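/- Let $d\in\{3,4,5\}$. Let $\mu$ be a probability measure on $\mathbb N=\{0,1,2,\dots\}$ with mean $1$ and finite variance, $\mu\neq\delta_1$. Let $\eta$ be a probability measure on $\mathbb Z^d$ such that the random walk on $\mathbb Z^d$ with jump distribution $\eta$ is irreducible and aperiodic, and such that $\eta$ has mean $0$ and finite moment of order $d+1$. Let $\theta$ be a probability measure on $\mathbb Z^d$ that is symmetric ($\theta(x)=\theta(-x)$ for all $x$), irreducible (in the same sense), and satisfies $\sum_x e^{c|x|}\theta(x)<\infty$ for some $c>0$. Let $(\mathcal T_k)_{k\ge 0}$ be independent Galton–Watson trees with offspring distribution $\mu$, and let $\mathcal T^{IGW}$ be the infinite tree obtained from an infinite ray $w_0,w_1,w_2,\dots$, rooted at $w_0$ and with $w_{k}$ the parent of $w_{k+1}$, by rooting $\mathcal T_k$ at $w_k$ for each $k\ge 0$. Independently of the tree, attach to its edges i.i.d. random variables with law $\theta$; for a vertex $u$ let $V_u\in\mathbb Z^d$ be the sum of these variables along the path from $w_0$ to $u$ (so $V_{w_0}=0$). Let $u_0,u_1,u_2,\dots$ be the vertices of $\mathcal T^{IGW}$ listed tree by tree,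 first those of $\mathcal T_0$, then those of $\mathcal T_1$, and so on, each tree being listed in depth-first (lexicographical) order from its root $w_k$. Put $R[0,n]=\{V_{u_0},\dots,V_{u_n}\}$. For a finite set $A\subset\mathbb Z^d$ let $$\mathrm{cap}_\eta(A)=\sum_{x\in A}P_x^{\eta}\big(S_n\notin A\text{ for all }n\ge 1\big),$$ where under $P_x^\eta$ the process $(S_n)_{n\ge0}$ is the random walk with jump distribution $\eta$ started at $x$. Then, almost surely, $$\mathrm{cap}_\eta\big(R[0,n]\big)=n^{\frac{d-2}{4}+o(1)}\qquad (n\to\infty),$$ that is, almost surely there is a (random) sequence $\varepsilon_n\to 0$ with $\mathrm{cap}_\eta(R[0,n])=n^{\frac{d-2}{4}+\varepsilon_n}$ for all sufficiently large $n$. -/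

import Mathlib

open MeasureTheory Filter Topology

noncomputable section

namespace BRWCapacity

/-- The lattice `ℤ^d`, with its discrete (product) σ-algebra. -/
abbrev Lattice (d : ℕ) : Type := Fin d → ℤ

/-- The Euclidean norm of a lattice point. -/
def euclNorm {d : ℕ} (x : Lattice d) : ℝ := Real.sqrt (∑ i, (x i : ℝ) ^ 2)

section RandomWalk

variable {d : ℕ}

/-- The trajectory `n ↦ x + ξ₀ + ⋯ + ξ_{n-1}` with starting point `x` and increments `ξ`. -/
def walkPath (x : Lattice d) (ξ : ℕ → Lattice d) (n : ℕ) : Lattice d :=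
  x + ∑ i ∈ Finset.range n, ξ i

theorem measurable_walkPath (x : Lattice d) : Measurable (walkPath x) := by
  refine measurable_pi_lambda _ fun n => ?_
  unfold walkPath
  fun_prop

/-- The law, on the space of trajectories, of the random walk with jump distribution `η`
started at `x`. -/
def walkLaw (η : Measure (Lattice d)) [IsProbabilityMeasure η] (x : Lattice d) :
    Measure (ℕ → Lattice d) :=
  (Measure.infinitePi fun _ : ℕ => η).map (walkPath x)

/-- The first return time `inf {n ≥ 1 : S n ∈ A}` of a trajectory `S` to `A`,
equal to `⊤` if there is no return. -/
def returnTime (A : Finset (Lattice d)) (S : ℕ → Lattice d) : ℕ∞ :=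
  ⨅ (n : ℕ) (_ : 1 ≤ n ∧ S n ∈ A), (n : ℕ∞)

/-- The `η`-capacity of a finite set. -/
def capacity (η : Measure (Lattice d)) [IsProbabilityMeasure η] (A : Finset (Lattice d)) : ℝ :=
  ∑ x ∈ A, (walkLaw η x).real {S | returnTime A S = ⊤}

/-- Every point is reached from every point with positive probability. -/
def IsIrreducible (η : Measure (Lattice d)) [IsProbabilityMeasure η] : Prop :=
  ∀ x y : Lattice d, ∃ n : ℕ, 0 < walkLaw η x {S | S n = y}

/-- The possible return times to the origin have greatest common divisor `1`. -/
def IsAperiodic (η : Measure (Lattice d)) [IsProbabilityMeasure η] : Prop :=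
  ∀ m : ℕ, (∀ n : ℕ, 1 ≤ n → 0 < walkLaw η 0 {S | S n = 0} → m ∣ n) → m = 1

end RandomWalk

section Forest

/-- Potential vertices of the forest. The pair `(k, [])` is the spine vertex `w_k`; the pair
`(k, j :: v)` is the child number `j` (counted from `0`) of the vertex `(k, v)` in the tree
attached to `w_k`. Thus `(k, v)` carries the Ulam–Harris word `v.reverse`. -/
abbrev Vertex : Type := ℕ × List ℕ

/-- Membership in the forest in which `(k, v)` has `N (k, v)` children inside its own tree. -/
def InForest (N : Vertex → ℕ) : Vertex → Prop
  | (_, []) => True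
  | (k, j :: v) => InForest N (k, v) ∧ j < N (k, v)

/-- Where the exploration continues once all descendants (in its own tree) of a vertex have been
visited: the next sibling of the vertex, or, if there is none, the same for its parent; when a
tree is exhausted, the next spine vertex. -/
def nextAfterSubtree (N : Vertex → ℕ) : Vertex → Vertex
  | (k, []) => (k + 1, [])
  | (k, j :: v) => if j + 1 < N (k, v) then (k, (j + 1) :: v) else nextAfterSubtree N (k, v)

/-- One step of the depth-first exploration: to the first child if there is one. -/
def dfsNext (N : Vertex → ℕ) (u : Vertex) : Vertex :=
  if 0 < N u then (u.1, 0 :: u.2) else nextAfterSubtree N u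

/-- The sequence `u₀, u₁, …` of the vertices in depth-first order. -/
def dfs (N : Vertex → ℕ) : ℕ → Vertex
  | 0 => (0, [])
  | i + 1 => dfsNext N (dfs N i)

/-- The lexicographical order: first the index of the tree, then the Ulam–Harris word. -/
def Precedes (u v : Vertex) : Prop :=
  u.1 < v.1 ∨ u.1 = v.1 ∧ u.2.reverse < v.2.reverse

theorem lex_append_of_not_prefix :
    ∀ {a b : List ℕ} (c : List ℕ), a < b → ¬ a <+: b → a ++ c < b
  | [], _, _, _, h => absurd (List.nil_prefix) h
  | _ :: _, [], _, h, _ => by simp at h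
  | x :: a, y :: b, c, h, h' => by
    rw [List.cons_append, List.cons_lt_cons_iff]
    rw [List.cons_lt_cons_iff] at h
    rcases h with h | ⟨rfl, h⟩
    · exact Or.inl h
    · exact Or.inr ⟨rfl, lex_append_of_not_prefix c h
        (fun hp => h' (by simpa using hp))⟩

theorem lex_append_left :
    ∀ (a : List ℕ) {b c : List ℕ}, a ++ b < a ++ c ↔ b < c
  | [], _, _ => Iff.rfl
  | x :: a, b, c => by
    simp [lex_append_left a]

theorem lex_lt_append : ∀ (a : List ℕ) (j : ℕ) (b : List ℕ), a < a ++ j :: b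
  | [], _, _ => by simp
  | x :: a, j, b => by
    rw [List.cons_append, List.cons_lt_cons_iff]
    exact Or.inr ⟨rfl, lex_lt_append a j b⟩

theorem nextAfterSubtree_spec (N : Vertex → ℕ) (k : ℕ) : ∀ w : List ℕ, InForest N (k, w) →
    InForest N (nextAfterSubtree N (k, w)) ∧
    (∀ t, Precedes (k, t ++ w) (nextAfterSubtree N (k, w))) ∧
    ∀ v, InForest N v → Precedes (k, w) v → ¬ (v.1 = k ∧ w.reverse <+: v.2.reverse) →
      v = nextAfterSubtree N (k, w) ∨ Precedes (nextAfterSubtree N (k, w)) v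
  | [], _ => by
    have hnext : nextAfterSubtree N (k, []) = (k + 1, []) := by simp [nextAfterSubtree]
    rw [hnext]
    refine ⟨by simp [InForest], by simp [Precedes], ?_⟩
    rintro ⟨l, v⟩ _ hp hn
    have hl : k < l := by
      rcases hp with h | ⟨h, -⟩
      · exact h
      · exact absurd ⟨h.symm, by simp⟩ hn
    rcases Nat.lt_or_ge (k + 1) l with h | h
    · exact Or.inr (Or.inl h)
    · obtain rfl : l = k + 1 := by omega
      cases v with
      | nil => exact Or.inl rfl
      | cons j v =>
        refine Or.inr (Or.inr ⟨rfl, ?_⟩)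
        simp only [List.reverse_nil, List.reverse_cons]
        rcases hv : v.reverse ++ [j] with _ | ⟨a, t⟩
        · simp at hv
        · simp
  | j :: w, hu => by
    obtain ⟨hw, hj⟩ : InForest N (k, w) ∧ j < N (k, w) := by simpa [InForest] using hu
    obtain ⟨ih1, ih2, ih3⟩ := nextAfterSubtree_spec N k w hw
    have key : ∀ v, InForest N v → Precedes (k, j :: w) v →
        ¬ (v.1 = k ∧ (j :: w).reverse <+: v.2.reverse) →
        (v.1 = k ∧ w.reverse <+: v.2.reverse) →
        ∃ a t, v = (k, t ++ a :: w) ∧ j < a ∧ a < N (k, w) := by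
      rintro ⟨l, v⟩ hv hp hn ⟨hl, hpre⟩
      obtain rfl : l = k := hl
      obtain ⟨t, ht⟩ := List.reverse_prefix.1 hpre
      have hp' : (j :: w).reverse < v.reverse := by
        rcases hp with h | ⟨-, h⟩
        · exact absurd h (lt_irrefl _)
        · exact h
      subst ht
      rcases List.eq_nil_or_concat t with rfl | ⟨t, a, rfl⟩
      · simp only [List.nil_append, List.reverse_cons] at hp'
        exact absurd hp' (lt_asymm (lex_lt_append _ _ _))
      · simp only [List.concat_eq_append, List.reverse_append, List.reverse_cons, List.reverse_nil,
          List.nil_append, List.singleton_append, lex_append_left, List.cons_lt_cons_iff] at hp'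
        have ha : a < N (l, w) := by
          have : ∀ t : List ℕ, InForest N (l, t ++ a :: w) → a < N (l, w) := by
            intro t
            induction t with
            | nil => intro h; simp only [List.nil_append, InForest] at h; exact h.2
            | cons b t ih => intro h; simp only [List.cons_append, InForest] at h; exact ih h.1
          exact this t (by simpa using hv)
        refine ⟨a, t, by simp, ?_, ha⟩
        rcases hp' with h | ⟨rfl, -⟩
        · exact h
        · exact absurd ⟨rfl, by simp⟩ hn
    have mono : ∀ v, Precedes (k, j :: w) v → Precedes (k, w) v := by
      rintro v (h | ⟨h, h'⟩)
      · exact Or.inl h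
      · refine Or.inr ⟨h, lt_trans ?_ h'⟩
        simpa using lex_lt_append w.reverse j []
    by_cases hs : j + 1 < N (k, w)
    · have hnext : nextAfterSubtree N (k, j :: w) = (k, (j + 1) :: w) := by
        simp [nextAfterSubtree, hs]
      rw [hnext]
      refine ⟨by simp [InForest, hw, hs], fun t => Or.inr ⟨rfl, ?_⟩, ?_⟩
      · simp [lex_append_left, List.cons_lt_cons_iff]
      · intro v hv hp hn
        by_cases hd : v.1 = k ∧ w.reverse <+: v.2.reverse
        · obtain ⟨a, t, rfl, hja, -⟩ := key v hv hp hn hd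
          rcases Nat.lt_or_ge (j + 1) a with h | h
          · refine Or.inr (Or.inr ⟨rfl, ?_⟩)
            simp [lex_append_left, List.cons_lt_cons_iff, h]
          · obtain rfl : a = j + 1 := by omega
            rcases List.eq_nil_or_concat t with rfl | ⟨t, b, rfl⟩
            · exact Or.inl rfl
            · refine Or.inr (Or.inr ⟨rfl, ?_⟩)
              simpa using lex_lt_append (w.reverse ++ [j + 1]) b t.reverse
        · rcases mono v hp with h | ⟨h, h'⟩
          · exact Or.inr (Or.inl h)
          · refine Or.inr (Or.inr ⟨h, ?_⟩)
            rw [List.reverse_cons]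
            exact lex_append_of_not_prefix _ h' (fun hc => hd ⟨h.symm, hc⟩)
    · have hnext : nextAfterSubtree N (k, j :: w) = nextAfterSubtree N (k, w) := by
        simp [nextAfterSubtree, hs]
      rw [hnext]
      have hnd : ∀ v, InForest N v → Precedes (k, j :: w) v →
          ¬ (v.1 = k ∧ (j :: w).reverse <+: v.2.reverse) →
          ¬ (v.1 = k ∧ w.reverse <+: v.2.reverse) := by
        intro v hv hp hn hd
        obtain ⟨a, t, -, h1, h2⟩ := key v hv hp hn hd
        omega
      refine ⟨ih1, fun t => ?_, fun v hv hp hn => ih3 v hv (mono v hp) (hnd v hv hp hn)⟩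
      simpa using ih2 (t ++ [j])

/-- The exploration starts at the root, stays in the forest, and `dfs N (i + 1)` is the least
vertex of the forest after `dfs N i` in the lexicographical order. -/
theorem dfs_spec (N : Vertex → ℕ) (i : ℕ) :
    InForest N (dfs N i) ∧ Precedes (dfs N i) (dfs N (i + 1)) ∧
    ∀ v, InForest N v → Precedes (dfs N i) v →
      v = dfs N (i + 1) ∨ Precedes (dfs N (i + 1)) v := by
  have step : ∀ u, InForest N u → InForest N (dfsNext N u) ∧ Precedes u (dfsNext N u) ∧
      ∀ v, InForest N v → Precedes u v → v = dfsNext N u ∨ Precedes (dfsNext N u) v := by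
    rintro ⟨k, w⟩ hu
    obtain ⟨h1, h2, h3⟩ := nextAfterSubtree_spec N k w hu
    by_cases hs : 0 < N (k, w)
    · have hnext : dfsNext N (k, w) = (k, 0 :: w) := by simp [dfsNext, hs]
      rw [hnext]
      have hlt : w.reverse < (0 :: w).reverse := by simpa using lex_lt_append w.reverse 0 []
      refine ⟨by simp [InForest, hu, hs], Or.inr ⟨rfl, hlt⟩, ?_⟩
      rintro ⟨l, v⟩ - (h | ⟨h, h'⟩)
      · exact Or.inr (Or.inl h)
      · obtain rfl : k = l := h
        by_cases hp : w.reverse <+: v.reverse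
        · obtain ⟨t, rfl⟩ := List.reverse_prefix.1 hp
          rcases List.eq_nil_or_concat t with rfl | ⟨t, a, rfl⟩
          · exact absurd h' (lt_irrefl _)
          · rcases Nat.eq_zero_or_pos a with rfl | ha
            · rcases List.eq_nil_or_concat t with rfl | ⟨t, b, rfl⟩
              · exact Or.inl rfl
              · refine Or.inr (Or.inr ⟨rfl, ?_⟩)
                have h := lex_lt_append (w.reverse ++ [0]) b t.reverse
                rw [List.append_assoc] at h
                simpa using h
            · refine Or.inr (Or.inr ⟨rfl, ?_⟩)
              simp [lex_append_left, List.cons_lt_cons_iff, ha]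
        · refine Or.inr (Or.inr ⟨rfl, ?_⟩)
          rw [List.reverse_cons]
          exact lex_append_of_not_prefix _ h' hp
    · have hnext : dfsNext N (k, w) = nextAfterSubtree N (k, w) := by simp [dfsNext, hs]
      rw [hnext]
      refine ⟨h1, by simpa using h2 [], fun v hv hp => h3 v hv hp ?_⟩
      rintro ⟨hl, hpre⟩
      obtain ⟨l, v⟩ := v
      obtain rfl : l = k := hl
      obtain ⟨t, rfl⟩ := List.reverse_prefix.1 hpre
      rcases List.eq_nil_or_concat t with rfl | ⟨t, a, rfl⟩
      · rcases hp with h | ⟨-, h⟩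
        · exact lt_irrefl _ h
        · exact lt_irrefl _ h
      · have : ∀ t : List ℕ, InForest N (l, t ++ a :: w) → a < N (l, w) := by
          intro t
          induction t with
          | nil => intro h; simp only [List.nil_append, InForest] at h; exact h.2
          | cons b t ih => intro h; simp only [List.cons_append, InForest] at h; exact ih h.1
        have := this t (by simpa using hv)
        omega
  have mem : ∀ i, InForest N (dfs N i) := by
    intro i
    induction i with
    | zero => simp [dfs, InForest]
    | succ i ih => exact (step _ ih).1
  exact ⟨mem i, (step _ (mem i)).2⟩

end Forest

section BranchingWalk

variable {d : ℕ}

/-- The position of a vertex: the sum of the displacements on the path from the root `(0, [])`.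
`X u` is the displacement on the edge between `u` and its parent; the parent of `(k + 1, [])` is
`(k, [])`. -/
def position (X : Vertex → Lattice d) : Vertex → Lattice d
  | (k, []) => ∑ i ∈ Finset.range k, X (i + 1, [])
  | (k, j :: v) => position X (k, v) + X (k, j :: v)

/-- The set `R[0,n]` of the positions of the first `n + 1` vertices in depth-first order. -/
def range (N : Vertex → ℕ) (X : Vertex → Lattice d) (n : ℕ) : Finset (Lattice d) :=
  (Finset.range (n + 1)).image fun i => position X (dfs N i)

/-- The law of the numbers of children and of the displacements: i.i.d. numbers of children with
law `μ` and, independently, i.i.d. displacements with law `θ`. -/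
def brwLaw (μ : Measure ℕ) [IsProbabilityMeasure μ] (θ : Measure (Lattice d))
    [IsProbabilityMeasure θ] : Measure ((Vertex → ℕ) × (Vertex → Lattice d)) :=
  (Measure.infinitePi fun _ : Vertex => μ).prod (Measure.infinitePi fun _ : Vertex => θ)

end BranchingWalk

end BRWCapacity

end

/-! The exponent comes from two scales. Up to factors n^δ with δ arbitrarily small, the first n
vertices lie in about n^(1/2) trees of height at most n^(1/2), and hence at positions within
distance n^(1/4) of the origin.

Upper bound. The last exit decomposition `sum_green_mul_escapeProb` expresses hitting probabilities
through the Green function and the escape probabilities. Summed over the starting points in a cube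
of side of order R, it shows that a subset of the cube has capacity O(R^(d-2)): the hitting
probabilities add up to at most O(R^d), while the walk spends a mean time of order at least R^2 in
the cube (`exists_ecapacity_le`). Then R is taken close to n^(1/4).

Lower bound. If E bounds the mutual Green energy of a family of points indexed by I, then |I|^2 is
at most 4 E times the capacity (`card_sq_le_mul_ecapacity`). As θ is symmetric, the difference of
the positions of two vertices at tree distance D is a θ-walk at time D (`map_position_sub`), and the
heat kernel bound `IsIrreducible.exists_convPow_le` for both walks gives a mean Green function of
order at most D^(-(d-2)/2) (`exists_lintegral_green_le`). A second moment computation over pairs of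
vertices, split at their last common ancestor, bounds the mean energy of the first M trees cut at
height M by O(M^(4-(d-2)/2)) (`exists_lintegral_energy_le`); here (d-2)/4 < 1 is needed. With M near
n^(1/2) the energy is near n^(2-(d-2)/4), and n^2 divided by it has the right exponent.

Localisation. A variance bound shows that the first n^(1/2+δ) trees contain more than n vertices
(`childLaw_truncCount_le`), Kolmogorov's estimate that they stay below height n^(1/2+2δ)
(`survival_le`), and an exponential Chebyshev bound controls the displacements
(`exists_brwLaw_displacement_le`). Each bad event has probability O(n^(-δ)). This is summable along
powers of two, and capacity is monotone in the set (`ecapacity_mono`), so Borel–Cantelli along these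
powers controls all n. -/

open scoped ENNReal

noncomputable section

namespace BRWCapacity

/-! ### Green function, last exit decomposition, monotonicity of capacity. -/

section Walk

variable {d : ℕ}

/-- The `n`-fold convolution power of a measure, the law of the walk at time `n`. -/
def convPow (η : Measure (Lattice d)) : ℕ → Measure (Lattice d)
  | 0 => Measure.dirac 0
  | n + 1 => η ∗ convPow η n

instance isProbabilityMeasure_convPow (η : Measure (Lattice d)) [IsProbabilityMeasure η] (n : ℕ) :
    IsProbabilityMeasure (convPow η n) := by
  induction n with
  | zero => unfold convPow; infer_instance
  | succ n ih => unfold convPow; infer_instance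

theorem conv_singleton {M : Type*} [AddCommGroup M] [MeasurableSpace M] [MeasurableAdd₂ M]
    [DiscreteMeasurableSpace M] (ρ ν : Measure M) [SFinite ν] (z : M) :
    (ρ ∗ ν) {z} = ∫⁻ x, ν {z - x} ∂ρ := by
  rw [← lintegral_indicator_one (measurableSet_singleton z),
    Measure.lintegral_conv (Measurable.of_discrete)]
  refine lintegral_congr fun x => ?_
  rw [← lintegral_indicator_one (measurableSet_singleton _)]
  refine lintegral_congr fun y => ?_
  have h : x + y ∈ ({z} : Set M) ↔ y ∈ ({z - x} : Set M) := by
    simp only [Set.mem_singleton_iff, eq_sub_iff_add_eq, add_comm x y]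
  by_cases hy : y ∈ ({z - x} : Set M)
  · rw [Set.indicator_of_mem hy, Set.indicator_of_mem (h.2 hy)]; rfl
  · rw [Set.indicator_of_notMem hy, Set.indicator_of_notMem (mt h.1 hy)]

theorem convPow_add (η : Measure (Lattice d)) [IsProbabilityMeasure η] (m n : ℕ) :
    convPow η (m + n) = convPow η m ∗ convPow η n := by
  induction m with
  | zero => simp [convPow]
  | succ m ih => rw [Nat.succ_add, convPow, ih, convPow, Measure.conv_assoc]

theorem map_neg_conv (ρ ν : Measure (Lattice d)) [SFinite ρ] [SFinite ν] :
    (ρ ∗ ν).map (fun x => -x) = ρ.map (fun x => -x) ∗ ν.map (fun x => -x) := by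
  unfold Measure.conv
  rw [Measure.map_prod_map _ _ (by fun_prop) (by fun_prop), Measure.map_map (by fun_prop)
    (by fun_prop), Measure.map_map (by fun_prop) (by fun_prop)]
  congr 1
  ext x : 1
  simp [add_comm]

theorem convPow_map_neg (η : Measure (Lattice d)) [IsProbabilityMeasure η] (n : ℕ) :
    convPow (η.map fun x => -x) n = (convPow η n).map fun x => -x := by
  induction n with
  | zero => simp [convPow, Measure.map_dirac' measurable_neg]
  | succ n ih => rw [convPow, ih, convPow, map_neg_conv]

/-- Prepending a coordinate carries ν times the product law to the product law, as both give the
same mass to finite boxes. Splitting off the first coordinate undoes prepending. -/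
theorem infinitePi_map_zero_shift {E : Type*} [MeasurableSpace E] (ν : Measure E)
    [IsProbabilityMeasure ν] :
    (Measure.infinitePi fun _ : ℕ => ν).map (fun ξ => (ξ 0, fun n => ξ (n + 1))) =
      ν.prod (Measure.infinitePi fun _ : ℕ => ν) := by
  have hcons : (ν.prod (Measure.infinitePi fun _ : ℕ => ν)).map
      (fun p n => Nat.casesOn (motive := fun _ => E) n p.1 p.2) =
      Measure.infinitePi fun _ : ℕ => ν := by
    have hm : Measurable (fun (p : E × (ℕ → E)) n =>
        Nat.casesOn (motive := fun _ => E) n p.1 p.2) := by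
      refine measurable_pi_lambda _ fun n => ?_
      cases n <;> simp only <;> fun_prop
    refine Measure.eq_infinitePi _ fun s t ht => ?_
    rw [Measure.map_apply hm (MeasurableSet.pi s.countable_toSet fun i _ => ht i)]
    set s' : Finset ℕ := s.preimage Nat.succ (Nat.succ_injective.injOn) with hs'
    by_cases h0 : 0 ∈ s
    · have : (fun (p : E × (ℕ → E)) n => Nat.casesOn (motive := fun _ => E) n p.1 p.2) ⁻¹'
          (Set.pi s t) = t 0 ×ˢ (Set.pi s' fun n => t (n + 1)) := by
        ext p
        simp only [Set.mem_preimage, Set.mem_pi, Set.mem_prod, Finset.mem_coe, hs',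
          Finset.mem_preimage]
        constructor
        · intro h
          exact ⟨h 0 h0, fun n hn => h (n + 1) hn⟩
        · rintro ⟨h1, h2⟩ n hn
          cases n with
          | zero => exact h1
          | succ n => exact h2 n hn
      rw [this, Measure.prod_prod, Measure.infinitePi_pi _ (fun i _ => ht _)]
      have hs : s = insert 0 (s'.image Nat.succ) := by
        ext n
        cases n <;> simp [hs', h0]
      rw [hs, Finset.prod_insert (by simp), Finset.prod_image (Nat.succ_injective.injOn)]
    · have : (fun (p : E × (ℕ → E)) n => Nat.casesOn (motive := fun _ => E) n p.1 p.2) ⁻¹'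
          (Set.pi s t) = Set.univ ×ˢ (Set.pi s' fun n => t (n + 1)) := by
        ext p
        simp only [Set.mem_preimage, Set.mem_pi, Set.mem_prod, Finset.mem_coe, hs',
          Finset.mem_preimage, Set.mem_univ, true_and]
        constructor
        · intro h n hn
          exact h (n + 1) hn
        · rintro h2 n hn
          cases n with
          | zero => exact absurd hn h0
          | succ n => exact h2 n hn
      rw [this, Measure.prod_prod, Measure.infinitePi_pi _ (fun i _ => ht _), measure_univ, one_mul]
      have hs : s = s'.image Nat.succ := by
        ext n
        cases n <;> simp [hs', h0]
      rw [hs, Finset.prod_image (Nat.succ_injective.injOn)]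
  have hm : Measurable (fun (p : E × (ℕ → E)) n =>
        Nat.casesOn (motive := fun _ => E) n p.1 p.2) := by
      refine measurable_pi_lambda _ fun n => ?_
      cases n <;> simp only <;> fun_prop
  conv_lhs => rw [← hcons]
  rw [Measure.map_map (by fun_prop) hm]
  exact Measure.map_id

/-- The law of the sequence of increments of the walk. -/
abbrev stepsLaw (η : Measure (Lattice d)) [IsProbabilityMeasure η] : Measure (ℕ → Lattice d) :=
  Measure.infinitePi fun _ : ℕ => η

theorem walkPath_succ' (x : Lattice d) (ξ : ℕ → Lattice d) (n : ℕ) :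
    walkPath x ξ (n + 1) = walkPath (x + ξ 0) (fun n => ξ (n + 1)) n := by
  simp [walkPath, Finset.sum_range_succ', add_comm, add_left_comm]

@[fun_prop]
theorem measurable_walkPath_apply (x : Lattice d) (n : ℕ) :
    Measurable fun ξ : ℕ → Lattice d => walkPath x ξ n :=
  (measurable_pi_apply n).comp (measurable_walkPath x)

/-- The Markov property at time one: the first step is integrated out, the later ones are again
i.i.d. -/
theorem stepsLaw_succ (η : Measure (Lattice d)) [IsProbabilityMeasure η]
    (s : Lattice d → Set (ℕ → Lattice d)) (hs : ∀ z, MeasurableSet (s z)) :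
    stepsLaw η {ξ | (fun n => ξ (n + 1)) ∈ s (ξ 0)} = ∫⁻ z, stepsLaw η (s z) ∂η := by
  have hmeas : MeasurableSet {p : Lattice d × (ℕ → Lattice d) | p.2 ∈ s p.1} := by
    have : {p : Lattice d × (ℕ → Lattice d) | p.2 ∈ s p.1} = ⋃ z, {z} ×ˢ s z := by
      ext p; simp
    rw [this]
    exact MeasurableSet.iUnion fun z => (measurableSet_singleton z).prod (hs z)
  have h := infinitePi_map_zero_shift η
  have h2 : stepsLaw η {ξ | (fun n => ξ (n + 1)) ∈ s (ξ 0)} =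
      ((stepsLaw η).map (fun ξ => (ξ 0, fun n => ξ (n + 1)))) {p | p.2 ∈ s p.1} := by
    rw [Measure.map_apply (by fun_prop) hmeas]; rfl
  rw [h2, h, Measure.prod_apply hmeas]
  rfl

/-- The probability, from `y`, of never returning to `A`. -/
def escapeProb (η : Measure (Lattice d)) [IsProbabilityMeasure η] (A : Finset (Lattice d))
    (y : Lattice d) : ℝ≥0∞ :=
  stepsLaw η {ξ | ∀ m, 1 ≤ m → walkPath y ξ m ∉ A}

theorem measurableSet_escape (A : Finset (Lattice d)) (x y : Lattice d) (n : ℕ) :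
    MeasurableSet {ξ : ℕ → Lattice d |
      walkPath x ξ n = y ∧ ∀ m, 1 ≤ m → walkPath x ξ (n + m) ∉ A} := by
  have : {ξ : ℕ → Lattice d | walkPath x ξ n = y ∧ ∀ m, 1 ≤ m → walkPath x ξ (n + m) ∉ A} =
    {ξ | walkPath x ξ n ∈ ({y} : Set (Lattice d))} ∩ ⋂ m, ⋂ (_ : 1 ≤ m),
      {ξ | walkPath x ξ (n + m) ∈ (A : Set (Lattice d))}ᶜ := by
    ext ξ; simp
  rw [this]
  refine MeasurableSet.inter (measurable_walkPath_apply x n (measurableSet_singleton y)) ?_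
  refine MeasurableSet.iInter fun m => MeasurableSet.iInter fun _ => MeasurableSet.compl ?_
  exact measurable_walkPath_apply x (n + m) (Finset.measurableSet A)

/-- The Markov property at time n, obtained by splitting off the first step n times. It is the
summand of the last exit decomposition. -/
theorem stepsLaw_last_visit (η : Measure (Lattice d)) [IsProbabilityMeasure η]
    (A : Finset (Lattice d)) (y : Lattice d) (n : ℕ) : ∀ x : Lattice d,
    stepsLaw η {ξ | walkPath x ξ n = y ∧ ∀ m, 1 ≤ m → walkPath x ξ (n + m) ∉ A} =
      convPow η n {y - x} * escapeProb η A y := by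
  induction n with
  | zero =>
    intro x
    by_cases h : x = y
    · subst h
      simp [convPow, walkPath, escapeProb]
    · have h' : (0 : Lattice d) ≠ y - x := fun h0 => h (sub_eq_zero.1 h0.symm).symm
      simp [convPow, walkPath, h, h']
  | succ n ih =>
    intro x
    have h1 : {ξ : ℕ → Lattice d | walkPath x ξ (n + 1) = y ∧
        ∀ m, 1 ≤ m → walkPath x ξ (n + 1 + m) ∉ A} =
        {ξ | (fun n => ξ (n + 1)) ∈ {ζ | walkPath (x + ξ 0) ζ n = y ∧
          ∀ m, 1 ≤ m → walkPath (x + ξ 0) ζ (n + m) ∉ A}} := by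
      ext ξ
      simp only [Set.mem_ofPred_eq, Nat.succ_add_eq_add_succ n]
      simp only [Nat.succ_eq_add_one, ← add_assoc, walkPath_succ']
    rw [h1, stepsLaw_succ η (fun z => {ζ | walkPath (x + z) ζ n = y ∧
          ∀ m, 1 ≤ m → walkPath (x + z) ζ (n + m) ∉ A})
          (fun z => measurableSet_escape A (x + z) y n)]
    simp_rw [ih]
    rw [lintegral_mul_const _ Measurable.of_discrete, convPow, conv_singleton]
    simp_rw [sub_sub]

theorem stepsLaw_walkPath_eq (η : Measure (Lattice d)) [IsProbabilityMeasure η]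
    (x y : Lattice d) (n : ℕ) :
    stepsLaw η {ξ | walkPath x ξ n = y} = convPow η n {y - x} := by
  have h := stepsLaw_last_visit η ∅ y n x
  simpa [escapeProb] using h

/-- The Green function of the walk. -/
def green (η : Measure (Lattice d)) (z : Lattice d) : ℝ≥0∞ := ∑' n, convPow η n {z}

theorem green_map_neg (η : Measure (Lattice d)) [IsProbabilityMeasure η] (z : Lattice d) :
    green (η.map fun x => -x) z = green η (-z) := by
  unfold green
  congr with n
  rw [convPow_map_neg, Measure.map_apply measurable_neg (measurableSet_singleton z)]
  congr 1
  ext x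
  simp

/-- The probability of hitting `A` from `x`. -/
def hitProb (η : Measure (Lattice d)) [IsProbabilityMeasure η] (A : Finset (Lattice d))
    (x : Lattice d) : ℝ≥0∞ :=
  stepsLaw η {ξ | ∃ n, walkPath x ξ n ∈ A}

theorem hitProb_le_one (η : Measure (Lattice d)) [IsProbabilityMeasure η] (A : Finset (Lattice d))
    (x : Lattice d) : hitProb η A x ≤ 1 := prob_le_one

theorem hitProb_of_mem (η : Measure (Lattice d)) [IsProbabilityMeasure η] {A : Finset (Lattice d)}
    {x : Lattice d} (hx : x ∈ A) : hitProb η A x = 1 := by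
  have : {ξ : ℕ → Lattice d | ∃ n, walkPath x ξ n ∈ A} = Set.univ := by
    refine Set.eq_univ_of_forall fun ξ => ⟨0, ?_⟩
    simpa [walkPath] using hx
  rw [hitProb, this, measure_univ]

/-- The last exit decomposition. -/
theorem sum_green_mul_escapeProb (η : Measure (Lattice d)) [IsProbabilityMeasure η]
    (hG : ∀ z, green η z ≠ ∞) (A : Finset (Lattice d)) (x : Lattice d) :
    ∑ y ∈ A, green η (y - x) * escapeProb η A y = hitProb η A x := by
  classical
  -- The event that the last visit to `A` is at a given point and time. These events are disjoint,
  -- and their probabilities sum to the left-hand side.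
  set L : A × ℕ → Set (ℕ → Lattice d) := fun p =>
    {ξ | walkPath x ξ p.2 = p.1 ∧ ∀ m, 1 ≤ m → walkPath x ξ (p.2 + m) ∉ A} with hL
  have hdisj : Pairwise (Function.onFun Disjoint L) := by
    rintro ⟨⟨y, hy⟩, n⟩ ⟨⟨y', hy'⟩, n'⟩ hne
    refine Set.disjoint_left.2 ?_
    rintro ξ ⟨h1, h2⟩ ⟨h1', h2'⟩
    simp only at h1 h2 h1' h2'
    rcases lt_trichotomy n n' with h | h | h
    · refine h2 (n' - n) (by omega) ?_
      rw [show n + (n' - n) = n' by omega, h1']; exact hy'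
    · subst h
      refine hne ?_
      subst h1 h1'
      rfl
    · refine h2' (n - n') (by omega) ?_
      rw [show n' + (n - n') = n by omega, h1]; exact hy
  have hsum : stepsLaw η (⋃ p, L p) = ∑ y ∈ A, green η (y - x) * escapeProb η A y := by
    rw [measure_iUnion hdisj (fun p => measurableSet_escape A x p.1 p.2)]
    simp only [hL]
    simp_rw [stepsLaw_last_visit]
    rw [ENNReal.tsum_prod', tsum_fintype]
    rw [Finset.sum_coe_sort A (fun y => ∑' n, convPow η n {y - x} * escapeProb η A y)]
    refine Finset.sum_congr rfl fun y _ => ?_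
    rw [ENNReal.tsum_mul_right, green]
  rw [← hsum, hitProb]
  -- Borel–Cantelli: finiteness of the Green function makes the visits to `A` finite in number, so a
  -- path that hits `A` has a last visit.
  have hfin : ∀ᵐ ξ ∂(stepsLaw η), ∀ᶠ n in atTop, walkPath x ξ n ∉ A := by
    refine ae_eventually_notMem (s := fun n => {ξ | walkPath x ξ n ∈ A}) ?_
    have : ∀ n, stepsLaw η {ξ | walkPath x ξ n ∈ A} ≤ ∑ y ∈ A, convPow η n {y - x} := by
      intro n
      have h : {ξ : ℕ → Lattice d | walkPath x ξ n ∈ A} ⊆ ⋃ y ∈ A, {ξ | walkPath x ξ n = y} := by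
        intro ξ hξ
        simpa using hξ
      refine (measure_mono h).trans ((measure_biUnion_finset_le _ _).trans ?_)
      simp_rw [stepsLaw_walkPath_eq]
      exact le_rfl
    refine ne_top_of_le_ne_top ?_ (ENNReal.tsum_le_tsum this)
    rw [Summable.tsum_finsetSum (fun _ _ => ENNReal.summable)]
    exact ENNReal.sum_ne_top.2 fun y _ => hG (y - x)
  refine measure_congr ?_
  filter_upwards [hfin] with ξ hξ
  refine propext ⟨fun h => ?_, fun h => ?_⟩
  · obtain ⟨⟨y, n⟩, h, -⟩ := Set.mem_iUnion.1 h
    refine ⟨n, ?_⟩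
    simp only at h
    rw [h]; exact y.2
  · obtain ⟨n₀, hn₀⟩ := h
    have hex : ∃ N, ∀ n, N ≤ n → walkPath x ξ n ∉ A := eventually_atTop.1 hξ
    obtain ⟨N, hN⟩ : ∃ N, N = Nat.find hex := ⟨_, rfl⟩
    have hspec := Nat.find_spec hex
    rw [← hN] at hspec
    have hpos : N ≠ 0 := by
      rintro rfl
      exact hspec n₀ (Nat.zero_le _) hn₀
    -- `N` is the least time from which `A` is avoided, so the last visit is at time `N - 1`.
    obtain ⟨n, rfl⟩ := Nat.exists_eq_succ_of_ne_zero hpos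
    have hn : walkPath x ξ n ∈ A := by
      by_contra hcon
      refine Nat.find_min hex (m := n) (by omega) fun k hk => ?_
      rcases hk.eq_or_lt with rfl | hk
      · exact hcon
      · exact hspec k hk
    exact Set.mem_iUnion.2 ⟨(⟨walkPath x ξ n, hn⟩, n), rfl, fun m hm => hspec _ (by simp; omega)⟩

/-- The capacity as an extended nonnegative number. -/
def ecapacity (η : Measure (Lattice d)) [IsProbabilityMeasure η] (A : Finset (Lattice d)) : ℝ≥0∞ :=
  ∑ x ∈ A, escapeProb η A x

theorem returnTime_eq_top (A : Finset (Lattice d)) (S : ℕ → Lattice d) :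
    returnTime A S = ⊤ ↔ ∀ m, 1 ≤ m → S m ∉ A := by
  simp only [returnTime, iInf_eq_top, ENat.natCast_ne_top, imp_false, not_and]

theorem walkLaw_escape (η : Measure (Lattice d)) [IsProbabilityMeasure η]
    (A : Finset (Lattice d)) (x : Lattice d) :
    walkLaw η x {S | returnTime A S = ⊤} = escapeProb η A x := by
  rw [walkLaw, Measure.map_apply (measurable_walkPath x)]
  · simp only [returnTime_eq_top]; rfl
  · have : {S : ℕ → Lattice d | returnTime A S = ⊤} =
      ⋂ m, ⋂ (_ : 1 ≤ m), {S | S m ∈ (A : Set (Lattice d))}ᶜ := by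
      ext S; simp [returnTime_eq_top]
    rw [this]
    refine MeasurableSet.iInter fun m => MeasurableSet.iInter fun _ => MeasurableSet.compl ?_
    exact measurable_pi_apply m (Finset.measurableSet A)

theorem escapeProb_ne_top (η : Measure (Lattice d)) [IsProbabilityMeasure η]
    (A : Finset (Lattice d)) (x : Lattice d) : escapeProb η A x ≠ ∞ := measure_ne_top _ _

theorem ecapacity_ne_top (η : Measure (Lattice d)) [IsProbabilityMeasure η]
    (A : Finset (Lattice d)) : ecapacity η A ≠ ∞ :=
  ENNReal.sum_ne_top.2 fun x _ => escapeProb_ne_top η A x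

theorem capacity_eq_toReal (η : Measure (Lattice d)) [IsProbabilityMeasure η]
    (A : Finset (Lattice d)) : capacity η A = (ecapacity η A).toReal := by
  rw [ecapacity, ENNReal.toReal_sum fun x _ => escapeProb_ne_top η A x]
  simp_rw [capacity, Measure.real, walkLaw_escape]

instance isProbabilityMeasure_map_neg (η : Measure (Lattice d)) [IsProbabilityMeasure η] :
    IsProbabilityMeasure (η.map fun x => -x) :=
  Measure.isProbabilityMeasure_map (by fun_prop)

/-- Duality of the walk and its reversal, whose Green kernels are transposes of each other. Each
term of the left side is multiplied by 1, written as the probability that the reversed walk from a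
point of `A` hits `B`; after exchanging the sums the inner one is a hitting probability of `A`,
hence at most 1. -/
theorem ecapacity_le_ecapacity_map_neg (η : Measure (Lattice d)) [IsProbabilityMeasure η]
    (hG : ∀ z, green η z ≠ ∞) {A B : Finset (Lattice d)} (hAB : A ⊆ B) :
    ecapacity η A ≤ ecapacity (η.map fun x => -x) B := by
  have hG' : ∀ z, green (η.map fun x => -x) z ≠ ∞ := fun z => by
    rw [green_map_neg]; exact hG _
  calc ecapacity η A = ∑ x ∈ A, escapeProb η A x *
        ∑ y ∈ B, green (η.map fun x => -x) (y - x) * escapeProb (η.map fun x => -x) B y := by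
        refine Finset.sum_congr rfl fun x hx => ?_
        rw [sum_green_mul_escapeProb _ hG', hitProb_of_mem _ (hAB hx), mul_one]
    _ = ∑ y ∈ B, escapeProb (η.map fun x => -x) B y *
        ∑ x ∈ A, green η (x - y) * escapeProb η A x := by
        simp_rw [Finset.mul_sum]
        rw [Finset.sum_comm]
        refine Finset.sum_congr rfl fun y _ => Finset.sum_congr rfl fun x _ => ?_
        rw [green_map_neg, neg_sub]
        ring
    _ ≤ ∑ y ∈ B, escapeProb (η.map fun x => -x) B y := by
        refine Finset.sum_le_sum fun y _ => ?_
        rw [sum_green_mul_escapeProb η hG]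
        exact mul_le_of_le_one_right' (hitProb_le_one η A y)

/-- The comparison is applied twice: once to enlarge the set at the price of reversing the walk,
once with equal sets to reverse it back. -/
theorem ecapacity_mono (η : Measure (Lattice d)) [IsProbabilityMeasure η]
    (hG : ∀ z, green η z ≠ ∞) {A B : Finset (Lattice d)} (hAB : A ⊆ B) :
    ecapacity η A ≤ ecapacity η B := by
  refine (ecapacity_le_ecapacity_map_neg η hG hAB).trans ?_
  have hG' : ∀ z, green (η.map fun x => -x) z ≠ ∞ := fun z => by
    rw [green_map_neg]; exact hG _
  have hη : (η.map fun x => -x).map (fun x => -x) = η := by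
    rw [Measure.map_map (by fun_prop) (by fun_prop)]
    convert Measure.map_id
    ext x : 1; simp
  have h := ecapacity_le_ecapacity_map_neg (η.map fun x => -x) hG' (Finset.Subset.refl B)
  simpa only [hη] using h

end Walk

/-! ### Lower bound by the energy, upper bound by the radius. -/

section CapacityBounds

variable {d : ℕ}

theorem one_le_green_zero (η : Measure (Lattice d)) : 1 ≤ green η 0 := by
  refine le_trans ?_ (ENNReal.le_tsum 0)
  simp [convPow]

/-- A lower bound for the capacity of a set of points in terms of their mutual energy. -/
theorem card_sq_le_mul_ecapacity (η : Measure (Lattice d)) [IsProbabilityMeasure η]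
    (hG : ∀ z, green η z ≠ ∞) {ι : Type*} (I : Finset ι) (V : ι → Lattice d) (E : ℝ≥0∞)
    (hE : ∑ j ∈ I, ∑ i ∈ I, green η (V j - V i) ≤ E) :
    (I.card : ℝ≥0∞) ^ 2 ≤ 4 * E * ecapacity η (I.image V) := by
  classical
  rcases I.eq_empty_or_nonempty with rfl | hI
  · simp
  set g : ι → ℝ≥0∞ := fun j => ∑ i ∈ I, green η (V j - V i) with hg
  have hg1 : ∀ j ∈ I, 1 ≤ g j := by
    intro j hj
    refine (one_le_green_zero η).trans ?_
    have := Finset.single_le_sum (f := fun i => green η (V j - V i)) (fun _ _ => zero_le) hj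
    simpa using this
  have hEpos : E ≠ 0 := by
    obtain ⟨j, hj⟩ := hI
    have h1 : 1 ≤ E :=
      ((hg1 j hj).trans (Finset.single_le_sum (f := g) (fun _ _ => zero_le) hj)).trans hE
    exact (zero_lt_one.trans_le h1).ne'
  -- An infinite bound may be replaced by the energy itself, which is a finite sum of finite terms.
  wlog hEtop : E ≠ ∞ generalizing E
  · refine this (∑ j ∈ I, g j) le_rfl ?_ ?_ |>.trans ?_
    · obtain ⟨j, hj⟩ := hI
      exact (zero_lt_one.trans_le ((hg1 j hj).trans
        (Finset.single_le_sum (f := g) (fun _ _ => zero_le) hj))).ne'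
    · exact ENNReal.sum_ne_top.2 fun j _ => ENNReal.sum_ne_top.2 fun i _ => hG _
    · gcongr
  -- The indices whose potential is at most twice E / |I|; by Markov's inequality they form at least
  -- half of `I`.
  set J := I.filter fun j => g j * I.card ≤ 2 * E with hJ
  have hbad : 2 * ((I \ J).card : ℝ≥0∞) ≤ I.card := by
    have h1 : ((I \ J).card : ℝ≥0∞) * (2 * E) ≤ E * I.card := by
      calc ((I \ J).card : ℝ≥0∞) * (2 * E) = ∑ j ∈ I \ J, 2 * E := by simp
        _ ≤ ∑ j ∈ I \ J, g j * I.card := by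
          refine Finset.sum_le_sum fun j hj => ?_
          simp only [hJ, Finset.mem_sdiff, Finset.mem_filter, not_and, not_le] at hj
          exact (hj.2 hj.1).le
        _ ≤ ∑ j ∈ I, g j * I.card := Finset.sum_le_sum_of_subset Finset.sdiff_subset
        _ = (∑ j ∈ I, g j) * I.card := by rw [Finset.sum_mul]
        _ ≤ E * I.card := by gcongr
    have h2 : E * (2 * ((I \ J).card : ℝ≥0∞)) ≤ E * I.card := by
      refine le_trans (le_of_eq ?_) h1
      ring
    exact (ENNReal.mul_le_mul_iff_right hEpos hEtop).1 h2
  have hcard : (I.card : ℝ≥0∞) ≤ 2 * J.card := by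
    have h1 : 2 * (I \ J).card ≤ I.card := by exact_mod_cast hbad
    have h2 : (I \ J).card + J.card = I.card := by
      rw [Finset.card_sdiff_add_card_eq_card (Finset.filter_subset _ _)]
    have : I.card ≤ 2 * J.card := by omega
    exact_mod_cast this
  -- Every point of `A` hits `A` with probability 1, so |J| is a sum of hitting probabilities. By
  -- the last exit decomposition it is the sum over y in `A` of the escape probability times the
  -- potential of `J` at y, and by the choice of `J` that potential is at most 2E / |I|.
  have hmain : (J.card : ℝ≥0∞) * I.card ≤ 2 * E * ecapacity η (J.image V) := by
    set A := J.image V with hA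
    calc (J.card : ℝ≥0∞) * I.card = (∑ i ∈ J, hitProb η A (V i)) * I.card := by
          rw [Finset.sum_congr rfl fun i hi => hitProb_of_mem η (Finset.mem_image_of_mem V hi)]
          simp
      _ = ∑ y ∈ A, escapeProb η A y * ((∑ i ∈ J, green η (y - V i)) * I.card) := by
          simp_rw [← sum_green_mul_escapeProb η hG]
          rw [Finset.sum_comm, Finset.sum_mul]
          refine Finset.sum_congr rfl fun y _ => ?_
          rw [← Finset.sum_mul]
          ring
      _ ≤ ∑ y ∈ A, escapeProb η A y * (2 * E) := by
          refine Finset.sum_le_sum fun y hy => ?_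
          obtain ⟨j, hj, rfl⟩ := Finset.mem_image.1 hy
          refine mul_le_mul_right (le_trans ?_ (Finset.mem_filter.1 hj).2) _
          gcongr
          exact Finset.sum_le_sum_of_subset (Finset.filter_subset _ _)
      _ = 2 * E * ecapacity η A := by rw [← Finset.sum_mul, ecapacity, mul_comm]
  calc (I.card : ℝ≥0∞) ^ 2 = I.card * I.card := sq _
    _ ≤ 2 * J.card * I.card := by gcongr
    _ = 2 * (J.card * I.card) := by ring
    _ ≤ 2 * (2 * E * ecapacity η (J.image V)) := by gcongr
    _ = 4 * E * ecapacity η (J.image V) := by ring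
    _ ≤ 4 * E * ecapacity η (I.image V) := by
      gcongr
      exact ecapacity_mono η hG (Finset.image_subset_image (Finset.filter_subset _ _))

theorem map_walkPath_eq_convPow (η : Measure (Lattice d)) [IsProbabilityMeasure η] (n : ℕ) :
    (stepsLaw η).map (fun ξ => walkPath 0 ξ n) = convPow η n := by
  refine Measure.ext_of_singleton fun y => ?_
  rw [Measure.map_apply (by fun_prop) (measurableSet_singleton y)]
  have h := stepsLaw_walkPath_eq η 0 y n
  rw [sub_zero] at h
  exact h

/-- Chebyshev's inequality for a sum of m independent centred variables, whose variances add. -/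
theorem convPow_chebyshev (η : Measure (Lattice d)) [IsProbabilityMeasure η] (i : Fin d)
    (hmean : ∫ x, (x i : ℝ) ∂η = 0) (hL2 : MemLp (fun x : Lattice d => (x i : ℝ)) 2 η)
    (m : ℕ) {r : ℝ} (hr : 0 < r) :
    convPow η m {z | r ≤ |(z i : ℝ)|} ≤
      ENNReal.ofReal (m * (∫ x, (x i : ℝ) ^ 2 ∂η) / r ^ 2) := by
  have hlaw : ∀ j : ℕ, (stepsLaw η).map (fun ξ => ξ j) = η := fun j =>
    Measure.infinitePi_map_eval (fun _ : ℕ => η) j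
  have hmem : ∀ j : ℕ, MemLp (fun ξ : ℕ → Lattice d => ((ξ j) i : ℝ)) 2 (stepsLaw η) := by
    intro j
    have h := hL2
    rw [← hlaw j] at h
    exact h.comp_of_map (measurable_pi_apply j).aemeasurable
  have hint : ∀ (f : Lattice d → ℝ) (j : ℕ), ∫ ξ, f (ξ j) ∂(stepsLaw η) = ∫ x, f x ∂η := by
    intro f j
    conv_rhs => rw [← hlaw j]
    rw [integral_map (measurable_pi_apply j).aemeasurable
      (Measurable.of_discrete).aestronglyMeasurable]
  have hind : ProbabilityTheory.iIndepFun (fun (j : ℕ) (ξ : ℕ → Lattice d) => ((ξ j) i : ℝ))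
      (stepsLaw η) :=
    ProbabilityTheory.iIndepFun_infinitePi (X := fun _ (x : Lattice d) => ((x i : ℤ) : ℝ))
      (fun _ => Measurable.of_discrete)
  set Y : (ℕ → Lattice d) → ℝ := ∑ j ∈ Finset.range m, fun ξ => ((ξ j) i : ℝ) with hY
  have hYmem : MemLp Y 2 (stepsLaw η) := memLp_finsetSum' _ fun j _ => hmem j
  have hYmean : ∫ ξ, Y ξ ∂(stepsLaw η) = 0 := by
    simp only [hY, Finset.sum_apply]
    rw [integral_finsetSum _ fun j _ => (hmem j).integrable (by norm_num)]
    refine Finset.sum_eq_zero fun j _ => ?_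
    rw [hint (fun x => (x i : ℝ)) j, hmean]
  have hvar : ProbabilityTheory.variance Y (stepsLaw η) = m * ∫ x, (x i : ℝ) ^ 2 ∂η := by
    rw [hY, ProbabilityTheory.IndepFun.variance_sum (fun j _ => hmem j)
      (fun j _ k _ hjk => hind.indepFun hjk)]
    rw [Finset.sum_congr rfl (g := fun _ => ∫ x, (x i : ℝ) ^ 2 ∂η)]
    · simp
    · intro j _
      rw [ProbabilityTheory.variance_of_integral_eq_zero (hmem j).aemeasurable]
      · exact hint (fun x => (x i : ℝ) ^ 2) j
      · rw [hint (fun x => (x i : ℝ)) j, hmean]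
  have h := ProbabilityTheory.meas_ge_le_variance_div_sq hYmem hr
  rw [hYmean, hvar] at h
  refine le_trans (le_of_eq ?_) h
  rw [← map_walkPath_eq_convPow, Measure.map_apply (by fun_prop) (MeasurableSet.of_discrete)]
  congr 1
  ext ξ
  simp [walkPath, hY, Finset.sum_apply]

/-- The lattice points in the cube `[-R, R]^d`. -/
def box (d : ℕ) (R : ℕ) : Finset (Lattice d) :=
  Fintype.piFinset fun _ => Finset.Icc (-(R : ℤ)) R

theorem mem_box {R : ℕ} {x : Lattice d} : x ∈ box d R ↔ ∀ i, |x i| ≤ R := by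
  simp [box, abs_le]

theorem card_box (d R : ℕ) : (box d R).card = (2 * R + 1) ^ d := by
  simp only [box, Fintype.card_piFinset, Int.card_Icc, Finset.prod_const, Finset.card_univ,
    Fintype.card_fin]
  congr 1
  omega

/-- At each time up to a small multiple of R^2 the walk is in the cube with probability at least
1/2, and the right-hand side is the mean time spent there. -/
theorem exists_le_sum_green_box (η : Measure (Lattice d)) [IsProbabilityMeasure η]
    (hmean : ∀ i, ∫ x, (x i : ℝ) ∂η = 0)
    (hL2 : ∀ i, MemLp (fun x : Lattice d => (x i : ℝ)) 2 η) :
    ∃ c : ℝ, 0 < c ∧ ∀ R : ℕ,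
      ENNReal.ofReal (c * R ^ 2) ≤ ∑ z ∈ box d R, green η z := by
  set s : ℝ := ∑ i, ∫ x, (x i : ℝ) ^ 2 ∂η + 1 with hs
  have hs0 : 0 ≤ ∑ i, ∫ x, (x i : ℝ) ^ 2 ∂η :=
    Finset.sum_nonneg fun i _ => integral_nonneg fun x => sq_nonneg _
  have hspos : 0 < s := by linarith
  refine ⟨1 / (4 * s), by positivity, fun R => ?_⟩
  rcases Nat.eq_zero_or_pos R with rfl | hR
  · simp
  have hR' : (0 : ℝ) < R := by exact_mod_cast hR
  -- For m < T the Chebyshev bounds, summed over the coordinates, give at most 1/2.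
  set T := ⌊(R : ℝ) ^ 2 / (2 * s)⌋₊ + 1 with hT
  have hhalf : ∀ m ∈ Finset.range T, (1 / 2 : ℝ≥0∞) ≤ convPow η m (box d R) := by
    intro m hm
    have hm' : (m : ℝ) ≤ (R : ℝ) ^ 2 / (2 * s) := by
      have : m ≤ ⌊(R : ℝ) ^ 2 / (2 * s)⌋₊ := by
        simp only [hT, Finset.mem_range] at hm; omega
      exact (Nat.cast_le.2 this).trans (Nat.floor_le (by positivity))
    have hcompl : convPow η m (box d R : Set (Lattice d))ᶜ ≤ 1 / 2 := by
      have hsub : (box d R : Set (Lattice d))ᶜ ⊆ ⋃ i, {z | (R : ℝ) ≤ |(z i : ℝ)|} := by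
        intro z hz
        simp only [Set.mem_compl_iff, Finset.mem_coe, mem_box, not_forall, not_le] at hz
        obtain ⟨i, hi⟩ := hz
        refine Set.mem_iUnion.2 ⟨i, ?_⟩
        simp only [Set.mem_ofPred_eq]
        exact_mod_cast hi.le
      refine (measure_mono hsub).trans ((measure_iUnion_le _).trans ?_)
      rw [tsum_fintype]
      refine (Finset.sum_le_sum fun i _ =>
        convPow_chebyshev η i (hmean i) (hL2 i) m hR').trans ?_
      rw [← ENNReal.ofReal_sum_of_nonneg fun i _ => div_nonneg (mul_nonneg (Nat.cast_nonneg _)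
        (integral_nonneg fun x => sq_nonneg _)) (sq_nonneg _), ← Finset.sum_div, ← Finset.mul_sum]
      rw [show (1 / 2 : ℝ≥0∞) = ENNReal.ofReal (1 / 2) by
        rw [ENNReal.ofReal_div_of_pos (by norm_num)]; simp]
      refine ENNReal.ofReal_le_ofReal ?_
      rw [div_le_iff₀ (by positivity)]
      calc (m : ℝ) * ∑ i, ∫ x, (x i : ℝ) ^ 2 ∂η ≤ (R : ℝ) ^ 2 / (2 * s) * s := by
            gcongr
            rw [hs]; linarith
        _ = 1 / 2 * (R : ℝ) ^ 2 := by field_simp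
    have hadd := prob_add_prob_compl (μ := convPow η m) (Finset.measurableSet (box d R))
    by_contra hcon
    rw [not_le] at hcon
    have : convPow η m (box d R) + convPow η m (box d R : Set (Lattice d))ᶜ < 1 / 2 + 1 / 2 :=
      ENNReal.add_lt_add_of_lt_of_le (ne_top_of_le_ne_top (by simp) hcompl) hcon hcompl
    rw [hadd, ENNReal.add_halves] at this
    exact lt_irrefl _ this
  calc ENNReal.ofReal (1 / (4 * s) * R ^ 2) ≤ ENNReal.ofReal (T / 2) := by
        refine ENNReal.ofReal_le_ofReal ?_
        have : (R : ℝ) ^ 2 / (2 * s) ≤ T := by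
          rw [hT]; push_cast; exact (Nat.lt_floor_add_one _).le
        calc 1 / (4 * s) * (R : ℝ) ^ 2 = ((R : ℝ) ^ 2 / (2 * s)) / 2 := by field_simp; ring
          _ ≤ (T : ℝ) / 2 := by gcongr
    _ = ∑ m ∈ Finset.range T, (1 / 2 : ℝ≥0∞) := by
        rw [ENNReal.ofReal_div_of_pos (by norm_num)]
        simp [div_eq_mul_inv]
    _ ≤ ∑ m ∈ Finset.range T, convPow η m (box d R) := Finset.sum_le_sum hhalf
    _ ≤ ∑' m, convPow η m (box d R) := ENNReal.sum_le_tsum _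
    _ = ∑ z ∈ box d R, green η z := by
        simp_rw [green]
        rw [← Summable.tsum_finsetSum (fun _ _ => ENNReal.summable)]
        congr with m
        rw [sum_measure_singleton]

/-- The capacity of a subset of a cube is at most of the order of that of the cube. -/
theorem exists_ecapacity_le (η : Measure (Lattice d)) [IsProbabilityMeasure η] (hd : 2 ≤ d)
    (hG : ∀ z, green η z ≠ ∞) (hmean : ∀ i, ∫ x, (x i : ℝ) ∂η = 0)
    (hL2 : ∀ i, MemLp (fun x : Lattice d => (x i : ℝ)) 2 η) :
    ∃ C : ℝ, 0 < C ∧ ∀ (R : ℕ) (A : Finset (Lattice d)), 0 < R → A ⊆ box d R →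
      ecapacity η A ≤ ENNReal.ofReal (C * (R : ℝ) ^ (d - 2)) := by
  obtain ⟨c, hc, hgreen⟩ := exists_le_sum_green_box η hmean hL2
  refine ⟨5 ^ d / c, by positivity, fun R A hR hA => ?_⟩
  have hR' : (0 : ℝ) < R := by exact_mod_cast hR
  have hkey : ecapacity η A * ENNReal.ofReal (c * R ^ 2) ≤ ENNReal.ofReal ((5 * R) ^ d) := by
    calc ecapacity η A * ENNReal.ofReal (c * R ^ 2)
        ≤ ∑ y ∈ A, escapeProb η A y * ∑ x ∈ box d (2 * R), green η (y - x) := by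
          rw [ecapacity, Finset.sum_mul]
          refine Finset.sum_le_sum fun y hy => ?_
          gcongr
          refine (hgreen R).trans ?_
          -- The cube of radius R around y lies in the one of radius 2R around 0, since y is in `A`
          -- and so in `box d R`.
          have hinj : Set.InjOn (fun z : Lattice d => y - z) (box d R) :=
            fun a _ b _ hab => sub_right_injective hab
          calc ∑ z ∈ box d R, green η z
              = ∑ x ∈ (box d R).image (fun z => y - z), green η (y - x) := by
                rw [Finset.sum_image hinj]
                simp
            _ ≤ ∑ x ∈ box d (2 * R), green η (y - x) := by
                refine Finset.sum_le_sum_of_subset ?_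
                intro x hx
                obtain ⟨z, hz, rfl⟩ := Finset.mem_image.1 hx
                rw [mem_box] at hz ⊢
                intro i
                have h1 := mem_box.1 (hA hy) i
                have h2 := hz i
                rw [Pi.sub_apply]
                push_cast
                exact (abs_sub _ _).trans (by linarith)
      _ = ∑ x ∈ box d (2 * R), hitProb η A x := by
          simp_rw [← sum_green_mul_escapeProb η hG, Finset.mul_sum]
          rw [Finset.sum_comm]
          simp_rw [mul_comm]
      _ ≤ ∑ x ∈ box d (2 * R), 1 := Finset.sum_le_sum fun x _ => hitProb_le_one η A x
      _ ≤ ENNReal.ofReal ((5 * R) ^ d) := by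
          rw [Finset.sum_const, card_box, nsmul_one]
          rw [show ((5 * R : ℝ)) = ((5 * R : ℕ) : ℝ) by push_cast; rfl, ← Nat.cast_pow,
            ENNReal.ofReal_natCast]
          have : (2 * (2 * R) + 1) ^ d ≤ (5 * R) ^ d := Nat.pow_le_pow_left (by omega) d
          exact_mod_cast this
  rw [← ENNReal.le_div_iff_mul_le (Or.inl (by simp; positivity)) (Or.inl ENNReal.ofReal_ne_top)]
    at hkey
  refine hkey.trans ?_
  rw [← ENNReal.ofReal_div_of_pos (by positivity)]
  refine ENNReal.ofReal_le_ofReal (le_of_eq ?_)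
  obtain ⟨e, rfl⟩ := Nat.exists_eq_add_of_le hd
  rw [Nat.add_sub_cancel_left, mul_pow]
  field_simp
  ring

end CapacityBounds

/-! ### Heat kernel bound and averages of the Green function. -/

section HeatKernel

/-- Induction with the ratio of consecutive central coefficients; the step amounts to (2m + 1)(2m +
3) ≤ 4(m + 1)^2. -/
theorem centralBinom_sq_mul_le (m : ℕ) : m.centralBinom ^ 2 * (2 * m + 1) ≤ 16 ^ m := by
  induction m with
  | zero => simp
  | succ m ih =>
    have h := Nat.succ_mul_centralBinom_succ m
    have h2 : (m + 1) ^ 2 * ((m + 1).centralBinom ^ 2 * (2 * (m + 1) + 1)) ≤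
        (m + 1) ^ 2 * 16 ^ (m + 1) := by
      calc (m + 1) ^ 2 * ((m + 1).centralBinom ^ 2 * (2 * (m + 1) + 1))
          = ((m + 1) * (m + 1).centralBinom) ^ 2 * (2 * m + 3) := by ring
        _ = (m.centralBinom ^ 2 * (2 * m + 1)) * (4 * ((2 * m + 1) * (2 * m + 3))) := by
          rw [h]; ring
        _ ≤ 16 ^ m * (4 * (4 * (m + 1) ^ 2)) := by
          exact Nat.mul_le_mul ih (Nat.mul_le_mul_left 4 (by nlinarith))
        _ = (m + 1) ^ 2 * 16 ^ (m + 1) := by ring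
    exact Nat.le_of_mul_le_mul_left h2 (by positivity)

/-- Reduction to central coefficients: in an odd row the middle entry is half of the central one in
the next row. -/
theorem choose_sq_mul_le (k s : ℕ) : k.choose s ^ 2 * (k + 1) ≤ 4 ^ k := by
  rcases Nat.even_or_odd' k with ⟨m, rfl | rfl⟩
  · have h := centralBinom_sq_mul_le m
    have h2 := Nat.choose_le_centralBinom s m
    calc (2 * m).choose s ^ 2 * (2 * m + 1) ≤ m.centralBinom ^ 2 * (2 * m + 1) := by gcongr
      _ ≤ 16 ^ m := h
      _ = 4 ^ (2 * m) := by rw [pow_mul]; norm_num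
  · have h := centralBinom_sq_mul_le (m + 1)
    have h1 : (m + 1).centralBinom = 2 * (2 * m + 1).choose m := by
      rw [Nat.centralBinom_eq_two_mul_choose, show 2 * (m + 1) = 2 * m + 1 + 1 by ring,
        Nat.choose_succ_succ, Nat.choose_symm_half]
      ring
    have h2 : (2 * m + 1).choose s ≤ (2 * m + 1).choose m := by
      have := Nat.choose_le_middle s (2 * m + 1)
      rwa [show (2 * m + 1) / 2 = m by omega] at this
    have h3 : 4 * ((2 * m + 1).choose s ^ 2 * (2 * m + 1 + 1)) ≤ 4 * 4 ^ (2 * m + 1) := by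
      calc 4 * ((2 * m + 1).choose s ^ 2 * (2 * m + 1 + 1))
          ≤ 4 * ((2 * m + 1).choose m ^ 2 * (2 * (m + 1) + 1)) := by
            gcongr; omega
        _ = (m + 1).centralBinom ^ 2 * (2 * (m + 1) + 1) := by rw [h1]; ring
        _ ≤ 16 ^ (m + 1) := h
        _ = 4 * 4 ^ (2 * m + 1) := by
          rw [← pow_succ', show 2 * m + 1 + 1 = 2 * (m + 1) by ring, pow_mul]; norm_num
    omega

/-- The uniform measure on `{0, a} ⊆ ℤ`. -/
def coin (a : ℕ) : Measure ℤ :=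
  (2⁻¹ : ℝ≥0∞) • Measure.dirac 0 + (2⁻¹ : ℝ≥0∞) • Measure.dirac (a : ℤ)

/-- The law of `a` times a symmetric binomial variable. -/
def coinPow (a : ℕ) : ℕ → Measure ℤ
  | 0 => Measure.dirac 0
  | k + 1 => coin a ∗ coinPow a k

instance (a : ℕ) : IsProbabilityMeasure (coin a) :=
  ⟨by simp [coin, ENNReal.inv_two_add_inv_two]⟩

instance (a k : ℕ) : IsProbabilityMeasure (coinPow a k) := by
  induction k with
  | zero => unfold coinPow; infer_instance
  | succ k ih => unfold coinPow; infer_instance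

theorem coinPow_succ_singleton (a k : ℕ) (t : ℤ) :
    coinPow a (k + 1) {t} = 2⁻¹ * coinPow a k {t} + 2⁻¹ * coinPow a k {t - a} := by
  rw [coinPow, conv_singleton, coin, lintegral_add_measure, lintegral_smul_measure,
    lintegral_smul_measure, lintegral_dirac, lintegral_dirac]
  simp

theorem coinPow_singleton {a : ℕ} (ha : 0 < a) (k : ℕ) :
    (∀ s : ℕ, coinPow a k {(a * s : ℤ)} = k.choose s * (2⁻¹ : ℝ≥0∞) ^ k) ∧
    ∀ t : ℤ, (∀ s : ℕ, t ≠ a * s) → coinPow a k {t} = 0 := by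
  induction k with
  | zero =>
    refine ⟨fun s => ?_, fun t ht => ?_⟩
    · cases s with
      | zero => simp [coinPow]
      | succ s =>
        have : (0 : ℤ) ≠ a * ((s + 1 : ℕ) : ℤ) := by positivity
        simp only [coinPow, measurableSet_singleton, Measure.dirac_apply',
          Set.mem_singleton_iff, this, not_false_eq_true, Set.indicator_of_notMem]
        simp
    · have : (0 : ℤ) ≠ t := fun h => ht 0 (by simp [← h])
      simp [coinPow, this]
  | succ k ih =>
    obtain ⟨ih1, ih2⟩ := ih
    refine ⟨fun s => ?_, fun t ht => ?_⟩
    · rw [coinPow_succ_singleton, ih1]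
      cases s with
      | zero =>
        rw [ih2]
        · simp [pow_succ']
        · intro s hs
          have : (a : ℤ) * (s + 1) = 0 := by push_cast at hs; linarith
          have h2 : (0 : ℤ) < a * (s + 1) := by positivity
          omega
      | succ s =>
        rw [show (a : ℤ) * ((s + 1 : ℕ) : ℤ) - a = a * s by push_cast; ring, ih1,
          Nat.choose_succ_succ, pow_succ]
        push_cast
        ring
    · rw [coinPow_succ_singleton, ih2 t ht, ih2 (t - a)]
      · simp
      · intro s hs
        exact ht (s + 1) (by push_cast; linarith)

theorem coinPow_singleton_le {a : ℕ} (ha : 0 < a) (k : ℕ) (t : ℤ) :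
    coinPow a k {t} ≤ ENNReal.ofReal (((k : ℝ) + 1) ^ (-(1 / 2 : ℝ))) := by
  obtain ⟨h1, h2⟩ := coinPow_singleton ha k
  by_cases h : ∃ s : ℕ, t = a * s
  · obtain ⟨s, rfl⟩ := h
    rw [h1, show (k.choose s : ℝ≥0∞) * (2⁻¹ : ℝ≥0∞) ^ k =
      ENNReal.ofReal ((k.choose s : ℝ) * (2⁻¹ : ℝ) ^ k) by
        rw [ENNReal.ofReal_mul (by positivity), ENNReal.ofReal_natCast,
          ENNReal.ofReal_pow (by positivity), ENNReal.ofReal_inv_of_pos (by norm_num)]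
        simp]
    refine ENNReal.ofReal_le_ofReal ?_
    rw [Real.rpow_neg (by positivity), ← Real.sqrt_eq_rpow]
    have h3 : ((k.choose s : ℝ)) ^ 2 * (k + 1) ≤ 4 ^ k := by exact_mod_cast choose_sq_mul_le k s
    refine (sq_le_sq₀ (by positivity) (by positivity)).1 ?_
    rw [inv_pow √_, Real.sq_sqrt (by positivity), mul_pow, ← pow_mul, mul_comm k 2, pow_mul,
      inv_eq_one_div ((k : ℝ) + 1), le_div_iff₀ (by positivity)]
    calc (k.choose s : ℝ) ^ 2 * (2⁻¹ ^ 2) ^ k * (k + 1)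
        = ((k.choose s : ℝ) ^ 2 * (k + 1)) * (2⁻¹ ^ 2) ^ k := by ring
      _ ≤ 4 ^ k * (2⁻¹ ^ 2) ^ k := by gcongr
      _ = 1 := by rw [← mul_pow]; norm_num
  · rw [h2 t (fun s hs => h ⟨s, hs⟩)]
    exact zero_le

theorem pi_conv_pi {d : ℕ} (ρ ν : Fin d → Measure ℤ) [∀ i, IsProbabilityMeasure (ρ i)]
    [∀ i, IsProbabilityMeasure (ν i)] :
    Measure.pi ρ ∗ Measure.pi ν = Measure.pi fun i => ρ i ∗ ν i := by
  have h := (measurePreserving_arrowProdEquivProdArrow ℤ ℤ (Fin d) ρ ν).map_eq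
  have h2 := Measure.pi_map_pi (μ := fun i => (ρ i).prod (ν i)) (f := fun _ x => x.1 + x.2)
    (fun i => (measurable_fst.add measurable_snd).aemeasurable)
  unfold Measure.conv
  rw [← h2, ← h, Measure.map_map (by fun_prop) (MeasurableEquiv.measurable _)]
  rfl

variable {d : ℕ}

theorem convPow_pi_coin (a : Fin d → ℕ) (k : ℕ) :
    convPow (Measure.pi fun i => coin (a i)) k = Measure.pi fun i => coinPow (a i) k := by
  induction k with
  | zero =>
    simp only [convPow, coinPow]
    refine Measure.ext_of_singleton fun x => ?_
    rw [Measure.pi_singleton]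
    simp only [measurableSet_singleton, Measure.dirac_apply', Set.indicator_apply,
      Set.mem_singleton_iff, Pi.one_apply]
    by_cases h : (0 : Lattice d) = x
    · subst h; simp
    · rw [if_neg h]
      obtain ⟨i, hi⟩ := Function.ne_iff.1 h
      exact (Finset.prod_eq_zero (Finset.mem_univ i) (if_neg hi)).symm
  | succ k ih => rw [convPow, ih, pi_conv_pi]; rfl

/-- The largest mass of a point. -/
def maxAtom (ν : Measure (Lattice d)) : ℝ≥0∞ := ⨆ z, ν {z}

theorem le_maxAtom (ν : Measure (Lattice d)) (z : Lattice d) : ν {z} ≤ maxAtom ν :=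
  le_iSup (fun z => ν {z}) z

theorem maxAtom_conv_le (ρ ν : Measure (Lattice d)) [SFinite ν] :
    maxAtom (ρ ∗ ν) ≤ ρ Set.univ * maxAtom ν := by
  refine iSup_le fun z => ?_
  rw [conv_singleton]
  refine (lintegral_mono fun x => le_maxAtom ν (z - x)).trans ?_
  rw [lintegral_const, mul_comm]

theorem maxAtom_convPow_pi_coin_le {a : Fin d → ℕ} (ha : ∀ i, 0 < a i) (k : ℕ) :
    maxAtom (convPow (Measure.pi fun i => coin (a i)) k) ≤
      ENNReal.ofReal (((k : ℝ) + 1) ^ (-(d / 2 : ℝ))) := by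
  refine iSup_le fun z => ?_
  rw [convPow_pi_coin, Measure.pi_singleton]
  refine (Finset.prod_le_prod' fun i _ => coinPow_singleton_le (ha i) k (z i)).trans ?_
  rw [Finset.prod_const, Finset.card_univ, Fintype.card_fin, ← ENNReal.ofReal_pow (by positivity),
    ← Real.rpow_natCast, ← Real.rpow_mul (by positivity)]
  refine le_of_eq ?_
  congr 2
  ring

theorem convPow_singleton_pos_add {η : Measure (Lattice d)} [IsProbabilityMeasure η] {m n : ℕ}
    {x y : Lattice d} (hx : 0 < convPow η m {x}) (hy : 0 < convPow η n {y}) :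
    0 < convPow η (m + n) {x + y} := by
  rw [convPow_add, conv_singleton]
  calc 0 < convPow η n {y} * convPow η m {x} := ENNReal.mul_pos hy.ne' hx.ne'
    _ = ∫⁻ z in {x}, convPow η n {x + y - z} ∂(convPow η m) := by
      rw [lintegral_singleton, add_sub_cancel_left]
    _ ≤ _ := setLIntegral_le_lintegral _ _

theorem convPow_singleton_pos_nsmul {η : Measure (Lattice d)} [IsProbabilityMeasure η] {m : ℕ}
    {x : Lattice d} (hx : 0 < convPow η m {x}) (k : ℕ) : 0 < convPow η (k * m) {k • x} := by
  induction k with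
  | zero => simp [convPow]
  | succ k ih =>
    rw [Nat.succ_mul, succ_nsmul]
    exact convPow_singleton_pos_add ih hx

theorem IsIrreducible.exists_convPow_pos {η : Measure (Lattice d)} [IsProbabilityMeasure η]
    (h : IsIrreducible η) (z : Lattice d) : ∃ n, 0 < convPow η n {z} := by
  obtain ⟨n, hn⟩ := h 0 z
  refine ⟨n, ?_⟩
  rw [walkLaw, Measure.map_apply (measurable_walkPath 0)] at hn
  · have h2 := stepsLaw_walkPath_eq η 0 z n
    rw [sub_zero] at h2
    rw [← h2]
    exact hn
  · exact measurableSet_eq_fun (measurable_pi_apply n) measurable_const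

/-- Let p_i and q_i be times at which e_i and -e_i can be reached, and a_i = p_i + q_i, the length
of a loop. In the same number a_i p_i of steps the walk can make a_i passages along e_i or p_i loops
at its place, so all corners of the box with sides a_i are reachable at one common time. -/
theorem IsIrreducible.exists_cube {η : Measure (Lattice d)} [IsProbabilityMeasure η]
    (hd : 0 < d) (h : IsIrreducible η) : ∃ (n : ℕ) (a : Fin d → ℕ), 0 < n ∧ (∀ i, 0 < a i) ∧
      ∀ ε : Fin d → Bool, 0 < convPow η n {fun i => if ε i then (a i : ℤ) else 0} := by
  choose p hp using fun i : Fin d => h.exists_convPow_pos (Pi.single i (1 : ℤ))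
  choose q hq using fun i : Fin d => h.exists_convPow_pos (Pi.single i (-1 : ℤ))
  have hp0 : ∀ i, 0 < p i := by
    intro i
    refine Nat.pos_of_ne_zero fun h0 => ?_
    have h1 := hp i
    have h2 : (0 : Lattice d) ≠ Pi.single i (1 : ℤ) := by
      intro h3
      simpa using congrFun h3 i
    rw [h0] at h1
    simp [convPow, h2] at h1
  set a : Fin d → ℕ := fun i => p i + q i with ha
  have ha0 : ∀ i, 0 < convPow η (a i) {0} := by
    intro i
    have := convPow_singleton_pos_add (hp i) (hq i)
    rwa [← Pi.single_add, add_neg_cancel, Pi.single_zero] at this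
  have hstep : ∀ (ε : Fin d → Bool) i,
      0 < convPow η (a i * p i) {Pi.single i (if ε i then (a i : ℤ) else 0)} := by
    intro ε i
    by_cases hε : ε i
    · have := convPow_singleton_pos_nsmul (hp i) (a i)
      rw [← Pi.single_smul] at this
      simpa [hε] using this
    · have := convPow_singleton_pos_nsmul (ha0 i) (p i)
      rw [mul_comm] at this
      simpa [hε] using this
  have hsum : ∀ (ε : Fin d → Bool) (s : Finset (Fin d)), 0 < convPow η (∑ i ∈ s, a i * p i)
      {∑ i ∈ s, Pi.single i (if ε i then (a i : ℤ) else 0)} := by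
    intro ε s
    induction s using Finset.induction_on with
    | empty => simp [convPow]
    | insert i s hi ih =>
      rw [Finset.sum_insert hi, Finset.sum_insert hi]
      exact convPow_singleton_pos_add (hstep ε i) ih
  have hapos : ∀ i, 0 < a i := fun i => by simp only [ha]; have := hp0 i; omega
  refine ⟨∑ i, a i * p i, a, ?_, hapos, fun ε => ?_⟩
  · exact Finset.sum_pos (fun i _ => Nat.mul_pos (hapos i) (hp0 i)) ⟨⟨0, hd⟩, Finset.mem_univ _⟩
  · have h1 := hsum ε Finset.univ
    rwa [Finset.univ_sum_single] at h1


/-- A Doeblin minorisation: c is the least mass of a corner, and the product of the coins lives on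
the corners. -/
theorem IsIrreducible.exists_smul_pi_coin_le {η : Measure (Lattice d)} [IsProbabilityMeasure η]
    (hd : 0 < d) (h : IsIrreducible η) : ∃ (n : ℕ) (a : Fin d → ℕ) (c : ℝ≥0∞), 0 < n ∧
      (∀ i, 0 < a i) ∧ 0 < c ∧ c ≠ ∞ ∧ c • Measure.pi (fun i => coin (a i)) ≤ convPow η n := by
  obtain ⟨n, a, hn, ha, hpos⟩ := h.exists_cube hd
  obtain ⟨ε₀, hε₀⟩ := Finite.exists_min
    (fun ε : Fin d → Bool => convPow η n {fun i => if ε i then (a i : ℤ) else 0})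
  refine ⟨n, a, _, hn, ha, hpos ε₀, measure_ne_top _ _, ?_⟩
  set c := convPow η n {fun i => if ε₀ i then (a i : ℤ) else 0} with hc
  refine Measure.le_iff.2 fun s hs => ?_
  rw [← Measure.tsum_indicator_apply_singleton _ s hs,
    ← Measure.tsum_indicator_apply_singleton _ s hs]
  refine ENNReal.tsum_le_tsum fun x => Set.indicator_le_indicator ?_
  rw [Measure.smul_apply, smul_eq_mul]
  by_cases hx : ∃ ε : Fin d → Bool, (fun i => if ε i then (a i : ℤ) else 0) = x
  · obtain ⟨ε, rfl⟩ := hx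
    exact (mul_le_of_le_one_right' prob_le_one).trans (hε₀ ε)
  · have : ∃ i, x i ≠ 0 ∧ x i ≠ a i := by
      by_contra hcon
      push Not at hcon
      refine hx ⟨fun i => decide (x i ≠ 0), funext fun i => ?_⟩
      by_cases hi : x i = 0
      · simp [hi]
      · rw [if_pos (by simpa using hi), hcon i hi]
    obtain ⟨i, hi1, hi2⟩ := this
    rw [Measure.pi_singleton, Finset.prod_eq_zero (Finset.mem_univ i), mul_zero]
    · exact zero_le
    · simp [coin, hi1.symm, hi2.symm]

/-- Write `convPow η n` as ρ + cπ. Each of the m blocks contributes either a factor π with weight c,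
or the factor ρ of mass 1 - c, which at most multiplies the largest atom by 1 - c. With at least L
factors π the bound is B; with fewer, the largest atom is at most 1, hence at most 2^L times 2 to
the minus their number. The mean of 2^(-Bin(m, c)) is (c/2 + 1 - c)^m. The induction carries along
the k factors collected so far. -/
theorem maxAtom_convPow_conv_le {η : Measure (Lattice d)} [IsProbabilityMeasure η] {n : ℕ}
    {π : Measure (Lattice d)} [IsProbabilityMeasure π] {c : ℝ≥0∞} (hle : c • π ≤ convPow η n)
    {B : ℝ≥0∞} {L : ℕ} (hB : ∀ k, L ≤ k → maxAtom (convPow π k) ≤ B) (m : ℕ) : ∀ k : ℕ,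
    maxAtom (convPow η (n * m) ∗ convPow π k) ≤
      B + 2 ^ L * (c / 2 + (1 - c)) ^ m * (2⁻¹) ^ k := by
  have hc1 : c ≤ 1 := by
    have := hle Set.univ
    simpa using this
  have hctop : c ≠ ∞ := ne_top_of_le_ne_top (by simp) hc1
  induction m with
  | zero =>
    intro k
    simp only [mul_zero, pow_zero, mul_one]
    rw [convPow, Measure.dirac_zero_conv]
    rcases le_or_gt L k with hk | hk
    · exact (hB k hk).trans le_self_add
    · refine le_add_left (le_trans (iSup_le fun z => prob_le_one) ?_)
      obtain ⟨j, rfl⟩ := Nat.exists_eq_add_of_lt hk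
      rw [show k + j + 1 = (j + 1) + k by ring, pow_add, mul_assoc, ← mul_pow,
        ENNReal.mul_inv_cancel (by simp) (by simp), one_pow, mul_one]
      exact one_le_pow₀ (by norm_num)
  | succ m ih =>
    intro k
    have : IsFiniteMeasure (c • π) := ⟨by simp [hctop.lt_top]⟩
    set ρ := convPow η n - c • π with hρ
    have hsplit : ρ + c • π = convPow η n := Measure.sub_add_cancel_of_le hle
    have hρuniv : ρ Set.univ = 1 - c := by
      have h1 : ρ Set.univ + c = 1 := by
        have := congrArg (fun ν : Measure (Lattice d) => ν Set.univ) hsplit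
        simpa using this
      rw [← h1, ENNReal.add_sub_cancel_right hctop]
    have hρfin : IsFiniteMeasure ρ := ⟨by rw [hρuniv]; exact tsub_le_self.trans_lt (by simp)⟩
    have hdecomp : convPow η (n * (m + 1)) ∗ convPow π k =
        ρ ∗ (convPow η (n * m) ∗ convPow π k) +
          c • (convPow η (n * m) ∗ convPow π (k + 1)) := by
      rw [Nat.mul_succ, add_comm, convPow_add, ← hsplit, Measure.conv_assoc, Measure.add_conv,
        Measure.conv_smul_left]
      congr 2
      rw [convPow, ← Measure.conv_assoc, ← Measure.conv_assoc, Measure.conv_comm π]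
    rw [hdecomp]
    have h1 : maxAtom (ρ ∗ (convPow η (n * m) ∗ convPow π k) +
          c • (convPow η (n * m) ∗ convPow π (k + 1))) ≤
        (1 - c) * maxAtom (convPow η (n * m) ∗ convPow π k) +
          c * maxAtom (convPow η (n * m) ∗ convPow π (k + 1)) := by
      refine iSup_le fun z => ?_
      rw [Measure.add_apply, Measure.smul_apply, smul_eq_mul]
      refine add_le_add ?_ (by gcongr; exact le_maxAtom _ z)
      rw [← hρuniv]
      exact (le_maxAtom _ z).trans (maxAtom_conv_le _ _)
    refine h1.trans ?_
    set X : ℝ≥0∞ := 2 ^ L * (c / 2 + (1 - c)) ^ m * (2⁻¹) ^ k with hX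
    calc (1 - c) * maxAtom (convPow η (n * m) ∗ convPow π k) +
          c * maxAtom (convPow η (n * m) ∗ convPow π (k + 1))
        ≤ (1 - c) * (B + X) + c * (B + X * 2⁻¹) := by
          gcongr
          · exact ih k
          · refine (ih (k + 1)).trans (le_of_eq ?_)
            rw [hX, pow_succ]; ring
      _ = ((1 - c) + c) * B + X * (c / 2 + (1 - c)) := by
          rw [div_eq_mul_inv]; ring
      _ = B + 2 ^ L * (c / 2 + (1 - c)) ^ (m + 1) * (2⁻¹) ^ k := by
          rw [tsub_add_cancel_of_le hc1, one_mul, hX, pow_succ]; ring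

theorem exists_two_inv_pow_le (d : ℕ) : ∃ C : ℝ, 0 < C ∧ ∀ L : ℕ,
    (2⁻¹ : ℝ) ^ L ≤ C * ((L : ℝ) + 1) ^ (-(d / 2 : ℝ)) := by
  have h := tendsto_pow_const_mul_const_pow_of_abs_lt_one d (r := (2⁻¹ : ℝ))
    (by rw [abs_of_pos (by norm_num)]; norm_num)
  obtain ⟨C, hC⟩ := h.bddAbove_range
  have hC' : ∀ n : ℕ, (n : ℝ) ^ d * 2⁻¹ ^ n ≤ C := fun n => hC ⟨n, rfl⟩
  refine ⟨2 * (|C| + 1), by positivity, fun L => ?_⟩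
  have h1 := hC' (L + 1)
  have hL : (1 : ℝ) ≤ (L : ℝ) + 1 := by simp
  have h2 : ((L : ℝ) + 1) ^ (d / 2 : ℝ) ≤ ((L : ℝ) + 1) ^ d := by
    rw [← Real.rpow_natCast]
    exact Real.rpow_le_rpow_of_exponent_le hL (by have : (0 : ℝ) ≤ d := by positivity
                                                  linarith)
  rw [Real.rpow_neg (by positivity), ← div_eq_mul_inv, le_div_iff₀ (by positivity)]
  calc (2⁻¹ : ℝ) ^ L * ((L : ℝ) + 1) ^ (d / 2 : ℝ) ≤ (2⁻¹ : ℝ) ^ L * ((L : ℝ) + 1) ^ d := by gcongr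
    _ = 2 * (((L + 1 : ℕ) : ℝ) ^ d * 2⁻¹ ^ (L + 1)) := by push_cast; ring
    _ ≤ 2 * (|C| + 1) := by
      have := le_abs_self C
      linarith

/-- The heat kernel bound. -/
theorem IsIrreducible.exists_convPow_le {η : Measure (Lattice d)} [IsProbabilityMeasure η]
    (hd : 0 < d) (h : IsIrreducible η) : ∃ C : ℝ, 0 < C ∧ ∀ m : ℕ,
      maxAtom (convPow η m) ≤ ENNReal.ofReal (C * ((m : ℝ) + 1) ^ (-(d / 2 : ℝ))) := by
  obtain ⟨n, a, c, hn, ha, hc0, hctop, hle⟩ := h.exists_smul_pi_coin_le hd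
  obtain ⟨C₁, hC₁, hexp⟩ := exists_two_inv_pow_le d
  have hc1 : c ≤ 1 := by
    have := hle Set.univ
    simpa using this
  set q : ℝ≥0∞ := c / 2 + (1 - c) with hq
  have hq1 : q < 1 := by
    calc q < c + (1 - c) := by
          refine ENNReal.add_lt_add_right ?_ (ENNReal.half_lt_self hc0.ne' hctop)
          exact ne_top_of_le_ne_top (by simp) tsub_le_self
      _ = 1 := add_tsub_cancel_of_le hc1
  -- With j blocks per unit of L, the error 2^L q^(jL) is at most 2^(-L), which is negligible
  -- against L^(-d/2).
  obtain ⟨j, hj⟩ : ∃ j, q ^ j < 4⁻¹ :=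
    ((ENNReal.tendsto_pow_atTop_nhds_zero_of_lt_one hq1).eventually_lt_const
      (by simp)).exists
  have hj0 : 0 < j := by
    refine Nat.pos_of_ne_zero ?_
    rintro rfl
    rw [pow_zero, ENNReal.lt_inv_iff_lt_inv] at hj
    norm_num at hj
  have hnj : (0 : ℝ) < (n * j : ℕ) := by exact_mod_cast Nat.mul_pos hn hj0
  refine ⟨(1 + C₁) * ((n * j : ℕ) : ℝ) ^ (d / 2 : ℝ), by positivity, fun m => ?_⟩
  set L := m / (n * j) with hL
  have hm : m = n * (j * L) + m % (n * j) := by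
    rw [← mul_assoc]; exact (Nat.div_add_mod m (n * j)).symm
  -- Further convolution with a probability measure does not increase the largest atom, so the
  -- remainder of the division may be dropped.
  have h1 : maxAtom (convPow η m) ≤ maxAtom (convPow η (n * (j * L))) := by
    conv_lhs => rw [hm, add_comm, convPow_add]
    refine (maxAtom_conv_le _ _).trans ?_
    rw [measure_univ, one_mul]
  have h2 := maxAtom_convPow_conv_le hle (B := ENNReal.ofReal (((L : ℝ) + 1) ^ (-(d / 2 : ℝ))))
    (L := L) (fun k hk => (maxAtom_convPow_pi_coin_le ha k).trans (ENNReal.ofReal_le_ofReal ?_))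
    (j * L) 0
  swap
  · refine Real.rpow_le_rpow_of_nonpos (by positivity) (by gcongr) ?_
    have : (0 : ℝ) ≤ d := by positivity
    linarith
  rw [convPow, Measure.conv_dirac_zero, pow_zero, mul_one, pow_mul] at h2
  have h3 : (2 : ℝ≥0∞) ^ L * (q ^ j) ^ L ≤ ENNReal.ofReal ((2⁻¹ : ℝ) ^ L) := by
    rw [← mul_pow, ENNReal.ofReal_pow (by positivity), ENNReal.ofReal_inv_of_pos (by norm_num)]
    gcongr
    calc 2 * q ^ j ≤ 2 * 4⁻¹ := by gcongr
      _ = (ENNReal.ofReal 2)⁻¹ := by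
        rw [show (4 : ℝ≥0∞) = 2 * 2 by norm_num, ENNReal.mul_inv (by simp) (by simp), ← mul_assoc,
          ENNReal.mul_inv_cancel (by simp) (by simp)]
        simp
  refine h1.trans (h2.trans ((add_le_add le_rfl h3).trans ?_))
  rw [← ENNReal.ofReal_add (by positivity) (by positivity)]
  refine ENNReal.ofReal_le_ofReal ?_
  have hmL : ((m : ℝ) + 1) ≤ (n * j : ℕ) * ((L : ℝ) + 1) := by
    have : m < n * j * (m / (n * j) + 1) := Nat.lt_mul_div_succ m (Nat.mul_pos hn hj0)
    rw [← hL] at this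
    exact_mod_cast this
  have h4 : ((L : ℝ) + 1) ^ (-(d / 2 : ℝ)) ≤
      ((n * j : ℕ) : ℝ) ^ (d / 2 : ℝ) * ((m : ℝ) + 1) ^ (-(d / 2 : ℝ)) := by
    have hpow : ((m : ℝ) + 1) ^ (d / 2 : ℝ) ≤
        ((n * j : ℕ) : ℝ) ^ (d / 2 : ℝ) * ((L : ℝ) + 1) ^ (d / 2 : ℝ) := by
      rw [← Real.mul_rpow (by positivity) (by positivity)]
      exact Real.rpow_le_rpow (by positivity) hmL (by positivity)
    rw [Real.rpow_neg (by positivity), Real.rpow_neg (by positivity), ← div_eq_mul_inv,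
      le_div_iff₀ (by positivity), inv_mul_le_iff₀ (by positivity)]
    rwa [mul_comm] at hpow
  calc ((L : ℝ) + 1) ^ (-(d / 2 : ℝ)) + 2⁻¹ ^ L
      ≤ ((L : ℝ) + 1) ^ (-(d / 2 : ℝ)) + C₁ * ((L : ℝ) + 1) ^ (-(d / 2 : ℝ)) := by
        gcongr; exact hexp L
    _ = (1 + C₁) * ((L : ℝ) + 1) ^ (-(d / 2 : ℝ)) := by ring
    _ ≤ (1 + C₁) * (((n * j : ℕ) : ℝ) ^ (d / 2 : ℝ) * ((m : ℝ) + 1) ^ (-(d / 2 : ℝ))) := by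
        gcongr
    _ = _ := by ring

/-- Cut the sum into blocks of length x, writing m = xb + i with i < x: every base in block b is at
least x(b + 1). -/
theorem tsum_shift_rpow_le {a : ℝ} (ha : 0 ≤ a) (x : ℕ) [NeZero x] :
    ∑' m : ℕ, ENNReal.ofReal (((x : ℝ) + m) ^ (-a)) ≤
      ENNReal.ofReal ((x : ℝ) ^ (1 - a)) * ∑' b : ℕ, ENNReal.ofReal (((b : ℝ) + 1) ^ (-a)) := by
  have hx : (0 : ℝ) < x := by exact_mod_cast Nat.pos_of_ne_zero (NeZero.ne x)
  rw [← (Nat.divModEquiv x).symm.tsum_eq, ENNReal.tsum_prod', ← ENNReal.tsum_mul_left]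
  refine ENNReal.tsum_le_tsum fun b => ?_
  rw [tsum_fintype, ← ENNReal.ofReal_mul (by positivity)]
  calc ∑ i : Fin x, ENNReal.ofReal (((x : ℝ) + ((Nat.divModEquiv x).symm (b, i) : ℕ)) ^ (-a))
      ≤ ∑ _i : Fin x, ENNReal.ofReal (((x : ℝ) * (b + 1)) ^ (-a)) := by
        refine Finset.sum_le_sum fun i _ => ENNReal.ofReal_le_ofReal ?_
        refine Real.rpow_le_rpow_of_nonpos (by positivity) ?_ (by linarith)
        simp only [Nat.divModEquiv_symm_apply]
        push_cast
        have : (0 : ℝ) ≤ ((i : ℕ) : ℝ) := by positivity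
        linarith
    _ = ENNReal.ofReal ((x : ℝ) ^ (1 - a) * ((b : ℝ) + 1) ^ (-a)) := by
        rw [Finset.sum_const, Finset.card_univ, Fintype.card_fin, nsmul_eq_mul,
          ← ENNReal.ofReal_natCast, ← ENNReal.ofReal_mul (by positivity),
          Real.mul_rpow (by positivity) (by positivity), sub_eq_add_neg, Real.rpow_add hx,
          Real.rpow_one, mul_assoc]

theorem lintegral_convPow_singleton_le (θ η : Measure (Lattice d)) [IsProbabilityMeasure θ]
    [IsProbabilityMeasure η] :
    ∫⁻ z, η {z} ∂θ ≤ min (maxAtom θ) (maxAtom η) := by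
  refine le_min ?_ ?_
  · rw [lintegral_countable']
    calc ∑' z, η {z} * θ {z} ≤ ∑' z, η {z} * maxAtom θ := by
          gcongr with z; exact le_maxAtom θ z
      _ = maxAtom θ := by
          have h := Measure.tsum_indicator_apply_singleton η Set.univ MeasurableSet.univ
          simp only [Set.indicator_univ, measure_univ] at h
          rw [ENNReal.tsum_mul_right, h, one_mul]
  · refine (lintegral_mono fun z => le_maxAtom η z).trans ?_
    simp

/-- Averaging the Green function over the position of a walk. -/
theorem exists_lintegral_green_le {θ η : Measure (Lattice d)} [IsProbabilityMeasure θ]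
    [IsProbabilityMeasure η] (hd : 3 ≤ d) (hθ : IsIrreducible θ) (hη : IsIrreducible η) :
    ∃ C : ℝ, 0 < C ∧ ∀ D : ℕ, ∫⁻ z, green η z ∂(convPow θ D) ≤
      ENNReal.ofReal (C * ((D : ℝ) + 1) ^ (-(((d : ℝ) - 2) / 2))) := by
  obtain ⟨C₁, hC₁, h₁⟩ := hθ.exists_convPow_le (by omega)
  obtain ⟨C₂, hC₂, h₂⟩ := hη.exists_convPow_le (by omega)
  set a : ℝ := d / 2 with ha
  have hd' : (3 : ℝ) ≤ d := by exact_mod_cast hd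
  have ha1 : 1 < a := by rw [ha]; linarith
  set C := max C₁ C₂ with hC
  have hCpos : 0 < C := lt_max_of_lt_left hC₁
  have hsummable : Summable fun b : ℕ => ((b : ℝ) + 1) ^ (-a) := by
    have := (summable_nat_add_iff 1).2 (Real.summable_nat_rpow.2 (show -a < -1 by linarith))
    simpa using this
  set Z := ∑' b : ℕ, ((b : ℝ) + 1) ^ (-a) with hZ
  have hZpos : 0 < Z := hsummable.tsum_pos (fun b => by positivity) 0 (by positivity)
  refine ⟨C * 2 ^ a * Z, by positivity, fun D => ?_⟩
  have hterm : ∀ m : ℕ, ∫⁻ z, convPow η m {z} ∂(convPow θ D) ≤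
      ENNReal.ofReal (C * 2 ^ a) * ENNReal.ofReal ((((D + 1 : ℕ) : ℝ) + m) ^ (-a)) := by
    intro m
    refine (lintegral_convPow_singleton_le _ _).trans ?_
    rw [← ENNReal.ofReal_mul (by positivity)]
    -- The heat kernel bound is used for the longer of the two walks, whose length is at least half
    -- of the total. The m-th term is thus of order (D + 1 + m)^(-d/2), summable in m as d ≥ 3.
    have hhalf : ∀ y : ℝ, (((D + 1 : ℕ) : ℝ) + m) / 2 ≤ y → C * y ^ (-a) ≤
        C * 2 ^ a * (((D + 1 : ℕ) : ℝ) + m) ^ (-a) := by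
      intro y hy
      have : y ^ (-a) ≤ ((((D + 1 : ℕ) : ℝ) + m) / 2) ^ (-a) :=
        Real.rpow_le_rpow_of_nonpos (by positivity) hy (by linarith)
      rw [mul_assoc]
      gcongr
      refine this.trans (le_of_eq ?_)
      rw [Real.div_rpow (by positivity) (by positivity), Real.rpow_neg (by norm_num : (0:ℝ) ≤ 2),
        div_inv_eq_mul, mul_comm]
    rcases le_total m D with hmD | hmD
    · refine (min_le_left _ _).trans ((h₁ D).trans (ENNReal.ofReal_le_ofReal ?_))
      refine le_trans ?_ (hhalf (D + 1) ?_)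
      · gcongr; exact le_max_left _ _
      · have : (m : ℝ) ≤ D := by exact_mod_cast hmD
        push_cast; linarith
    · refine (min_le_right _ _).trans ((h₂ m).trans (ENNReal.ofReal_le_ofReal ?_))
      refine le_trans ?_ (hhalf (m + 1) ?_)
      · gcongr; exact le_max_right _ _
      · have : (D : ℝ) ≤ m := by exact_mod_cast hmD
        push_cast; linarith
  unfold green
  rw [lintegral_tsum fun m => Measurable.of_discrete.aemeasurable]
  refine (ENNReal.tsum_le_tsum hterm).trans ?_
  rw [ENNReal.tsum_mul_left]
  refine (mul_le_mul_right (tsum_shift_rpow_le (a := a) (by linarith) (D + 1)) _).trans ?_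
  rw [← ENNReal.ofReal_tsum_of_nonneg (fun b => by positivity) hsummable,
    ← ENNReal.ofReal_mul (by positivity), ← ENNReal.ofReal_mul (by positivity)]
  refine ENNReal.ofReal_le_ofReal (le_of_eq ?_)
  rw [show (1 - a : ℝ) = -(((d : ℝ) - 2) / 2) by rw [ha]; ring]
  push_cast
  ring

theorem IsIrreducible.green_ne_top {η : Measure (Lattice d)} [IsProbabilityMeasure η] (hd : 3 ≤ d)
    (hη : IsIrreducible η) (z : Lattice d) : green η z ≠ ∞ := by
  obtain ⟨C₂, hC₂, h₂⟩ := hη.exists_convPow_le (by omega)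
  have hd' : (3 : ℝ) ≤ d := by exact_mod_cast hd
  have hsummable : Summable fun b : ℕ => C₂ * ((b : ℝ) + 1) ^ (-(d / 2 : ℝ)) := by
    have := (summable_nat_add_iff 1).2
      (Real.summable_nat_rpow.2 (show -(d / 2 : ℝ) < -1 by linarith))
    exact Summable.mul_left _ (by simpa using this)
  refine ne_top_of_le_ne_top ?_
    (ENNReal.tsum_le_tsum fun m => (le_maxAtom (convPow η m) z).trans (h₂ m))
  rw [← ENNReal.ofReal_tsum_of_nonneg (fun b => by positivity) hsummable]
  exact ENNReal.ofReal_ne_top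

end HeatKernel

/-! ### First and second moment formulas for the forest. -/

section ForestLaw

variable (μ : Measure ℕ)

/-- The probability of having more than `j` children. -/
def tail (j : ℕ) : ℝ≥0∞ := μ {n | j < n}

theorem tsum_lt (n : ℕ) : ∑' j : ℕ, (if j < n then (1 : ℝ≥0∞) else 0) = n := by
  rw [tsum_eq_sum (s := Finset.range n) (fun j hj => if_neg (by simpa using hj))]
  rw [Finset.sum_congr rfl fun j hj => if_pos (Finset.mem_range.1 hj)]
  simp

theorem tail_eq_lintegral (j : ℕ) : tail μ j = ∫⁻ n, (if j < n then 1 else 0) ∂μ := by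
  rw [tail, ← lintegral_indicator_one MeasurableSet.of_discrete]
  refine lintegral_congr fun n => ?_
  simp [Set.indicator_apply]

theorem tsum_tail : ∑' j, tail μ j = ∫⁻ n, (n : ℝ≥0∞) ∂μ := by
  simp_rw [tail_eq_lintegral]
  rw [← lintegral_tsum fun j => Measurable.of_discrete.aemeasurable]
  simp_rw [tsum_lt]

/-- A vertex with n children has n^2 ordered pairs of them. -/
theorem tsum_tail_max : ∑' p : ℕ × ℕ, tail μ (max p.1 p.2) = ∫⁻ n, (n : ℝ≥0∞) ^ 2 ∂μ := by
  simp_rw [tail_eq_lintegral]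
  rw [← lintegral_tsum fun j => Measurable.of_discrete.aemeasurable]
  refine lintegral_congr fun n => ?_
  have : ∀ p : ℕ × ℕ, (if max p.1 p.2 < n then (1 : ℝ≥0∞) else 0) =
      (if p.1 < n then 1 else 0) * (if p.2 < n then 1 else 0) := by
    intro p
    by_cases h1 : p.1 < n <;> by_cases h2 : p.2 < n <;> simp [h1, h2]
  simp_rw [this]
  rw [ENNReal.tsum_prod' (f := fun p : ℕ × ℕ => (if p.1 < n then (1 : ℝ≥0∞) else 0) *
    (if p.2 < n then 1 else 0))]
  rw [tsum_congr fun a => ENNReal.tsum_mul_left (a := if a < n then (1 : ℝ≥0∞) else 0)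
    (f := fun b : ℕ => if b < n then (1 : ℝ≥0∞) else 0), ENNReal.tsum_mul_right, tsum_lt, sq]

/-- The conditions on the numbers of children for the path from `(k, w)` to `(k, x ++ w)` to
belong to the forest. -/
def conds (k : ℕ) (w : List ℕ) : List ℕ → List (Vertex × ℕ)
  | [] => []
  | j :: x => ((k, x ++ w), j) :: conds k w x

/-- The numbers of children fulfil a list of lower bounds. -/
def Sat (N : Vertex → ℕ) (L : List (Vertex × ℕ)) : Prop := ∀ p ∈ L, p.2 < N p.1

theorem inForest_append (N : Vertex → ℕ) (k : ℕ) (w x : List ℕ) :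
    InForest N (k, x ++ w) ↔ Sat N (conds k w x) ∧ InForest N (k, w) := by
  induction x with
  | nil => simp [Sat, conds]
  | cons j x ih =>
    simp only [List.cons_append, InForest, ih, Sat, conds, List.forall_mem_cons]
    tauto

theorem inForest_iff_sat (N : Vertex → ℕ) (k : ℕ) (x : List ℕ) :
    InForest N (k, x) ↔ Sat N (conds k [] x) := by
  have := inForest_append N k [] x
  simpa [InForest] using this

theorem exists_of_mem_conds {k : ℕ} {w x : List ℕ} {p : Vertex × ℕ} (hp : p ∈ conds k w x) :
    ∃ t, t <:+ x ∧ t.length < x.length ∧ p.1 = (k, t ++ w) := by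
  induction x with
  | nil => simp [conds] at hp
  | cons j x ih =>
    rcases List.mem_cons.1 hp with rfl | hp
    · exact ⟨x, List.suffix_cons _ _, by simp, rfl⟩
    · obtain ⟨t, h1, h2, h3⟩ := ih hp
      exact ⟨t, h1.trans (List.suffix_cons _ _), by simp; omega, h3⟩

theorem nodup_conds (k : ℕ) (w x : List ℕ) : ((conds k w x).map Prod.fst).Nodup := by
  induction x with
  | nil => simp [conds]
  | cons j x ih =>
    simp only [conds, List.map_cons, List.nodup_cons]
    refine ⟨fun h => ?_, ih⟩
    obtain ⟨p, hp, hpe⟩ := List.mem_map.1 h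
    obtain ⟨t, -, h2, h3⟩ := exists_of_mem_conds hp
    rw [h3] at hpe
    have := congrArg (fun v : Vertex => v.2.length) hpe
    simp at this
    omega

/-- The probability that a word belongs to the tree. -/
def wt (x : List ℕ) : ℝ≥0∞ := (x.map (tail μ)).prod

theorem prod_conds (k : ℕ) (w x : List ℕ) :
    ((conds k w x).map fun p => tail μ p.2).prod = wt μ x := by
  induction x with
  | nil => simp [conds, wt]
  | cons j x ih =>
    simp only [conds, List.map_cons, List.prod_cons, ih]
    simp [wt]

theorem wt_append (x y : List ℕ) : wt μ (x ++ y) = wt μ x * wt μ y := by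
  simp [wt]

theorem wt_cons (j : ℕ) (x : List ℕ) : wt μ (j :: x) = tail μ j * wt μ x := by
  simp [wt]

theorem tsum_list (F : List ℕ → ℝ≥0∞) :
    ∑' x, F x = F [] + ∑' j, ∑' x, F (j :: x) := by
  let e : Unit ⊕ (ℕ × List ℕ) ≃ List ℕ :=
    { toFun := fun p => match p with
        | Sum.inl _ => []
        | Sum.inr p => p.1 :: p.2
      invFun := fun l => match l with
        | [] => Sum.inl ()
        | j :: x => Sum.inr (j, x)
      left_inv := fun p => by rcases p with _ | _ <;> rfl
      right_inv := fun l => by cases l <;> rfl }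
  rw [← e.tsum_eq, Summable.tsum_sum ENNReal.summable ENNReal.summable, ENNReal.tsum_prod']
  simp [e]

/-- Criticality: the expected size of each generation is 1, one more letter contributing the factor
`∑' j, tail μ j`, which is the mean. -/
theorem tsum_wt_length (hmean : ∫⁻ n, (n : ℝ≥0∞) ∂μ = 1) (h : ℕ) :
    ∑' x, wt μ x * (if x.length = h then 1 else 0) = 1 := by
  induction h with
  | zero =>
    rw [tsum_list]
    simp [wt]
  | succ h ih =>
    rw [tsum_list]
    simp only [List.length_nil, List.length_cons, Nat.add_right_cancel_iff, wt_cons, mul_assoc]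
    simp_rw [ENNReal.tsum_mul_left, ih]
    simp [tsum_tail, hmean]

theorem tsum_wt_mul (hmean : ∫⁻ n, (n : ℝ≥0∞) ∂μ = 1) (φ : ℕ → ℝ≥0∞) :
    ∑' x, wt μ x * φ x.length = ∑' h, φ h := by
  have h1 : ∀ x : List ℕ, wt μ x * φ x.length =
      ∑' h, φ h * (wt μ x * (if x.length = h then 1 else 0)) := by
    intro x
    rw [tsum_eq_single x.length]
    · simp [mul_comm]
    · intro h hh
      simp [hh.symm]
  simp_rw [h1]
  rw [ENNReal.tsum_comm]
  simp_rw [ENNReal.tsum_mul_left, tsum_wt_length μ hmean, mul_one]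

variable [IsProbabilityMeasure μ]

/-- The law of the numbers of children. -/
abbrev childLaw : Measure (Vertex → ℕ) := Measure.infinitePi fun _ : Vertex => μ

/-- Conditions at distinct vertices are independent. -/
theorem childLaw_sat {L : List (Vertex × ℕ)} (hL : (L.map Prod.fst).Nodup) :
    childLaw μ {N | Sat N L} = (L.map fun p => tail μ p.2).prod := by
  classical
  have hset : {N : Vertex → ℕ | Sat N L} =
      Set.pi ((L.map Prod.fst).toFinset : Set Vertex)
        fun f => {n | ∀ p ∈ L, p.1 = f → p.2 < n} := by
    ext N
    simp only [Sat, Set.mem_ofPred_eq, Set.mem_pi, List.coe_toFinset, List.mem_map]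
    constructor
    · rintro h f ⟨p, hp, rfl⟩ q hq hqp
      rw [← hqp]; exact h q hq
    · intro h p hp
      exact h p.1 ⟨p, hp, rfl⟩ p hp rfl
  rw [hset, Measure.infinitePi_pi _ (fun _ _ => MeasurableSet.of_discrete),
    List.prod_toFinset _ hL, List.map_map]
  congr 1
  refine List.map_congr_left fun p hp => ?_
  simp only [Function.comp, tail]
  congr 1
  ext n
  simp only [Set.mem_ofPred_eq]
  constructor
  · intro h; exact h p hp rfl
  · intro h q hq hqp
    rw [List.inj_on_of_nodup_map hL hq hp hqp]; exact h

theorem childLaw_inForest (k : ℕ) (x : List ℕ) :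
    childLaw μ {N | InForest N (k, x)} = wt μ x := by
  simp_rw [inForest_iff_sat]
  rw [childLaw_sat μ (nodup_conds k [] x), prod_conds]

theorem sat_append (N : Vertex → ℕ) (L L' : List (Vertex × ℕ)) :
    Sat N (L ++ L') ↔ Sat N L ∧ Sat N L' := by
  simp [Sat, or_imp, forall_and]

theorem childLaw_inForest_of_ne {k l : ℕ} (hkl : k ≠ l) (x y : List ℕ) :
    childLaw μ {N | InForest N (k, x) ∧ InForest N (l, y)} = wt μ x * wt μ y := by
  simp_rw [inForest_iff_sat, ← sat_append]
  rw [childLaw_sat, List.map_append, List.prod_append, prod_conds, prod_conds]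
  rw [List.map_append, List.nodup_append]
  refine ⟨nodup_conds _ _ _, nodup_conds _ _ _, ?_⟩
  rintro a ha b hb rfl
  obtain ⟨p, hp, hpa⟩ := List.mem_map.1 ha
  obtain ⟨q, hq, hqa⟩ := List.mem_map.1 hb
  obtain ⟨t, -, -, h3⟩ := exists_of_mem_conds hp
  obtain ⟨t', -, -, h3'⟩ := exists_of_mem_conds hq
  have := h3.symm.trans (hpa.trans (hqa.symm.trans h3'))
  exact hkl (congrArg Prod.fst this)

theorem not_suffix_both {i j : ℕ} (hij : i ≠ j) {z t y : List ℕ} :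
    ¬ (t ++ i :: z <:+ y ++ j :: z) := by
  intro h
  have h1 : i :: z <:+ y ++ j :: z := (List.suffix_append t (i :: z)).trans h
  have h2 : j :: z <:+ y ++ j :: z := List.suffix_append _ _
  have h3 := List.suffix_of_suffix_length_le h1 h2 (by simp)
  have h4 := h3.eq_of_length (by simp)
  exact hij (List.cons.inj h4).1

/-- The two paths share the conditions up to z; at z both children i and j must exist, which is the
single condition on max(i, j); beyond z the conditions concern disjoint sets of vertices. -/
theorem childLaw_inForest_branch (k : ℕ) {i j : ℕ} (hij : i ≠ j) (x y z : List ℕ) :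
    childLaw μ {N | InForest N (k, x ++ i :: z) ∧ InForest N (k, y ++ j :: z)} =
      wt μ x * wt μ y * wt μ z * tail μ (max i j) := by
  have hset : {N : Vertex → ℕ | InForest N (k, x ++ i :: z) ∧ InForest N (k, y ++ j :: z)} =
      {N | Sat N (conds k (i :: z) x ++ (conds k (j :: z) y ++
        (((k, z), max i j) :: conds k [] z)))} := by
    ext N
    simp only [Set.mem_ofPred_eq, sat_append, inForest_append, InForest, inForest_iff_sat N k z]
    simp only [Sat, List.forall_mem_cons, max_lt_iff]
    tauto
  rw [hset, childLaw_sat]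
  · simp only [List.map_append, List.prod_append, List.map_cons, List.prod_cons, prod_conds]
    ring
  · have hlow : ∀ a ∈ (((k, z), max i j) :: conds k [] z).map Prod.fst,
        a.2.length ≤ z.length := by
      intro a ha
      obtain ⟨p, hp, rfl⟩ := List.mem_map.1 ha
      rcases List.mem_cons.1 hp with rfl | hp
      · simp
      · obtain ⟨t, -, h2, h3⟩ := exists_of_mem_conds hp
        rw [h3]; simp; omega
    have hup : ∀ (i : ℕ) (x : List ℕ), ∀ a ∈ (conds k (i :: z) x).map Prod.fst,
        ∃ t, t <:+ x ∧ a = (k, t ++ i :: z) := by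
      intro i x a ha
      obtain ⟨p, hp, rfl⟩ := List.mem_map.1 ha
      obtain ⟨t, h1, h2, h3⟩ := exists_of_mem_conds hp
      exact ⟨t, h1, h3⟩
    rw [List.map_append, List.map_append, List.nodup_append, List.nodup_append]
    refine ⟨nodup_conds _ _ _, ⟨nodup_conds _ _ _, ?_, ?_⟩, ?_⟩
    · rw [List.map_cons, List.nodup_cons]
      refine ⟨fun h => ?_, nodup_conds _ _ _⟩
      obtain ⟨p, hp, hpe⟩ := List.mem_map.1 h
      obtain ⟨t, -, h2, h3⟩ := exists_of_mem_conds hp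
      rw [h3] at hpe
      have := congrArg (fun v : Vertex => v.2.length) hpe
      simp at this
      omega
    · rintro a ha b hb rfl
      obtain ⟨t, -, rfl⟩ := hup _ _ _ ha
      have := hlow _ hb
      simp at this
      omega
    · rintro a ha b hb rfl
      obtain ⟨t, ht, rfl⟩ := hup _ _ _ ha
      rcases List.mem_append.1 hb with hb | hb
      · obtain ⟨t', ht', h'⟩ := hup _ _ _ hb
        have : t ++ i :: z = t' ++ j :: z := congrArg Prod.snd h'
        exact not_suffix_both hij (this ▸ List.suffix_rfl : t ++ i :: z <:+ t' ++ j :: z)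
      · have := hlow _ hb
        simp at this
        omega

/-- Words carry their last letter first, so common ancestors are common suffixes. The induction runs
on the reversed words. -/
theorem exists_common_suffix (u v : List ℕ) :
    (∃ x, u = x ++ v) ∨ (∃ x, v = x ++ u) ∨
      ∃ x y z i j, i ≠ j ∧ u = x ++ i :: z ∧ v = y ++ j :: z := by
  suffices h : ∀ a b : List ℕ, (∃ x, a = b ++ x) ∨ (∃ x, b = a ++ x) ∨
      ∃ x y z i j, i ≠ j ∧ a = z ++ i :: x ∧ b = z ++ j :: y by
    rcases h u.reverse v.reverse with ⟨x, hx⟩ | ⟨x, hx⟩ | ⟨x, y, z, i, j, hij, hx, hy⟩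
    · refine Or.inl ⟨x.reverse, ?_⟩
      rw [← List.reverse_inj, hx]; simp
    · refine Or.inr (Or.inl ⟨x.reverse, ?_⟩)
      rw [← List.reverse_inj, hx]; simp
    · refine Or.inr (Or.inr ⟨x.reverse, y.reverse, z.reverse, i, j, hij, ?_, ?_⟩)
      · rw [← List.reverse_inj, hx]; simp
      · rw [← List.reverse_inj, hy]; simp
  intro a
  induction a with
  | nil => exact fun b => Or.inr (Or.inl ⟨b, rfl⟩)
  | cons i a ih =>
    intro b
    cases b with
    | nil => exact Or.inl ⟨i :: a, rfl⟩
    | cons j b =>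
      by_cases hij : i = j
      · subst hij
        rcases ih b with ⟨x, rfl⟩ | ⟨x, rfl⟩ | ⟨x, y, z, i', j', h', rfl, rfl⟩
        · exact Or.inl ⟨x, rfl⟩
        · exact Or.inr (Or.inl ⟨x, rfl⟩)
        · exact Or.inr (Or.inr ⟨x, y, i :: z, i', j', h', rfl, rfl⟩)
      · exact Or.inr (Or.inr ⟨a, b, [], i, j, hij, rfl, rfl⟩)

/-- Splitting a sum over pairs of words at the longest common suffix. -/
theorem tsum_pairs_le (F : List ℕ → List ℕ → ℝ≥0∞) :
    ∑' u, ∑' v, F u v ≤ ∑' z, ∑' x, F (x ++ z) z + ∑' z, ∑' x, F z (x ++ z) +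
      ∑' z, ∑' x, ∑' y, ∑' p : ℕ × ℕ,
        if p.1 ≠ p.2 then F (x ++ p.1 :: z) (y ++ p.2 :: z) else 0 := by
  let T := (List ℕ × List ℕ) ⊕ (List ℕ × List ℕ) ⊕
    {q : List ℕ × List ℕ × List ℕ × (ℕ × ℕ) // q.2.2.2.1 ≠ q.2.2.2.2}
  let g : T → List ℕ × List ℕ := fun t => match t with
    | Sum.inl q => (q.2 ++ q.1, q.1)
    | Sum.inr (Sum.inl q) => (q.1, q.2 ++ q.1)
    | Sum.inr (Sum.inr q) => (q.1.2.1 ++ q.1.2.2.2.1 :: q.1.1, q.1.2.2.1 ++ q.1.2.2.2.2 :: q.1.1)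
  have hg : Function.Surjective g := by
    rintro ⟨u, v⟩
    rcases exists_common_suffix u v with ⟨x, rfl⟩ | ⟨x, rfl⟩ | ⟨x, y, z, i, j, hij, rfl, rfl⟩
    · exact ⟨Sum.inl (v, x), rfl⟩
    · exact ⟨Sum.inr (Sum.inl (u, x)), rfl⟩
    · exact ⟨Sum.inr (Sum.inr ⟨(z, x, y, (i, j)), hij⟩), rfl⟩
  rw [← ENNReal.tsum_prod]
  refine (ENNReal.tsum_le_tsum_comp_of_surjective hg fun q => F q.1 q.2).trans ?_
  rw [Summable.tsum_sum ENNReal.summable ENNReal.summable,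
    Summable.tsum_sum ENNReal.summable ENNReal.summable, ← add_assoc]
  refine add_le_add (add_le_add ?_ ?_) ?_
  · rw [ENNReal.tsum_prod']
  · rw [ENNReal.tsum_prod']
  · have h := tsum_subtype {q : List ℕ × List ℕ × List ℕ × (ℕ × ℕ) | q.2.2.2.1 ≠ q.2.2.2.2}
      (fun q => F (q.2.1 ++ q.2.2.2.1 :: q.1) (q.2.2.1 ++ q.2.2.2.2 :: q.1))
    refine (le_of_eq h).trans ?_
    rw [ENNReal.tsum_prod']
    simp_rw [ENNReal.tsum_prod' (α := List ℕ)]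
    refine le_of_eq ?_
    refine tsum_congr fun z => tsum_congr fun x => tsum_congr fun y => tsum_congr fun p => ?_
    simp [Set.indicator_apply]

/-- A second moment bound for pairs of vertices in the same tree. -/
theorem tsum_same_tree_le (hmean : ∫⁻ n, (n : ℝ≥0∞) ∂μ = 1) (k : ℕ)
    (g : List ℕ → List ℕ → ℝ≥0∞) (χ φ : ℕ → ℝ≥0∞)
    (h1 : ∀ x z, g (x ++ z) z ≤ χ z.length * φ x.length)
    (h2 : ∀ x z, g z (x ++ z) ≤ χ z.length * φ x.length)
    (h3 : ∀ x y z i j, i ≠ j → g (x ++ i :: z) (y ++ j :: z) ≤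
      χ z.length * φ x.length * φ y.length) :
    ∑' u, ∑' v, childLaw μ {N | InForest N (k, u) ∧ InForest N (k, v)} * g u v ≤
      (∑' h, χ h) * (2 * ∑' a, φ a + (∫⁻ n, (n : ℝ≥0∞) ^ 2 ∂μ) * (∑' a, φ a) ^ 2) := by
  have hsub : ∀ x z, childLaw μ {N | InForest N (k, x ++ z) ∧ InForest N (k, z)} ≤
      wt μ z * wt μ x := by
    intro x z
    refine (measure_mono (t := {N | InForest N (k, x ++ z)}) fun N h => h.1).trans ?_
    rw [childLaw_inForest, wt_append, mul_comm]
  have hcomp : ∑' z, ∑' x, (wt μ z * wt μ x) * (χ z.length * φ x.length) =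
      (∑' h, χ h) * ∑' a, φ a := by
    have : ∀ z x : List ℕ, (wt μ z * wt μ x) * (χ z.length * φ x.length) =
        (wt μ z * χ z.length) * (wt μ x * φ x.length) := fun z x => by ring
    simp_rw [this, ENNReal.tsum_mul_left, ENNReal.tsum_mul_right, tsum_wt_mul μ hmean]
  refine (tsum_pairs_le _).trans ?_
  have hA : ∑' z, ∑' x, childLaw μ {N | InForest N (k, x ++ z) ∧ InForest N (k, z)} *
      g (x ++ z) z ≤ (∑' h, χ h) * ∑' a, φ a := by
    rw [← hcomp]
    gcongr with z x
    · exact hsub x z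
    · exact h1 x z
  have hB : ∑' z, ∑' x, childLaw μ {N | InForest N (k, z) ∧ InForest N (k, x ++ z)} *
      g z (x ++ z) ≤ (∑' h, χ h) * ∑' a, φ a := by
    rw [← hcomp]
    gcongr with z x
    · exact (measure_mono fun N (h : _ ∧ _) => And.intro h.2 h.1).trans (hsub x z)
    · exact h2 x z
  have hC : ∑' z, ∑' x, ∑' y, ∑' p : ℕ × ℕ, (if p.1 ≠ p.2 then
      childLaw μ {N | InForest N (k, x ++ p.1 :: z) ∧ InForest N (k, y ++ p.2 :: z)} *
      g (x ++ p.1 :: z) (y ++ p.2 :: z) else 0) ≤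
      (∑' h, χ h) * ((∫⁻ n, (n : ℝ≥0∞) ^ 2 ∂μ) * (∑' a, φ a) ^ 2) := by
    calc _ ≤ ∑' z, ∑' x, ∑' y, ∑' p : ℕ × ℕ, (wt μ z * χ z.length) * ((wt μ x * φ x.length) *
          ((wt μ y * φ y.length) * tail μ (max p.1 p.2))) := by
          gcongr with z x y p
          split_ifs with hp
          · rw [childLaw_inForest_branch μ k hp]
            refine (mul_le_mul_right (h3 x y z _ _ hp) _).trans (le_of_eq (by ring))
          · exact zero_le
      _ = _ := by
          simp_rw [ENNReal.tsum_mul_left, tsum_tail_max, ENNReal.tsum_mul_right,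
            tsum_wt_mul μ hmean]
          ring
  calc _ ≤ _ := add_le_add (add_le_add hA hB) hC
    _ = _ := by ring

theorem tsum_distinct_trees_le (hmean : ∫⁻ n, (n : ℝ≥0∞) ∂μ = 1) {k l : ℕ} (hkl : k ≠ l)
    (g : List ℕ → List ℕ → ℝ≥0∞) (φ : ℕ → ℝ≥0∞)
    (h : ∀ x y, g x y ≤ φ x.length * φ y.length) :
    ∑' u, ∑' v, childLaw μ {N | InForest N (k, u) ∧ InForest N (l, v)} * g u v ≤
      (∑' a, φ a) ^ 2 := by
  calc _ ≤ ∑' u, ∑' v, (wt μ u * φ u.length) * (wt μ v * φ v.length) := by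
        refine ENNReal.tsum_le_tsum fun u => ENNReal.tsum_le_tsum fun v => ?_
        rw [childLaw_inForest_of_ne μ hkl]
        refine (mul_le_mul_right (h u v) _).trans (le_of_eq (by ring))
    _ = _ := by
        simp_rw [ENNReal.tsum_mul_left, ENNReal.tsum_mul_right, tsum_wt_mul μ hmean, sq]

end ForestLaw

/-! ### Tree distance and the law of differences of positions. -/

section Positions

/-- The vertices, other than the root, on the path from the root to a vertex. -/
def pathVerts : Vertex → Finset Vertex
  | (k, []) => (Finset.range k).image fun i => (i + 1, [])
  | (k, j :: v) => insert (k, j :: v) (pathVerts (k, v))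

theorem mem_pathVerts {k : ℕ} {v : List ℕ} {f : Vertex} : f ∈ pathVerts (k, v) ↔
    (f.1 = k ∧ f.2 ≠ [] ∧ f.2 <:+ v) ∨ (f.2 = [] ∧ 1 ≤ f.1 ∧ f.1 ≤ k) := by
  induction v with
  | nil =>
    obtain ⟨l, w⟩ := f
    simp only [pathVerts, Finset.mem_image, Finset.mem_range, Prod.mk.injEq, List.suffix_nil]
    constructor
    · rintro ⟨i, hi, rfl, rfl⟩
      exact Or.inr ⟨rfl, by omega, by omega⟩
    · rintro (⟨-, h1, h2⟩ | ⟨rfl, h1, h2⟩)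
      · exact absurd h2 h1
      · exact ⟨l - 1, by omega, by omega, rfl⟩
  | cons j v ih =>
    obtain ⟨l, w⟩ := f
    simp only [pathVerts, Finset.mem_insert, ih, List.suffix_cons_iff, Prod.mk.injEq]
    constructor
    · rintro (⟨rfl, rfl⟩ | ⟨h1, h2, h3⟩ | h)
      · exact Or.inl ⟨rfl, by simp, Or.inl rfl⟩
      · exact Or.inl ⟨h1, h2, Or.inr h3⟩
      · exact Or.inr h
    · rintro (⟨h1, h2, h3 | h3⟩ | h)
      · exact Or.inl ⟨h1, h3⟩
      · exact Or.inr (Or.inl ⟨h1, h2, h3⟩)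
      · exact Or.inr (Or.inr h)

theorem notMem_pathVerts_parent (k j : ℕ) (v : List ℕ) : (k, j :: v) ∉ pathVerts (k, v) := by
  rw [mem_pathVerts]
  rintro (⟨-, -, h⟩ | ⟨h, -⟩)
  · have := h.length_le
    simp at this
  · simp at h

theorem position_eq_sum {d : ℕ} (X : Vertex → Lattice d) (k : ℕ) (v : List ℕ) :
    position X (k, v) = ∑ f ∈ pathVerts (k, v), X f := by
  induction v with
  | nil =>
    rw [position, pathVerts, Finset.sum_image]
    intro i _ j _ hij
    simpa using hij
  | cons j v ih =>
    rw [position, pathVerts, Finset.sum_insert (notMem_pathVerts_parent k j v), ih, add_comm]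

theorem card_pathVerts (k : ℕ) (v : List ℕ) : (pathVerts (k, v)).card = k + v.length := by
  induction v with
  | nil =>
    rw [pathVerts, Finset.card_image_of_injective]
    · simp
    · intro i j hij
      simpa using hij
  | cons j v ih =>
    rw [pathVerts, Finset.card_insert_of_notMem (notMem_pathVerts_parent k j v), ih]
    simp [add_assoc]

/-- The graph distance between two vertices. -/
def treeDist (u v : Vertex) : ℕ :=
  (pathVerts u \ pathVerts v).card + (pathVerts v \ pathVerts u).card

/-- The vertices between (k, w), excluded, and (k, x ++ w) are as many as the letters of x, and all
are missing from the other path. -/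
theorem length_le_card_sdiff {k l : ℕ} {x w v : List ℕ}
    (h : ∀ t, t <:+ x → t ≠ [] → (k, t ++ w) ∉ pathVerts (l, v)) :
    x.length ≤ (pathVerts (k, x ++ w) \ pathVerts (l, v)).card := by
  calc x.length = ((Finset.range x.length).image fun i => ((k, x.drop i ++ w) : Vertex)).card := by
        rw [Finset.card_image_of_injOn, Finset.card_range]
        intro i hi j hj hij
        simp only [Finset.coe_range, Set.mem_Iio] at hi hj
        have := congrArg (fun f : Vertex => f.2.length) hij
        simp only [List.length_append, List.length_drop] at this
        omega
    _ ≤ _ := by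
        refine Finset.card_le_card fun f hf => ?_
        obtain ⟨i, hi, rfl⟩ := Finset.mem_image.1 hf
        rw [Finset.mem_range] at hi
        have hne : x.drop i ≠ [] := by
          rw [Ne, List.drop_eq_nil_iff]; omega
        refine Finset.mem_sdiff.2 ⟨mem_pathVerts.2 (Or.inl ⟨rfl, by simp [hne], ?_⟩),
          h _ (List.drop_suffix i x) hne⟩
        obtain ⟨t, ht⟩ := List.drop_suffix i x
        exact ⟨t, by simp only; rw [← List.append_assoc, ht]⟩

theorem length_le_treeDist (k : ℕ) (x z : List ℕ) : x.length ≤ treeDist (k, x ++ z) (k, z) := by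
  refine (length_le_card_sdiff fun t _ ht hmem => ?_).trans (Nat.le_add_right _ _)
  rcases mem_pathVerts.1 hmem with ⟨-, -, h⟩ | ⟨h, -⟩
  · have := h.length_le
    have h2 := List.length_pos_iff.2 ht
    rw [List.length_append] at this
    omega
  · simp [ht] at h

theorem treeDist_comm (u v : Vertex) : treeDist u v = treeDist v u := add_comm _ _

theorem length_add_length_le_treeDist_of_ne {k l : ℕ} (hkl : k ≠ l) (x y : List ℕ) :
    x.length + y.length ≤ treeDist (k, x) (l, y) := by
  have key : ∀ {k l : ℕ}, k ≠ l → ∀ x y : List ℕ,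
      x.length ≤ (pathVerts (k, x) \ pathVerts (l, y)).card := by
    intro k l hkl x y
    have := length_le_card_sdiff (k := k) (l := l) (x := x) (w := []) (v := y) (by
      intro t _ ht hmem
      rcases mem_pathVerts.1 hmem with ⟨h, -⟩ | ⟨h, -⟩
      · exact hkl h
      · simp [ht] at h)
    simpa using this
  exact Nat.add_le_add (key hkl x y) (key hkl.symm y x)

theorem length_add_length_le_treeDist_branch (k : ℕ) {i j : ℕ} (hij : i ≠ j) (x y z : List ℕ) :
    x.length + y.length ≤ treeDist (k, x ++ i :: z) (k, y ++ j :: z) := by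
  have key : ∀ {i j : ℕ}, i ≠ j → ∀ x y : List ℕ, x.length ≤
      (pathVerts (k, x ++ i :: z) \ pathVerts (k, y ++ j :: z)).card := by
    intro i j hij x y
    refine length_le_card_sdiff fun t _ _ hmem => ?_
    rcases mem_pathVerts.1 hmem with ⟨-, -, h⟩ | ⟨h, -⟩
    · exact not_suffix_both hij h
    · simp at h
  exact Nat.add_le_add (key hij x y) (key hij.symm y x)

variable {d : ℕ}

theorem map_sum_eq_convPow {Ω ι : Type*} [MeasurableSpace Ω] {P : Measure Ω}
    [IsProbabilityMeasure P] {θ : Measure (Lattice d)} {Y : ι → Ω → Lattice d}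
    (hm : ∀ i, Measurable (Y i)) (hind : ProbabilityTheory.iIndepFun Y P)
    (hlaw : ∀ i, P.map (Y i) = θ) (F : Finset ι) :
    P.map (∑ i ∈ F, Y i) = convPow θ F.card := by
  classical
  induction F using Finset.induction_on with
  | empty =>
    simp only [Finset.sum_empty, Finset.card_empty, convPow]
    exact (Measure.map_const P (0 : Lattice d)).trans (by simp)
  | insert i F hi ih =>
    rw [Finset.sum_insert hi, Finset.card_insert_of_notMem hi, convPow, ← ih, ← hlaw i]
    exact (hind.indepFun_finsetSum_of_notMem hm hi).symm.map_add_eq_map_conv_map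
      (hm i) (Finset.sum_induction _ Measurable (fun _ _ h₁ h₂ => h₁.add h₂) measurable_zero
        fun j _ => hm j)

/-- The law of the displacements. -/
abbrev dispLaw (θ : Measure (Lattice d)) [IsProbabilityMeasure θ] : Measure (Vertex → Lattice d) :=
  Measure.infinitePi fun _ : Vertex => θ

variable (θ : Measure (Lattice d)) [IsProbabilityMeasure θ]

theorem map_position (k : ℕ) (v : List ℕ) :
    (dispLaw θ).map (fun X => position X (k, v)) = convPow θ (k + v.length) := by
  have h := map_sum_eq_convPow (P := dispLaw θ) (θ := θ) (Y := fun f X => X f)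
    (fun f => measurable_pi_apply f)
    (ProbabilityTheory.iIndepFun_infinitePi (X := fun _ (x : Lattice d) => x)
      (fun _ => measurable_id))
    (fun f => Measure.infinitePi_map_eval (fun _ : Vertex => θ) f) (pathVerts (k, v))
  rw [card_pathVerts] at h
  rw [← h]
  congr 1
  ext X : 1
  simp [position_eq_sum, Finset.sum_apply]

/-- The displacements on the common part of the paths cancel. Those on the path to v enter with a
minus sign, which the symmetry of θ removes, so the difference is a sum of `treeDist u v`
independent variables of law θ. -/
theorem map_position_sub (hsymm : θ.map (fun x => -x) = θ) (u v : Vertex) :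
    (dispLaw θ).map (fun X => position X u - position X v) = convPow θ (treeDist u v) := by
  classical
  set A := pathVerts u \ pathVerts v with hA
  set B := pathVerts v \ pathVerts u with hB
  have hdisj : Disjoint A B := by
    rw [Finset.disjoint_left]
    intro f hf hf'
    exact (Finset.mem_sdiff.1 hf).2 (Finset.mem_sdiff.1 hf').1
  have h := map_sum_eq_convPow (P := dispLaw θ) (θ := θ)
    (Y := fun f X => if f ∈ B then -X f else X f)
    (fun f => by by_cases hf : f ∈ B <;> simp only [hf, if_true, if_false] <;> fun_prop)
    (ProbabilityTheory.iIndepFun_infinitePi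
      (X := fun f (x : Lattice d) => if f ∈ B then -x else x)
      (fun _ => Measurable.of_discrete))
    (fun f => by
      by_cases hf : f ∈ B
      · simp only [hf, if_true]
        have h1 := Measure.infinitePi_map_eval (fun _ : Vertex => θ) f
        have h2 : (dispLaw θ).map ((fun x => -x) ∘ fun X : Vertex → Lattice d => X f) = θ := by
          rw [← Measure.map_map (by fun_prop) (by fun_prop), h1, hsymm]
        exact h2
      · simp only [hf, if_false]
        exact Measure.infinitePi_map_eval (fun _ : Vertex => θ) f) (A ∪ B)
  rw [Finset.card_union_of_disjoint hdisj] at h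
  rw [treeDist, ← h]
  congr 1
  ext X : 1
  rw [Finset.sum_apply, Finset.sum_union hdisj]
  have h1 : ∑ f ∈ A, (if f ∈ B then -X f else X f) = ∑ f ∈ A, X f :=
    Finset.sum_congr rfl fun f hf => if_neg (Finset.disjoint_left.1 hdisj hf)
  have h2 : ∑ f ∈ B, (if f ∈ B then -X f else X f) = -∑ f ∈ B, X f := by
    rw [← Finset.sum_neg_distrib]
    exact Finset.sum_congr rfl fun f hf => if_pos hf
  rw [h1, h2, ← sub_eq_add_neg]
  obtain ⟨k, x⟩ := u
  obtain ⟨l, y⟩ := v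
  rw [position_eq_sum, position_eq_sum, hA, hB, Finset.sum_sdiff_sub_sum_sdiff]

@[fun_prop]
theorem measurable_position (u : Vertex) :
    Measurable fun X : Vertex → Lattice d => position X u := by
  obtain ⟨k, v⟩ := u
  simp_rw [position_eq_sum]
  fun_prop

theorem lintegral_position_sub (hsymm : θ.map (fun x => -x) = θ) (u v : Vertex)
    (G : Lattice d → ℝ≥0∞) :
    ∫⁻ X, G (position X u - position X v) ∂(dispLaw θ) = ∫⁻ z, G z ∂(convPow θ (treeDist u v)) := by
  rw [← map_position_sub θ hsymm u v, lintegral_map Measurable.of_discrete (by fun_prop)]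

end Positions

/-! ### Truncated forest and concentration of its size. -/

section Truncation

/-- The vertex belongs to the part of the forest consisting of the vertices of height at most `H`
in the first `K` trees. -/
def InTrunc (N : Vertex → ℕ) (K H : ℕ) (u : Vertex) : Prop :=
  u.1 < K ∧ u.2.length ≤ H ∧ InForest N u

theorem measurableSet_sat (L : List (Vertex × ℕ)) : MeasurableSet {N : Vertex → ℕ | Sat N L} := by
  have : {N : Vertex → ℕ | Sat N L} = ⋂ p ∈ {p | p ∈ L}, {N | N p.1 ∈ Set.Ioi p.2} := by
    ext N; simp [Sat]
  rw [this]
  exact MeasurableSet.biInter (Set.to_countable _) fun p _ =>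
    measurable_pi_apply p.1 MeasurableSet.of_discrete

theorem measurableSet_inForest (u : Vertex) : MeasurableSet {N : Vertex → ℕ | InForest N u} := by
  obtain ⟨k, x⟩ := u
  simp_rw [inForest_iff_sat]
  exact measurableSet_sat _

theorem measurableSet_inTrunc (K H : ℕ) (u : Vertex) :
    MeasurableSet {N : Vertex → ℕ | InTrunc N K H u} := by
  have : {N : Vertex → ℕ | InTrunc N K H u} = {N | u.1 < K} ∩ ({N | u.2.length ≤ H} ∩
    {N | InForest N u}) := by ext N; simp [InTrunc]
  rw [this]
  exact (MeasurableSet.const _).inter ((MeasurableSet.const _).inter (measurableSet_inForest u))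

open Classical in
/-- The indicator of the truncated forest. -/
def incl (K H : ℕ) (u : Vertex) (N : Vertex → ℕ) : ℝ≥0∞ := if InTrunc N K H u then 1 else 0

theorem measurable_incl (K H : ℕ) (u : Vertex) : Measurable (incl K H u) := by
  unfold incl
  exact Measurable.ite (measurableSet_inTrunc K H u) measurable_const measurable_const

theorem lintegral_incl (P : Measure (Vertex → ℕ)) (K H : ℕ) (u : Vertex) :
    ∫⁻ N, incl K H u N ∂P = P {N | InTrunc N K H u} := by
  classical
  rw [← lintegral_indicator_one (measurableSet_inTrunc K H u)]
  refine lintegral_congr fun N => ?_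
  simp [incl, Set.indicator_apply]

theorem lintegral_incl_mul (P : Measure (Vertex → ℕ)) (K H : ℕ) (u v : Vertex) :
    ∫⁻ N, incl K H u N * incl K H v N ∂P =
      P {N | InTrunc N K H u ∧ InTrunc N K H v} := by
  classical
  have hm : MeasurableSet {N : Vertex → ℕ | InTrunc N K H u ∧ InTrunc N K H v} :=
    (measurableSet_inTrunc K H u).inter (measurableSet_inTrunc K H v)
  rw [← lintegral_indicator_one hm]
  refine lintegral_congr fun N => ?_
  by_cases h1 : InTrunc N K H u <;> by_cases h2 : InTrunc N K H v <;>
    simp [incl, h1, h2]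

variable (μ : Measure ℕ) [IsProbabilityMeasure μ]

theorem tsum_ite_lt (K : ℕ) (c : ℝ≥0∞) : ∑' k : ℕ, (if k < K then c else 0) = K * c := by
  rw [← tsum_lt K, ← ENNReal.tsum_mul_right]
  simp

theorem tsum_ite_le (H : ℕ) (φ : ℕ → ℝ≥0∞) :
    ∑' a : ℕ, (if a ≤ H then φ a else 0) = ∑ a ∈ Finset.range (H + 1), φ a := by
  rw [tsum_eq_sum (s := Finset.range (H + 1)) fun a ha => if_neg (by simpa using ha)]
  exact Finset.sum_congr rfl fun a ha => if_pos (by simpa [Nat.lt_succ_iff] using ha)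

/-- The expected number of vertices of the truncated forest, with weights. -/
theorem tsum_incl_le (hmean : ∫⁻ n, (n : ℝ≥0∞) ∂μ = 1) (K H : ℕ) (c : ℝ≥0∞) (g : Vertex → ℝ≥0∞)
    (hg : ∀ u : Vertex, u.1 < K → u.2.length ≤ H → g u ≤ c) :
    ∑' u, childLaw μ {N | InTrunc N K H u} * g u ≤ K * (H + 1) * c := by
  rw [ENNReal.tsum_prod']
  calc ∑' k, ∑' x, childLaw μ {N | InTrunc N K H (k, x)} * g (k, x)
      ≤ ∑' k, ∑' x, (if k < K then 1 else 0) *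
          (wt μ x * (if x.length ≤ H then c else 0)) := by
        refine ENNReal.tsum_le_tsum fun k => ENNReal.tsum_le_tsum fun x => ?_
        by_cases hk : k < K <;> by_cases hx : x.length ≤ H <;>
          simp only [InTrunc, hk, hx, true_and, false_and, if_true, if_false, mul_zero, zero_mul,
            one_mul, Set.ofPred_false, measure_empty, le_refl]
        rw [childLaw_inForest]
        exact mul_le_mul_right (hg _ hk hx) _
    _ = K * (H + 1) * c := by
        simp_rw [ENNReal.tsum_mul_left, tsum_wt_mul μ hmean (fun h => if h ≤ H then c else 0),
          tsum_ite_le, ENNReal.tsum_mul_right, tsum_ite_lt]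
        simp [mul_assoc]

theorem tsum_incl_eq (hmean : ∫⁻ n, (n : ℝ≥0∞) ∂μ = 1) (K H : ℕ) :
    ∑' u, childLaw μ {N | InTrunc N K H u} = K * (H + 1) := by
  rw [ENNReal.tsum_prod']
  calc ∑' k, ∑' x, childLaw μ {N | InTrunc N K H (k, x)}
      = ∑' k, ∑' x, (if k < K then 1 else 0) *
          (wt μ x * (if x.length ≤ H then 1 else 0)) := by
        refine tsum_congr fun k => tsum_congr fun x => ?_
        by_cases hk : k < K <;> by_cases hx : x.length ≤ H <;>
          simp only [InTrunc, hk, hx, true_and, false_and, if_true, if_false, mul_zero, zero_mul,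
            one_mul, Set.ofPred_false, measure_empty]
        rw [childLaw_inForest, mul_one]
    _ = K * (H + 1) := by
        simp_rw [ENNReal.tsum_mul_left, tsum_wt_mul μ hmean (fun h => if h ≤ H then 1 else 0),
          tsum_ite_le, ENNReal.tsum_mul_right, tsum_ite_lt]
        simp

/-- Pairs of trees contribute the square of the sum of φ, because the weight factorises over the two
heights. Pairs inside one tree are split at their last common ancestor, whose height ranges over H +
1 values; this gives the second term. -/
theorem tsum_pairs_incl_le (hmean : ∫⁻ n, (n : ℝ≥0∞) ∂μ = 1) (K H : ℕ)
    (g : Vertex → Vertex → ℝ≥0∞) (φ : ℕ → ℝ≥0∞)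
    (h1 : ∀ k x z, g (k, x ++ z) (k, z) ≤ φ x.length)
    (h2 : ∀ k x z, g (k, z) (k, x ++ z) ≤ φ x.length)
    (h3 : ∀ k x y z i j, i ≠ j → g (k, x ++ i :: z) (k, y ++ j :: z) ≤ φ x.length * φ y.length)
    (h4 : ∀ k l x y, k ≠ l → g (k, x) (l, y) ≤ φ x.length * φ y.length) :
    ∑' u, ∑' v, childLaw μ {N | InTrunc N K H u ∧ InTrunc N K H v} * g u v ≤
      K * K * (∑ a ∈ Finset.range (H + 1), φ a) ^ 2 +
        K * ((H + 1) * (2 * ∑ a ∈ Finset.range (H + 1), φ a +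
          (∫⁻ n, (n : ℝ≥0∞) ^ 2 ∂μ) * (∑ a ∈ Finset.range (H + 1), φ a) ^ 2)) := by
  set Φ := ∑ a ∈ Finset.range (H + 1), φ a with hΦ
  set Q := ((H : ℝ≥0∞) + 1) * (2 * Φ + (∫⁻ n, (n : ℝ≥0∞) ^ 2 ∂μ) * Φ ^ 2) with hQ
  -- The truncation at height `H` is moved into the weights, so that the formulas for the full
  -- forest apply.
  set ψ : ℕ → ℝ≥0∞ := fun a => if a ≤ H then φ a else 0 with hψ
  set χ : ℕ → ℝ≥0∞ := fun a => if a ≤ H then 1 else 0 with hχ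
  have hψsum : ∑' a, ψ a = Φ := tsum_ite_le H φ
  have hχsum : ∑' a, χ a = (H : ℝ≥0∞) + 1 := by rw [hχ, tsum_ite_le]; simp
  set g' : ℕ → ℕ → List ℕ → List ℕ → ℝ≥0∞ := fun k l x y =>
    if x.length ≤ H ∧ y.length ≤ H then g (k, x) (l, y) else 0 with hg'
  have hinner : ∀ k l, ∑' x, ∑' y,
      childLaw μ {N | InForest N (k, x) ∧ InForest N (l, y)} * g' k l x y ≤
      Φ ^ 2 + if k = l then Q else 0 := by
    intro k l
    by_cases hkl : k = l
    · subst hkl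
      rw [if_pos rfl]
      refine le_add_left ?_
      have h := tsum_same_tree_le μ hmean k (g' k k) χ ψ ?_ ?_ ?_
      · rwa [hψsum, hχsum] at h
      · intro x z
        simp only [hg', hχ, hψ, List.length_append]
        split_ifs with ha <;> first | exact zero_le | skip
        all_goals first | omega | skip
        rw [one_mul]; exact h1 k x z
      · intro x z
        simp only [hg', hχ, hψ, List.length_append]
        split_ifs with ha <;> first | exact zero_le | skip
        all_goals first | omega | skip
        rw [one_mul]; exact h2 k x z
      · intro x y z i j hij
        simp only [hg', hχ, hψ, List.length_append, List.length_cons]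
        split_ifs with ha <;> first | exact zero_le | skip
        all_goals first | omega | skip
        rw [one_mul]; exact h3 k x y z i j hij
    · rw [if_neg hkl, add_zero]
      have h := tsum_distinct_trees_le μ hmean hkl (g' k l) ψ ?_
      · rwa [hψsum] at h
      · intro x y
        simp only [hg', hψ]
        split_ifs with ha <;> first | exact zero_le | skip
        all_goals first | omega | skip
        exact h4 k l x y hkl
  calc ∑' u, ∑' v, childLaw μ {N | InTrunc N K H u ∧ InTrunc N K H v} * g u v
      = ∑' k, ∑' l, ∑' x, ∑' y,
          childLaw μ {N | InTrunc N K H (k, x) ∧ InTrunc N K H (l, y)} * g (k, x) (l, y) := by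
        rw [ENNReal.tsum_prod']
        refine tsum_congr fun k => ?_
        rw [ENNReal.tsum_comm]
        rw [ENNReal.tsum_prod']
        refine tsum_congr fun l => ?_
        rw [ENNReal.tsum_comm]
    _ ≤ ∑' k, ∑' l, (if k < K then 1 else 0) * ((if l < K then 1 else 0) *
          ∑' x, ∑' y, childLaw μ {N | InForest N (k, x) ∧ InForest N (l, y)} * g' k l x y) := by
        refine ENNReal.tsum_le_tsum fun k => ENNReal.tsum_le_tsum fun l => ?_
        by_cases hk : k < K
        · by_cases hl : l < K
          · simp only [hk, hl, if_true, one_mul]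
            refine ENNReal.tsum_le_tsum fun x => ENNReal.tsum_le_tsum fun y => ?_
            by_cases hxy : x.length ≤ H ∧ y.length ≤ H
            · simp only [hg', hxy, InTrunc, hk, hl, true_and, and_self, if_true, le_refl]
            · have : {N : Vertex → ℕ | InTrunc N K H (k, x) ∧ InTrunc N K H (l, y)} = ∅ := by
                ext N
                simp only [InTrunc, Set.mem_ofPred_eq, Set.mem_empty_iff_false, iff_false]
                tauto
              rw [this]; simp
          · simp [InTrunc, hl]
        · simp [InTrunc, hk]
    _ ≤ ∑' k, ∑' l, (if k < K then 1 else 0) * ((if l < K then 1 else 0) *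
          (Φ ^ 2 + if k = l then Q else 0)) := by
        gcongr with k l
        exact hinner k l
    _ ≤ ∑' k : ℕ, (if k < K then (K * Φ ^ 2 + Q) else 0) := by
        refine ENNReal.tsum_le_tsum fun k => ?_
        rw [ENNReal.tsum_mul_left]
        split_ifs with hk
        · rw [one_mul]
          calc ∑' l : ℕ, (if l < K then (1 : ℝ≥0∞) else 0) * (Φ ^ 2 + if k = l then Q else 0)
              ≤ ∑' l : ℕ, ((if l < K then Φ ^ 2 else 0) + if l = k then Q else 0) := by
                refine ENNReal.tsum_le_tsum fun l => ?_
                by_cases hl : l < K <;> simp [hl, eq_comm]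
            _ = K * Φ ^ 2 + Q := by
                rw [ENNReal.tsum_add, tsum_ite_lt, tsum_ite_eq]
        · simp
    _ = K * K * Φ ^ 2 + K * Q := by rw [tsum_ite_lt]; ring

/-- The number of vertices of the truncated forest. -/
def truncCount (K H : ℕ) (N : Vertex → ℕ) : ℝ≥0∞ := ∑' u, incl K H u N

theorem measurable_truncCount (K H : ℕ) : Measurable (truncCount K H) :=
  Measurable.tsum fun u => measurable_incl K H u

theorem lintegral_truncCount (hmean : ∫⁻ n, (n : ℝ≥0∞) ∂μ = 1) (K H : ℕ) :
    ∫⁻ N, truncCount K H N ∂(childLaw μ) = K * (H + 1) := by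
  unfold truncCount
  rw [lintegral_tsum fun u => (measurable_incl K H u).aemeasurable]
  simp_rw [lintegral_incl]
  exact tsum_incl_eq μ hmean K H

theorem lintegral_truncCount_sq_le (hmean : ∫⁻ n, (n : ℝ≥0∞) ∂μ = 1) (K H : ℕ) :
    ∫⁻ N, truncCount K H N ^ 2 ∂(childLaw μ) ≤
      (K * (H + 1)) ^ 2 + K * (H + 1) ^ 3 * (2 + ∫⁻ n, (n : ℝ≥0∞) ^ 2 ∂μ) := by
  have hsq : ∀ N : Vertex → ℕ, truncCount K H N ^ 2 =
      ∑' u, ∑' v, incl K H u N * incl K H v N := by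
    intro N
    simp_rw [truncCount, sq, ENNReal.tsum_mul_left, ENNReal.tsum_mul_right]
  simp_rw [hsq]
  have hm : ∀ u v, Measurable fun N => incl K H u N * incl K H v N := fun u v =>
    (measurable_incl K H u).mul (measurable_incl K H v)
  rw [lintegral_tsum fun u => (Measurable.tsum fun v => hm u v).aemeasurable]
  simp_rw [lintegral_tsum fun v => (hm _ v).aemeasurable, lintegral_incl_mul]
  have h := tsum_pairs_incl_le μ hmean K H (fun _ _ => 1) (fun _ => 1) (by simp) (by simp)
    (by simp) (by simp)
  simp only [mul_one, Finset.sum_const, Finset.card_range, nsmul_one, Nat.cast_add,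
    Nat.cast_one] at h
  refine h.trans ?_
  set m := ∫⁻ n, (n : ℝ≥0∞) ^ 2 ∂μ
  calc (K : ℝ≥0∞) * K * (H + 1) ^ 2 + K * ((H + 1) * (2 * (H + 1) + m * (H + 1) ^ 2))
      = (K * (H + 1)) ^ 2 + (K * (H + 1) ^ 2) * (2 * 1 + m * (H + 1)) := by ring
    _ ≤ (K * (H + 1)) ^ 2 + (K * (H + 1) ^ 2) * (2 * (H + 1) + m * (H + 1)) := by
        gcongr
        exact le_add_self
    _ = _ := by ring

/-- The truncated forest is unlikely to have less than half of its expected size. -/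
theorem childLaw_truncCount_le (hmean : ∫⁻ n, (n : ℝ≥0∞) ∂μ = 1)
    (hvar : ∫⁻ n, (n : ℝ≥0∞) ^ 2 ∂μ ≠ ∞) {K H n : ℕ} (hK : 0 < K) (hn : 2 * n ≤ K * (H + 1)) :
    childLaw μ {N | truncCount K H N ≤ n} ≤
      ENNReal.ofReal (4 * (2 + (∫⁻ n, (n : ℝ≥0∞) ^ 2 ∂μ).toReal) * (H + 1) / K) := by
  set S := truncCount K H with hS
  set m := ∫⁻ n, (n : ℝ≥0∞) ^ 2 ∂μ with hm
  have hSm : Measurable S := measurable_truncCount K H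
  have hE : ∫⁻ N, S N ∂(childLaw μ) = K * (H + 1) := lintegral_truncCount μ hmean K H
  have hE2 := lintegral_truncCount_sq_le μ hmean K H
  have hfin2 : ((K : ℝ≥0∞) * (H + 1)) ^ 2 + K * (H + 1) ^ 3 * (2 + m) ≠ ∞ := by
    finiteness
  have htop : ∀ᵐ N ∂(childLaw μ), S N < ∞ := by
    refine ae_lt_top hSm ?_
    rw [hE]; finiteness
  have hEY : ∫ N, (S N).toReal ∂(childLaw μ) = K * (H + 1) := by
    rw [integral_toReal hSm.aemeasurable htop, hE, ENNReal.toReal_mul,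
      ENNReal.toReal_add (by finiteness) (by finiteness)]
    simp
  have hY2 : ∫⁻ N, ENNReal.ofReal ((S N).toReal ^ 2) ∂(childLaw μ) =
      ∫⁻ N, S N ^ 2 ∂(childLaw μ) := by
    refine lintegral_congr_ae ?_
    filter_upwards [htop] with N hN
    rw [ENNReal.ofReal_pow ENNReal.toReal_nonneg, ENNReal.ofReal_toReal hN.ne]
  have hmem : MemLp (fun N => (S N).toReal) 2 (childLaw μ) := by
    rw [memLp_two_iff_integrable_sq hSm.ennreal_toReal.aestronglyMeasurable]
    refine ⟨(hSm.ennreal_toReal.pow_const 2).aestronglyMeasurable, ?_⟩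
    rw [hasFiniteIntegral_iff_ofReal (ae_of_all _ fun N => sq_nonneg _), hY2]
    exact (hE2.trans_lt hfin2.lt_top)
  have hEY2 : ∫ N, (S N).toReal ^ 2 ∂(childLaw μ) ≤
      (K * (H + 1)) ^ 2 + K * (H + 1) ^ 3 * (2 + m.toReal) := by
    rw [integral_eq_lintegral_of_nonneg_ae (ae_of_all _ fun N => sq_nonneg _)
      (hSm.ennreal_toReal.pow_const 2).aestronglyMeasurable, hY2]
    have := ENNReal.toReal_mono hfin2 hE2
    refine this.trans (le_of_eq ?_)
    rw [ENNReal.toReal_add (by finiteness) (by finiteness)]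
    simp only [ENNReal.toReal_mul, ENNReal.toReal_pow, ENNReal.toReal_natCast]
    rw [ENNReal.toReal_add (by finiteness) (by finiteness),
      ENNReal.toReal_add (by finiteness) (by finiteness)]
    simp
  have hV : ProbabilityTheory.variance (fun N => (S N).toReal) (childLaw μ) ≤
      K * (H + 1) ^ 3 * (2 + m.toReal) := by
    rw [ProbabilityTheory.variance_eq_sub hmem]
    simp only [Pi.pow_apply]
    rw [hEY]
    linarith
  -- Chebyshev at half the mean, as n is at most half of K(H + 1). The variance is of order K(H +
  -- 1)^3, which leaves the ratio (H + 1) / K.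
  have hc : (0 : ℝ) < K * (H + 1) / 2 := by positivity
  have hcheb := ProbabilityTheory.meas_ge_le_variance_div_sq hmem hc
  rw [hEY] at hcheb
  refine (measure_mono ?_).trans (hcheb.trans (ENNReal.ofReal_le_ofReal ?_))
  · intro N hN
    simp only [Set.mem_ofPred_eq] at hN ⊢
    have h1 : (S N).toReal ≤ n := by
      have := ENNReal.toReal_mono (by simp) hN
      simpa using this
    have h2 : (2 : ℝ) * n ≤ K * (H + 1) := by exact_mod_cast hn
    rw [abs_sub_comm]
    refine le_trans ?_ (le_abs_self _)
    linarith
  · have hK' : (0 : ℝ) < K := by exact_mod_cast hK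
    rw [div_le_div_iff₀ (by positivity) hK']
    calc _ ≤ K * (H + 1) ^ 3 * (2 + m.toReal) * (K : ℝ) := by gcongr
      _ = _ := by ring

end Truncation

/-! ### Expected Green energy of the truncated forest. -/

section Energy

variable {d : ℕ}

/-- The mutual energy of the positions of the vertices of the truncated forest. -/
def energy (η : Measure (Lattice d)) (K H : ℕ) (ω : (Vertex → ℕ) × (Vertex → Lattice d)) : ℝ≥0∞ :=
  ∑' u, ∑' v, incl K H u ω.1 * incl K H v ω.1 * green η (position ω.2 u - position ω.2 v)

theorem measurable_energy_term (η : Measure (Lattice d)) (K H : ℕ) (u v : Vertex) :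
    Measurable fun ω : (Vertex → ℕ) × (Vertex → Lattice d) =>
      incl K H u ω.1 * incl K H v ω.1 * green η (position ω.2 u - position ω.2 v) := by
  have h1 : Measurable fun ω : (Vertex → ℕ) × (Vertex → Lattice d) => incl K H u ω.1 :=
    (measurable_incl K H u).comp measurable_fst
  have h2 : Measurable fun ω : (Vertex → ℕ) × (Vertex → Lattice d) => incl K H v ω.1 :=
    (measurable_incl K H v).comp measurable_fst
  have h3 : Measurable fun ω : (Vertex → ℕ) × (Vertex → Lattice d) =>
      green η (position ω.2 u - position ω.2 v) :=
    (Measurable.of_discrete (f := green η)).comp (by fun_prop)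
  exact (h1.mul h2).mul h3

theorem measurable_energy (η : Measure (Lattice d)) (K H : ℕ) : Measurable (energy η K H) :=
  Measurable.tsum fun u => Measurable.tsum fun v => measurable_energy_term η K H u v

theorem lintegral_energy (μ : Measure ℕ) [IsProbabilityMeasure μ] (θ η : Measure (Lattice d))
    [IsProbabilityMeasure θ] (hsymm : θ.map (fun x => -x) = θ) (K H : ℕ) :
    ∫⁻ ω, energy η K H ω ∂(brwLaw μ θ) =
      ∑' u, ∑' v, childLaw μ {N | InTrunc N K H u ∧ InTrunc N K H v} *
        ∫⁻ z, green η z ∂(convPow θ (treeDist u v)) := by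
  unfold energy
  rw [lintegral_tsum fun u => (Measurable.tsum fun v =>
    measurable_energy_term η K H u v).aemeasurable]
  refine tsum_congr fun u => ?_
  rw [lintegral_tsum fun v => (measurable_energy_term η K H u v).aemeasurable]
  refine tsum_congr fun v => ?_
  rw [← lintegral_incl_mul, ← lintegral_position_sub θ hsymm, brwLaw]
  exact lintegral_prod_mul (f := fun N => incl K H u N * incl K H v N)
    (g := fun X => green η (position X u - position X v))
    ((measurable_incl K H u).mul (measurable_incl K H v)).aemeasurable
    ((Measurable.of_discrete (f := green η)).comp (by fun_prop)).aemeasurable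

/-- Bernoulli's inequality with exponent 1 - r shows that x^(1-r) / (1-r) increases by at least
x^(-r) between x - 1 and x; the sum telescopes. -/
theorem sum_rpow_neg_le {r : ℝ} (hr0 : 0 ≤ r) (hr1 : r < 1) (M : ℕ) :
    ∑ a ∈ Finset.range M, ((a : ℝ) + 1) ^ (-r) ≤ (M : ℝ) ^ (1 - r) / (1 - r) := by
  have h1r : 0 < 1 - r := by linarith
  induction M with
  | zero => simp [Real.zero_rpow h1r.ne']
  | succ M ih =>
    rw [Finset.sum_range_succ]
    set x : ℝ := (M : ℝ) + 1 with hx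
    have hxpos : 0 < x := by positivity
    have hM : (M : ℝ) = x * (1 + -(1 / x)) := by
      rw [hx]; field_simp; ring
    have hle1 : 1 / x ≤ 1 := by
      rw [div_le_one hxpos, hx]; simp
    have hB := rpow_one_add_le_one_add_mul_self (s := -(1 / x)) (by linarith) h1r.le (by linarith)
    have h2 : (M : ℝ) ^ (1 - r) ≤ x ^ (1 - r) - (1 - r) * x ^ (-r) := by
      rw [hM, Real.mul_rpow hxpos.le (by linarith)]
      calc x ^ (1 - r) * (1 + -(1 / x)) ^ (1 - r)
          ≤ x ^ (1 - r) * (1 + (1 - r) * -(1 / x)) := by gcongr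
        _ = x ^ (1 - r) - (1 - r) * (x ^ (1 - r) / x) := by ring
        _ = x ^ (1 - r) - (1 - r) * x ^ (-r) := by
          rw [← Real.rpow_sub_one hxpos.ne']; congr 3; ring
    push_cast
    rw [← hx]
    calc _ ≤ (M : ℝ) ^ (1 - r) / (1 - r) + x ^ (-r) := by gcongr
      _ ≤ (x ^ (1 - r) - (1 - r) * x ^ (-r)) / (1 - r) + x ^ (-r) := by gcongr
      _ = x ^ (1 - r) / (1 - r) := by field_simp; ring

/-- A bound for the expected energy of the truncated forest. -/
theorem exists_lintegral_energy_le (hd3 : 3 ≤ d) (hd5 : d ≤ 5) (μ : Measure ℕ)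
    [IsProbabilityMeasure μ] (θ η : Measure (Lattice d)) [IsProbabilityMeasure θ]
    [IsProbabilityMeasure η] (hmean : ∫⁻ n, (n : ℝ≥0∞) ∂μ = 1)
    (hvar : ∫⁻ n, (n : ℝ≥0∞) ^ 2 ∂μ ≠ ∞) (hsymm : θ.map (fun x => -x) = θ)
    (hθ : IsIrreducible θ) (hη : IsIrreducible η) :
    ∃ C : ℝ, 0 < C ∧ ∀ K H M : ℕ, K ≤ M → H + 1 ≤ M →
      ∫⁻ ω, energy η K H ω ∂(brwLaw μ θ) ≤
        ENNReal.ofReal (C * (M : ℝ) ^ (4 - ((d : ℝ) - 2) / 2)) := by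
  obtain ⟨C₀, hC₀, hgreen⟩ := exists_lintegral_green_le hd3 hθ hη
  -- Half of the decay exponent of the averaged Green function: since D ≥ a + b, the decay (D +
  -- 1)^(-2r) is at most (a + 1)^(-r) (b + 1)^(-r), which factorises over two branches of lengths a
  -- and b. As d ≤ 5, r < 1.
  set r : ℝ := ((d : ℝ) - 2) / 4 with hr
  have hd3' : (3 : ℝ) ≤ d := by exact_mod_cast hd3
  have hd5' : (d : ℝ) ≤ 5 := by exact_mod_cast hd5
  have hr0 : 0 ≤ r := by rw [hr]; linarith
  have hr1 : r < 1 := by rw [hr]; linarith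
  -- The lower bound 1 makes `C₀ ≤ c * c`, so one weight φ serves both for single branches and for
  -- products.
  set c : ℝ := max 1 C₀ with hc
  have hc1 : 1 ≤ c := le_max_left _ _
  have hcC : C₀ ≤ c := le_max_right _ _
  set φ : ℕ → ℝ≥0∞ := fun a => ENNReal.ofReal (c * ((a : ℝ) + 1) ^ (-r)) with hφ
  have hγ2 : ∀ D a b : ℕ, a + b ≤ D →
      ∫⁻ z, green η z ∂(convPow θ D) ≤ φ a * φ b := by
    intro D a b hab
    refine (hgreen D).trans ?_
    rw [hφ, ← ENNReal.ofReal_mul (by positivity)]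
    refine ENNReal.ofReal_le_ofReal ?_
    have hab' : (a : ℝ) + b ≤ D := by exact_mod_cast hab
    have ha0 : (0 : ℝ) ≤ a := by positivity
    have hb0 : (0 : ℝ) ≤ b := by positivity
    have h1 : ((D : ℝ) + 1) ^ (-r) ≤ ((a : ℝ) + 1) ^ (-r) :=
      Real.rpow_le_rpow_of_nonpos (by positivity) (by linarith) (by linarith)
    have h2 : ((D : ℝ) + 1) ^ (-r) ≤ ((b : ℝ) + 1) ^ (-r) :=
      Real.rpow_le_rpow_of_nonpos (by positivity) (by linarith) (by linarith)
    rw [show -(((d : ℝ) - 2) / 2) = -r + -r by rw [hr]; ring, Real.rpow_add (by positivity)]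
    calc C₀ * (((D : ℝ) + 1) ^ (-r) * ((D : ℝ) + 1) ^ (-r))
        ≤ (c * c) * (((a : ℝ) + 1) ^ (-r) * ((b : ℝ) + 1) ^ (-r)) := by
          gcongr
          nlinarith
      _ = _ := by ring
  have hγ1 : ∀ D a : ℕ, a ≤ D → ∫⁻ z, green η z ∂(convPow θ D) ≤ φ a := by
    intro D a ha
    refine (hgreen D).trans (ENNReal.ofReal_le_ofReal ?_)
    have ha' : (a : ℝ) ≤ D := by exact_mod_cast ha
    have ha0 : (0 : ℝ) ≤ a := by positivity
    have h1 : ((D : ℝ) + 1) ^ (-(((d : ℝ) - 2) / 2)) ≤ ((D : ℝ) + 1) ^ (-r) := by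
      refine Real.rpow_le_rpow_of_exponent_le (by linarith) ?_
      rw [hr]; linarith
    have h2 : ((D : ℝ) + 1) ^ (-r) ≤ ((a : ℝ) + 1) ^ (-r) :=
      Real.rpow_le_rpow_of_nonpos (by positivity) (by linarith) (by linarith)
    gcongr
    exact h1.trans h2
  set m := ∫⁻ n, (n : ℝ≥0∞) ^ 2 ∂μ with hm
  refine ⟨(3 + m.toReal) * (c / (1 - r)) ^ 2, ?_, fun K H M hK hH => ?_⟩
  · have : 0 < 1 - r := by linarith
    positivity
  rw [lintegral_energy μ θ η hsymm]
  refine (tsum_pairs_incl_le μ hmean K H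
    (fun u v => ∫⁻ z, green η z ∂(convPow θ (treeDist u v))) φ
    (fun k x z => hγ1 _ _ (length_le_treeDist k x z))
    (fun k x z => hγ1 _ _ (by rw [treeDist_comm]; exact length_le_treeDist k x z))
    (fun k x y z i j hij => hγ2 _ _ _ (length_add_length_le_treeDist_branch k hij x y z))
    (fun k l x y hkl => hγ2 _ _ _ (length_add_length_le_treeDist_of_ne hkl x y))).trans ?_
  have h1r : 0 < 1 - r := by linarith
  have hM1 : (1 : ℝ) ≤ M := by
    have : 1 ≤ M := by omega
    exact_mod_cast this
  set B : ℝ := c / (1 - r) * (M : ℝ) ^ (1 - r) with hB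
  have hB1 : 1 ≤ B := by
    have h1 : 1 ≤ c / (1 - r) := by rw [le_div_iff₀ h1r]; linarith
    have h2 : 1 ≤ (M : ℝ) ^ (1 - r) := Real.one_le_rpow hM1 h1r.le
    rw [hB]
    nlinarith
  have hΦ : ∑ a ∈ Finset.range (H + 1), φ a ≤ ENNReal.ofReal B := by
    rw [hφ, ← ENNReal.ofReal_sum_of_nonneg fun a _ => by positivity, ← Finset.mul_sum]
    refine ENNReal.ofReal_le_ofReal ?_
    calc c * ∑ a ∈ Finset.range (H + 1), ((a : ℝ) + 1) ^ (-r)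
        ≤ c * (((H + 1 : ℕ) : ℝ) ^ (1 - r) / (1 - r)) := by
          gcongr; exact sum_rpow_neg_le hr0 hr1 _
      _ ≤ c * ((M : ℝ) ^ (1 - r) / (1 - r)) := by
          gcongr
      _ = B := by rw [hB]; ring
  have hKM : (K : ℝ≥0∞) ≤ M := by exact_mod_cast hK
  have hHM : (H : ℝ≥0∞) + 1 ≤ M := by exact_mod_cast hH
  have hBe : 1 ≤ ENNReal.ofReal B := by simpa using ENNReal.ofReal_le_ofReal hB1
  -- Pairs of ancestor and descendant give a term linear in B; it is absorbed by the quadratic ones.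
  have hBsq : ENNReal.ofReal B ≤ ENNReal.ofReal B ^ 2 := by
    rw [sq]; exact le_mul_of_one_le_left' hBe
  calc _ ≤ (M : ℝ≥0∞) * M * ENNReal.ofReal B ^ 2 + M * (M * (2 * ENNReal.ofReal B ^ 2 +
        m * ENNReal.ofReal B ^ 2)) := by
        gcongr
        exact hΦ.trans hBsq
    _ = (3 + m) * (M ^ 2 * ENNReal.ofReal B ^ 2) := by ring
    _ = ENNReal.ofReal ((3 + m.toReal) * ((M : ℝ) ^ 2 * B ^ 2)) := by
        have hB0 : 0 ≤ B := by linarith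
        rw [ENNReal.ofReal_mul (p := 3 + m.toReal) (by positivity),
          ENNReal.ofReal_add (by positivity) (by positivity),
          ENNReal.ofReal_toReal hvar, ENNReal.ofReal_mul (p := (M : ℝ) ^ 2) (by positivity),
          ENNReal.ofReal_pow (by positivity), ENNReal.ofReal_pow hB0,
          ENNReal.ofReal_natCast]
        simp
    _ = _ := by
        congr 1
        rw [hB, mul_pow, ← Real.rpow_natCast _ 2, ← Real.rpow_natCast ((M : ℝ) ^ (1 - r)) 2,
          ← Real.rpow_mul (by positivity)]
        rw [show (4 - ((d : ℝ) - 2) / 2) = 2 + (1 - r) * 2 by rw [hr]; ring,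
          Real.rpow_add (by linarith)]
        push_cast
        ring

end Energy

/-! ### Exponential moments and the maximal displacement. -/

section Displacement

variable {d : ℕ}

theorem exp_le_one_add_add_sq_mul (y : ℝ) : Real.exp y ≤ 1 + y + y ^ 2 * Real.exp |y| := by
  rcases le_total 0 y with hy | hy
  · rw [abs_of_nonneg hy]
    have h1 : Real.exp y * (1 - y) ≤ 1 := by
      calc Real.exp y * (1 - y) ≤ Real.exp y * Real.exp (-y) := by
            gcongr; linarith [Real.add_one_le_exp (-y)]
        _ = 1 := by rw [← Real.exp_add]; simp
    nlinarith [Real.add_one_le_exp y]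
  · rw [abs_of_nonpos hy]
    have h1 : 1 ≤ Real.exp (-y) := Real.one_le_exp (by linarith)
    have h2 : Real.exp y * (1 - y) ≤ 1 := by
      calc Real.exp y * (1 - y) ≤ Real.exp y * Real.exp (-y) := by
            gcongr; linarith [Real.add_one_le_exp (-y)]
        _ = 1 := by rw [← Real.exp_add]; simp
    have h3 : Real.exp y ≤ 1 + y + y ^ 2 := by
      have h4 : Real.exp y ≤ 1 / (1 - y) := by
        rw [le_div_iff₀ (by linarith)]; exact h2
      refine h4.trans ?_
      rw [div_le_iff₀ (by linarith)]
      nlinarith [mul_nonneg (sq_nonneg y) (neg_nonneg.2 hy)]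
    nlinarith [sq_nonneg y]

theorem abs_le_euclNorm (x : Lattice d) (i : Fin d) : |(x i : ℝ)| ≤ euclNorm x := by
  refine Real.abs_le_sqrt ?_
  exact Finset.single_le_sum (f := fun i => (x i : ℝ) ^ 2) (fun _ _ => sq_nonneg _)
    (Finset.mem_univ i)

variable (θ : Measure (Lattice d))

theorem lintegral_exp_convPow (t : ℝ) (i : Fin d) (m : ℕ) :
    ∫⁻ z, ENNReal.ofReal (Real.exp (t * z i)) ∂(convPow θ m) =
      (∫⁻ x, ENNReal.ofReal (Real.exp (t * x i)) ∂θ) ^ m := by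
  induction m with
  | zero => simp [convPow]
  | succ m ih =>
    rw [convPow, Measure.lintegral_conv Measurable.of_discrete, pow_succ', ← ih]
    have : ∀ x y : Lattice d, ENNReal.ofReal (Real.exp (t * ((x + y) i : ℤ))) =
        ENNReal.ofReal (Real.exp (t * x i)) * ENNReal.ofReal (Real.exp (t * y i)) := by
      intro x y
      rw [← ENNReal.ofReal_mul (Real.exp_pos _).le, ← Real.exp_add]
      congr 2
      push_cast [Pi.add_apply]
      ring
    simp_rw [this]
    simp_rw [lintegral_const_mul _ (Measurable.of_discrete (α := Lattice d))]
    rw [lintegral_mul_const _ Measurable.of_discrete]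

variable [IsProbabilityMeasure θ]

/-- Symmetry kills the linear term of the exponential, so the moment generating function is 1 +
O(t^2). -/
theorem exists_mgf_le (hsymm : θ.map (fun x => -x) = θ) {c : ℝ} (hc : 0 < c)
    (hint : Integrable (fun x => Real.exp (c * euclNorm x)) θ) (i : Fin d) :
    ∃ C : ℝ, 0 < C ∧ ∀ t : ℝ, |t| ≤ c / 2 →
      ∫⁻ x, ENNReal.ofReal (Real.exp (t * x i)) ∂θ ≤ ENNReal.ofReal (Real.exp (C * t ^ 2)) := by
  set E := ∫ x, Real.exp (c * euclNorm x) ∂θ with hE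
  have hE0 : 0 ≤ E := integral_nonneg fun x => (Real.exp_pos _).le
  have hlin : Integrable (fun x : Lattice d => (x i : ℝ)) θ := by
    refine (hint.const_mul (1 / c)).mono' Measurable.of_discrete.aestronglyMeasurable
      (ae_of_all _ fun x => ?_)
    have h1 := Real.add_one_le_exp (c * euclNorm x)
    have h2 := abs_le_euclNorm x i
    rw [Real.norm_eq_abs]
    refine h2.trans ?_
    rw [one_div, inv_mul_eq_div, le_div_iff₀ hc]
    linarith
  have hzero : ∫ x, (x i : ℝ) ∂θ = 0 := by
    have h1 : ∫ x, (x i : ℝ) ∂θ = ∫ x, -(x i : ℝ) ∂θ := by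
      conv_lhs => rw [← hsymm]
      rw [integral_map (by fun_prop) Measurable.of_discrete.aestronglyMeasurable]
      simp
    rw [integral_neg] at h1
    linarith
  refine ⟨8 / c ^ 2 * E + 1, by positivity, fun t ht => ?_⟩
  have hpt : ∀ x : Lattice d, Real.exp (t * x i) ≤
      1 + t * x i + t ^ 2 * (8 / c ^ 2) * Real.exp (c * euclNorm x) := by
    intro x
    refine (exp_le_one_add_add_sq_mul _).trans ?_
    have h2 := abs_le_euclNorm x i
    have habs : |t * (x i : ℝ)| ≤ c / 2 * euclNorm x := by
      rw [abs_mul]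
      gcongr
    -- Half of the exponential moment pays for the square, the other half for exp |t x_i|; this is
    -- where |t| ≤ c/2 comes from.
    have hsq : (x i : ℝ) ^ 2 ≤ 8 / c ^ 2 * Real.exp (c / 2 * euclNorm x) := by
      have h0 : 0 ≤ euclNorm x := Real.sqrt_nonneg _
      have h3 := Real.quadratic_le_exp_of_nonneg (x := c / 2 * euclNorm x) (by positivity)
      have h4 : (x i : ℝ) ^ 2 ≤ euclNorm x ^ 2 := by
        rw [← sq_abs]; gcongr
      refine h4.trans ?_
      rw [div_mul_eq_mul_div, le_div_iff₀ (by positivity)]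
      nlinarith [mul_nonneg hc.le h0]
    have : (t * (x i : ℝ)) ^ 2 * Real.exp |t * (x i : ℝ)| ≤
        t ^ 2 * (8 / c ^ 2) * Real.exp (c * euclNorm x) := by
      calc (t * (x i : ℝ)) ^ 2 * Real.exp |t * (x i : ℝ)|
          = t ^ 2 * (x i : ℝ) ^ 2 * Real.exp |t * (x i : ℝ)| := by ring
        _ ≤ t ^ 2 * (8 / c ^ 2 * Real.exp (c / 2 * euclNorm x)) *
            Real.exp (c / 2 * euclNorm x) := by
            gcongr
        _ = t ^ 2 * (8 / c ^ 2) *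
            (Real.exp (c / 2 * euclNorm x) * Real.exp (c / 2 * euclNorm x)) := by ring
        _ = _ := by rw [← Real.exp_add]; congr 2; ring
    linarith
  have hbound : Integrable (fun x : Lattice d =>
      1 + t * x i + t ^ 2 * (8 / c ^ 2) * Real.exp (c * euclNorm x)) θ :=
    ((integrable_const 1).add (hlin.const_mul t)).add (hint.const_mul _)
  have hexp : Integrable (fun x : Lattice d => Real.exp (t * x i)) θ := by
    refine hbound.mono' Measurable.of_discrete.aestronglyMeasurable (ae_of_all _ fun x => ?_)
    rw [Real.norm_eq_abs, abs_of_pos (Real.exp_pos _)]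
    exact hpt x
  rw [← ofReal_integral_eq_lintegral_ofReal hexp (ae_of_all _ fun x => (Real.exp_pos _).le)]
  refine ENNReal.ofReal_le_ofReal ?_
  calc ∫ x, Real.exp (t * x i) ∂θ
      ≤ ∫ x, (1 + t * x i + t ^ 2 * (8 / c ^ 2) * Real.exp (c * euclNorm x)) ∂θ :=
        integral_mono hexp hbound hpt
    _ = 1 + t ^ 2 * (8 / c ^ 2) * E := by
        rw [integral_add (f := fun x : Lattice d => 1 + t * (x i : ℝ))
            ((integrable_const 1).add (hlin.const_mul t)) (hint.const_mul _),
          integral_add (integrable_const 1) (hlin.const_mul t), integral_const_mul,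
          integral_const_mul, hzero]
        simp [hE]
    _ ≤ (8 / c ^ 2 * E + 1) * t ^ 2 + 1 := by nlinarith [sq_nonneg t]
    _ ≤ _ := Real.add_one_le_exp _

/-- Exponential Chebyshev inequality in both directions of every coordinate. The parameter t stays
free, to be fitted to the scale later. -/
theorem exists_convPow_tail_le (hsymm : θ.map (fun x => -x) = θ)
    (hexp : ∃ c : ℝ, 0 < c ∧ Integrable (fun x => Real.exp (c * euclNorm x)) θ) :
    ∃ C t₀ : ℝ, 0 < C ∧ 0 < t₀ ∧ ∀ (m : ℕ) (t R : ℝ), 0 < t → t ≤ t₀ →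
      convPow θ m {z | ∃ i, R ≤ |(z i : ℝ)|} ≤
        ENNReal.ofReal (2 * d * Real.exp (C * t ^ 2 * m - t * R)) := by
  obtain ⟨c, hc, hint⟩ := hexp
  choose C hC hmgf using exists_mgf_le θ hsymm hc hint
  have hCsum : ∀ i, C i ≤ ∑ j, C j := fun i =>
    Finset.single_le_sum (f := C) (fun j _ => (hC j).le) (Finset.mem_univ i)
  refine ⟨∑ i, C i + 1, c / 2, ?_, by positivity, fun m t R ht htc => ?_⟩
  · have : 0 ≤ ∑ i, C i := Finset.sum_nonneg fun i _ => (hC i).le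
    linarith
  set D := ∑ i, C i + 1 with hD
  have hone : ∀ (i : Fin d) (s : ℝ), |s| = t →
      convPow θ m {z | t * R ≤ s * z i} ≤ ENNReal.ofReal (Real.exp (D * t ^ 2 * m - t * R)) := by
    intro i s hs
    have h1 : ENNReal.ofReal (Real.exp (t * R)) * convPow θ m {z | t * R ≤ s * z i} ≤
        ENNReal.ofReal (Real.exp (D * t ^ 2 * m)) := by
      calc ENNReal.ofReal (Real.exp (t * R)) * convPow θ m {z | t * R ≤ s * z i}
          ≤ ENNReal.ofReal (Real.exp (t * R)) * convPow θ m {z | ENNReal.ofReal (Real.exp (t * R)) ≤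
              ENNReal.ofReal (Real.exp (s * z i))} := by
            gcongr with z
            intro h
            exact ENNReal.ofReal_le_ofReal (Real.exp_le_exp.2 h)
        _ ≤ ∫⁻ z, ENNReal.ofReal (Real.exp (s * z i)) ∂(convPow θ m) :=
            mul_meas_ge_le_lintegral Measurable.of_discrete _
        _ ≤ ENNReal.ofReal (Real.exp (C i * s ^ 2)) ^ m := by
            rw [lintegral_exp_convPow]
            gcongr
            exact hmgf i s (by rw [hs]; exact htc)
        _ ≤ ENNReal.ofReal (Real.exp (D * t ^ 2 * m)) := by
            rw [← ENNReal.ofReal_pow (Real.exp_pos _).le, ← Real.exp_nat_mul]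
            refine ENNReal.ofReal_le_ofReal (Real.exp_le_exp.2 ?_)
            rw [← sq_abs s, hs]
            have : C i ≤ D := by rw [hD]; linarith [hCsum i]
            calc (m : ℝ) * (C i * t ^ 2) = C i * t ^ 2 * m := by ring
              _ ≤ D * t ^ 2 * m := by gcongr
    rw [mul_comm, ← ENNReal.le_div_iff_mul_le (Or.inl (by simp [Real.exp_pos]))
      (Or.inl ENNReal.ofReal_ne_top)] at h1
    refine h1.trans (le_of_eq ?_)
    rw [← ENNReal.ofReal_div_of_pos (Real.exp_pos _), ← Real.exp_sub]
  have hsub : {z : Lattice d | ∃ i, R ≤ |(z i : ℝ)|} ⊆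
      ⋃ i, ({z | t * R ≤ t * z i} ∪ {z | t * R ≤ (-t) * z i}) := by
    rintro z ⟨i, hi⟩
    refine Set.mem_iUnion.2 ⟨i, ?_⟩
    rcases le_abs.1 hi with h | h
    · exact Or.inl (show t * R ≤ t * z i by gcongr)
    · refine Or.inr (show t * R ≤ (-t) * z i from ?_)
      nlinarith
  refine (measure_mono hsub).trans ((measure_iUnion_le _).trans ?_)
  rw [tsum_fintype]
  refine (Finset.sum_le_sum (g := fun _ => ENNReal.ofReal (2 * Real.exp (D * t ^ 2 * m - t * R)))
    fun i _ => ?_).trans (le_of_eq ?_)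
  · refine (measure_union_le _ _).trans ((add_le_add (hone i t (abs_of_pos ht))
      (hone i (-t) (by rw [abs_neg, abs_of_pos ht]))).trans (le_of_eq ?_))
    rw [← ENNReal.ofReal_add (Real.exp_pos _).le (Real.exp_pos _).le, two_mul]
  · rw [Finset.sum_const, Finset.card_univ, Fintype.card_fin, nsmul_eq_mul,
      ← ENNReal.ofReal_natCast, ← ENNReal.ofReal_mul (by positivity)]
    congr 1; ring

/-- The vertices of the truncated forest are unlikely to be far away from the origin. -/
theorem exists_brwLaw_displacement_le (μ : Measure ℕ) [IsProbabilityMeasure μ]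
    (hmean : ∫⁻ n, (n : ℝ≥0∞) ∂μ = 1) (hsymm : θ.map (fun x => -x) = θ)
    (hexp : ∃ c : ℝ, 0 < c ∧ Integrable (fun x => Real.exp (c * euclNorm x)) θ) :
    ∃ C t₀ : ℝ, 0 < C ∧ 0 < t₀ ∧ ∀ (K H M : ℕ) (t R : ℝ), 0 < t → t ≤ t₀ → K ≤ M → H + 1 ≤ M →
      brwLaw μ θ {ω | ∃ u, InTrunc ω.1 K H u ∧ ∃ i, R ≤ |(position ω.2 u i : ℝ)|} ≤
        ENNReal.ofReal (2 * d * M ^ 2 * Real.exp (C * t ^ 2 * (2 * M) - t * R)) := by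
  obtain ⟨C, t₀, hC, ht₀, htail⟩ := exists_convPow_tail_le θ hsymm hexp
  refine ⟨C, t₀, hC, ht₀, fun K H M t R ht htt hK hH => ?_⟩
  have hsub : {ω : (Vertex → ℕ) × (Vertex → Lattice d) |
      ∃ u, InTrunc ω.1 K H u ∧ ∃ i, R ≤ |(position ω.2 u i : ℝ)|} ⊆
      ⋃ u, {N | InTrunc N K H u} ×ˢ {X | ∃ i, R ≤ |(position X u i : ℝ)|} := by
    rintro ω ⟨u, h1, h2⟩
    exact Set.mem_iUnion.2 ⟨u, h1, h2⟩
  refine (measure_mono hsub).trans ((measure_iUnion_le _).trans ?_)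
  -- Forest and displacements are independent, so each term of the union bound factorises. The mean
  -- number of vertices is K(H + 1) ≤ M^2, and all of them have depth at most 2M.
  simp_rw [brwLaw, Measure.prod_prod]
  refine (tsum_incl_le μ hmean K H
    (ENNReal.ofReal (2 * d * Real.exp (C * t ^ 2 * (2 * M) - t * R))) _ ?_).trans ?_
  · rintro ⟨k, x⟩ hk hx
    have h1 : dispLaw θ {X | ∃ i, R ≤ |(position X (k, x) i : ℝ)|} =
        convPow θ (k + x.length) {z | ∃ i, R ≤ |(z i : ℝ)|} := by
      rw [← map_position θ k x, Measure.map_apply (by fun_prop) MeasurableSet.of_discrete]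
      rfl
    refine (le_of_eq h1).trans ((htail (k + x.length) t R ht htt).trans
      (ENNReal.ofReal_le_ofReal ?_))
    have : ((k + x.length : ℕ) : ℝ) ≤ 2 * M := by
      simp only at hk hx
      have : k + x.length ≤ 2 * M := by omega
      exact_mod_cast this
    gcongr
  · have hKM : (K : ℝ≥0∞) ≤ M := by exact_mod_cast hK
    have hHM : (H : ℝ≥0∞) + 1 ≤ M := by exact_mod_cast hH
    calc (K : ℝ≥0∞) * (H + 1) * ENNReal.ofReal (2 * d * Real.exp (C * t ^ 2 * (2 * M) - t * R))
        ≤ M * M * ENNReal.ofReal (2 * d * Real.exp (C * t ^ 2 * (2 * M) - t * R)) := by gcongr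
      _ = _ := by
        rw [← ENNReal.ofReal_natCast, ← ENNReal.ofReal_mul (by positivity),
          ← ENNReal.ofReal_mul (by positivity)]
        congr 1; ring

end Displacement

/-! ### Survival probability of a critical tree. -/

section Survival

/-- The vertex `(k, w)` has descendants `h` generations further. -/
def Reach (N : Vertex → ℕ) (k : ℕ) (w : List ℕ) (h : ℕ) : Prop :=
  ∃ x : List ℕ, x.length = h ∧ Sat N (conds k w x)

theorem conds_concat (k : ℕ) (w x : List ℕ) (j : ℕ) :
    conds k w (x ++ [j]) = conds k (j :: w) x ++ [((k, w), j)] := by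
  induction x with
  | nil => simp [conds]
  | cons i x ih => simp [conds, ih]

theorem reach_succ (N : Vertex → ℕ) (k : ℕ) (w : List ℕ) (h : ℕ) :
    Reach N k w (h + 1) ↔ ∃ j, j < N (k, w) ∧ Reach N k (j :: w) h := by
  constructor
  · rintro ⟨x, hx, hs⟩
    rcases List.eq_nil_or_concat x with rfl | ⟨y, j, rfl⟩
    · simp at hx
    · rw [List.concat_eq_append, conds_concat, sat_append] at hs
      refine ⟨j, hs.2 ((k, w), j) (by simp), y, by simpa using hx, hs.1⟩
  · rintro ⟨j, hj, y, hy, hs⟩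
    refine ⟨y ++ [j], by simp [hy], ?_⟩
    rw [conds_concat, sat_append]
    exact ⟨hs, by simpa [Sat] using hj⟩

theorem reach_of_inForest {N : Vertex → ℕ} {k h : ℕ} {x : List ℕ} (hx : InForest N (k, x))
    (hh : h ≤ x.length) : Reach N k [] h := by
  obtain ⟨a, b, rfl, hb⟩ : ∃ a b, x = a ++ b ∧ b.length = h :=
    ⟨x.take (x.length - h), x.drop (x.length - h), (List.take_append_drop _ _).symm,
      by rw [List.length_drop]; omega⟩
  refine ⟨b, hb, ?_⟩
  rw [← inForest_iff_sat]
  exact ((inForest_append N k b a).1 hx).2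

/-- The σ-algebra generated by the numbers of children of the vertices in `S`. -/
abbrev childSigma (S : Set Vertex) : MeasurableSpace (Vertex → ℕ) :=
  ⨆ f ∈ S, MeasurableSpace.comap (fun N => N f) ⊤

theorem measurableSet_childSigma_lt {S : Set Vertex} {f : Vertex} (hf : f ∈ S) (j : ℕ) :
    MeasurableSet[childSigma S] {N : Vertex → ℕ | j < N f} := by
  have hle : MeasurableSpace.comap (fun N : Vertex → ℕ => N f) ⊤ ≤ childSigma S :=
    le_iSup₂ (f := fun f (_ : f ∈ S) => MeasurableSpace.comap (fun N : Vertex → ℕ => N f) ⊤) f hf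
  exact hle _ ⟨{n | j < n}, trivial, rfl⟩

theorem measurableSet_childSigma_reach {S : Set Vertex} {k : ℕ} {w : List ℕ}
    (hS : ∀ t, (k, t ++ w) ∈ S) (h : ℕ) :
    MeasurableSet[childSigma S] {N : Vertex → ℕ | Reach N k w h} := by
  have : {N : Vertex → ℕ | Reach N k w h} =
      ⋃ x ∈ {x : List ℕ | x.length = h}, ⋂ p ∈ {p | p ∈ conds k w x}, {N | p.2 < N p.1} := by
    ext N; simp [Reach, Sat]
  rw [this]
  refine MeasurableSet.biUnion (Set.to_countable _) fun x _ =>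
    MeasurableSet.biInter (Set.to_countable _) fun p hp => measurableSet_childSigma_lt ?_ _
  obtain ⟨t, -, -, h3⟩ := exists_of_mem_conds hp
  rw [h3]; exact hS t

variable (μ : Measure ℕ) [IsProbabilityMeasure μ]

theorem childLaw_inter {S T : Set Vertex} (hST : Disjoint S T) {A B : Set (Vertex → ℕ)}
    (hA : MeasurableSet[childSigma S] A) (hB : MeasurableSet[childSigma T] B) :
    childLaw μ (A ∩ B) = childLaw μ A * childLaw μ B := by
  have hind : ProbabilityTheory.iIndepFun (fun (f : Vertex) (N : Vertex → ℕ) => N f)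
      (childLaw μ) :=
    ProbabilityTheory.iIndepFun_infinitePi (X := fun _ (n : ℕ) => n) (fun _ => measurable_id)
  have := ProbabilityTheory.indep_iSup_of_disjoint
    (m := fun f : Vertex => MeasurableSpace.comap (fun N : Vertex → ℕ => N f) ⊤)
    (fun f => (measurable_pi_apply f).comap_le) hind hST
  exact (ProbabilityTheory.Indep_iff _ _ _).1 this A B hA hB

theorem measurableSet_reach (k : ℕ) (w : List ℕ) (h : ℕ) :
    MeasurableSet {N : Vertex → ℕ | Reach N k w h} := by
  have hle : childSigma Set.univ ≤ (MeasurableSpace.pi : MeasurableSpace (Vertex → ℕ)) :=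
    iSup₂_le fun f _ => (measurable_pi_apply f).comap_le
  exact hle _ (measurableSet_childSigma_reach (fun _ => Set.mem_univ _) h)

/-- The probability that a tree reaches height `h`. -/
def survival (h : ℕ) : ℝ≥0∞ := childLaw μ {N | Reach N 0 [] h}

/-- The potential subtree at (k, w) is a copy of the tree at the origin: relabelling along an
injection of vertices preserves the product law. -/
theorem childLaw_reach (k : ℕ) (w : List ℕ) (h : ℕ) :
    childLaw μ {N | Reach N k w h} = survival μ h := by
  let σ : Vertex → Vertex := fun f => (k + f.1, f.2 ++ w)
  have hσ : Function.Injective σ := by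
    rintro ⟨a, x⟩ ⟨b, y⟩ hab
    simp only [σ, Prod.mk.injEq, Nat.add_left_cancel_iff, List.append_cancel_right_eq] at hab
    exact Prod.ext hab.1 hab.2
  have hmap := Measure.map_infinitePi_infinitePi_of_inj (P := fun _ : Vertex => μ) hσ
  have hconds : ∀ (N : Vertex → ℕ) (x : List ℕ),
      Sat N (conds k w x) ↔ Sat (fun f => N (σ f)) (conds 0 [] x) := by
    intro N x
    induction x with
    | nil => simp [conds, Sat]
    | cons j x ih =>
      simp only [Sat, conds, List.forall_mem_cons] at ih ⊢
      rw [ih]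
      simp [σ]
  rw [survival]
  conv_rhs => rw [childLaw, ← hmap]
  rw [Measure.map_apply (by fun_prop) (measurableSet_reach 0 [] h)]
  simp only [Reach, hconds]
  rfl

theorem childLaw_lt_root (j : ℕ) : childLaw μ {N | j < N (0, [])} = tail μ j := by
  have h1 := Measure.infinitePi_map_eval (fun _ : Vertex => μ) (0, [])
  have h2 := congrArg (fun ν : Measure ℕ => ν {n | j < n}) h1
  exact (Measure.map_apply (measurable_pi_apply _) MeasurableSet.of_discrete).symm.trans h2

theorem measurableSet_childSigma_reach_child (j h : ℕ) :
    MeasurableSet[childSigma {f : Vertex | [j] <:+ f.2}] {N : Vertex → ℕ | Reach N 0 [j] h} :=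
  measurableSet_childSigma_reach (fun t => List.suffix_append t [j]) h

theorem measurableSet_childSigma_root (j : ℕ) :
    MeasurableSet[childSigma {((0, []) : Vertex)}] {N : Vertex → ℕ | j < N (0, [])} :=
  measurableSet_childSigma_lt (Set.mem_singleton _) j

theorem childLaw_child_reach (j h : ℕ) :
    childLaw μ ({N | j < N (0, [])} ∩ {N | Reach N 0 [j] h}) = tail μ j * survival μ h := by
  have hroot : Disjoint {((0, []) : Vertex)} {f : Vertex | [j] <:+ f.2} := by
    rw [Set.disjoint_singleton_left]
    simp
  rw [childLaw_inter μ hroot (measurableSet_childSigma_root j)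
    (measurableSet_childSigma_reach_child j h), childLaw_lt_root, childLaw_reach]

theorem childLaw_two_children_reach (h : ℕ) :
    childLaw μ ({N | 1 < N (0, [])} ∩ ({N | Reach N 0 [0] h} ∩ {N | Reach N 0 [1] h})) =
      tail μ 1 * survival μ h ^ 2 := by
  have hmono : ∀ {S T : Set Vertex}, S ⊆ T → childSigma S ≤ childSigma T := fun hST =>
    biSup_mono hST
  have hdisj : Disjoint {f : Vertex | [0] <:+ f.2} {f : Vertex | [1] <:+ f.2} := by
    refine Set.disjoint_left.2 fun f h0 h1 => ?_
    have := List.suffix_of_suffix_length_le h0 h1 (by simp)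
    have := this.eq_of_length (by simp)
    simp at this
  have hroot : Disjoint {((0, []) : Vertex)}
      ({f : Vertex | [0] <:+ f.2} ∪ {f : Vertex | [1] <:+ f.2}) := by
    rw [Set.disjoint_singleton_left]
    simp
  have hmeas : MeasurableSet[childSigma ({f : Vertex | [0] <:+ f.2} ∪ {f : Vertex | [1] <:+ f.2})]
      ({N : Vertex → ℕ | Reach N 0 [0] h} ∩ {N | Reach N 0 [1] h}) :=
    MeasurableSet.inter
      (hmono Set.subset_union_left _ (measurableSet_childSigma_reach_child 0 h))
      (hmono Set.subset_union_right _ (measurableSet_childSigma_reach_child 1 h))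
  rw [childLaw_inter μ hroot (measurableSet_childSigma_root 1) hmeas, childLaw_lt_root,
    childLaw_inter μ hdisj (measurableSet_childSigma_reach_child 0 h)
      (measurableSet_childSigma_reach_child 1 h), childLaw_reach, childLaw_reach, sq]

/-- Consider the number of children of the root with descendants h generations further. Its mean is
the survival probability to h, as the mean offspring is 1. It is at least 1 if the tree reaches
height h + 1, and at least 2 if the first two children exist and both have such descendants, an
event with the probability of the quadratic term. -/
theorem survival_succ_add_le (hmean : ∫⁻ n, (n : ℝ≥0∞) ∂μ = 1) (h : ℕ) :
    survival μ (h + 1) + tail μ 1 * survival μ h ^ 2 ≤ survival μ h := by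
  classical
  have hlt : ∀ j, MeasurableSet {N : Vertex → ℕ | j < N (0, [])} := fun j =>
    measurableSet_lt measurable_const (measurable_pi_apply _)
  set E : ℕ → Set (Vertex → ℕ) := fun j => {N | Reach N 0 [j] h}
  have hEm : ∀ j, MeasurableSet (E j) := fun j => measurableSet_reach 0 [j] h
  have hone : ∀ j, childLaw μ ({N | j < N (0, [])} ∩ E j) = tail μ j * survival μ h :=
    fun j => childLaw_child_reach μ j h
  have htwo : childLaw μ ({N | 1 < N (0, [])} ∩ (E 0 ∩ E 1)) = tail μ 1 * survival μ h ^ 2 :=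
    childLaw_two_children_reach μ h
  have hsucc : survival μ (h + 1) = childLaw μ {N | Reach N 0 [] (h + 1)} := rfl
  have hE : ∀ {N j}, Reach N 0 [j] h → N ∈ E j := fun hr => hr
  clear_value E
  calc survival μ (h + 1) + tail μ 1 * survival μ h ^ 2
      = ∫⁻ N, ({N | Reach N 0 [] (h + 1)}.indicator 1 N +
          ({N | 1 < N (0, [])} ∩ (E 0 ∩ E 1)).indicator 1 N) ∂(childLaw μ) := by
        rw [lintegral_add_left (measurable_one.indicator (measurableSet_reach 0 [] (h + 1))),
          lintegral_indicator_one (measurableSet_reach 0 [] (h + 1)),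
          lintegral_indicator_one ((hlt 1).inter ((hEm 0).inter (hEm 1))), htwo, hsucc]
    _ ≤ ∫⁻ N, ∑' j, ({N | j < N (0, [])} ∩ E j).indicator 1 N ∂(childLaw μ) := by
        refine lintegral_mono fun N => ?_
        by_cases h2 : N ∈ {N : Vertex → ℕ | 1 < N (0, [])} ∩ (E 0 ∩ E 1)
        · have hm0 : N ∈ {N : Vertex → ℕ | 0 < N (0, [])} ∩ E 0 :=
            ⟨Set.mem_ofPred.2 (lt_trans zero_lt_one (Set.mem_ofPred.1 h2.1)), h2.2.1⟩
          have hm1 : N ∈ {N : Vertex → ℕ | 1 < N (0, [])} ∩ E 1 := ⟨h2.1, h2.2.2⟩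
          have hsum := ENNReal.sum_le_tsum (f := fun j =>
            ({N : Vertex → ℕ | j < N (0, [])} ∩ E j).indicator (1 : (Vertex → ℕ) → ℝ≥0∞) N)
            (Finset.range 2)
          rw [Finset.sum_range_succ, Finset.sum_range_one, Set.indicator_of_mem hm0,
            Set.indicator_of_mem hm1] at hsum
          refine le_trans (add_le_add ?_ ?_) hsum
          · exact Set.indicator_apply_le' (fun _ => le_rfl) (fun _ => zero_le)
          · exact Set.indicator_apply_le' (fun _ => le_rfl) (fun _ => zero_le)
        · rw [Set.indicator_of_notMem h2, add_zero]
          refine Set.indicator_apply_le' (fun hr => ?_) (fun _ => zero_le)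
          obtain ⟨j, hj, hrj⟩ := (reach_succ N 0 [] h).1 hr
          have hmj : N ∈ {N : Vertex → ℕ | j < N (0, [])} ∩ E j := ⟨hj, hE hrj⟩
          refine le_trans ?_ (ENNReal.le_tsum j)
          rw [Set.indicator_of_mem hmj]
    _ = ∑' j, tail μ j * survival μ h := by
        rw [lintegral_tsum fun j => (measurable_one.indicator
          ((hlt j).inter (hEm j))).aemeasurable]
        refine tsum_congr fun j => ?_
        rw [lintegral_indicator_one ((hlt j).inter (hEm j)), hone]
    _ = survival μ h := by rw [ENNReal.tsum_mul_right, tsum_tail, hmean, one_mul]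

/-- Kolmogorov's estimate for the survival probability. -/
theorem survival_le (hmean : ∫⁻ n, (n : ℝ≥0∞) ∂μ = 1) (h : ℕ) :
    survival μ h ≤ ENNReal.ofReal (1 / (1 + (tail μ 1).toReal * h)) := by
  set c := (tail μ 1).toReal with hc
  have hc0 : 0 ≤ c := ENNReal.toReal_nonneg
  have hc1 : c ≤ 1 := by
    have : tail μ 1 ≤ 1 := prob_le_one
    simpa [hc] using ENNReal.toReal_mono (by simp) this
  have hfin : ∀ h, survival μ h ≠ ∞ := fun h => measure_ne_top _ _
  have htfin : tail μ 1 ≠ ∞ := measure_ne_top _ _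
  have key : ∀ h : ℕ, (survival μ h).toReal * (1 + c * h) ≤ 1 := by
    intro h
    induction h with
    | zero =>
      have : survival μ 0 ≤ 1 := prob_le_one
      simpa using ENNReal.toReal_mono (by simp) this
    | succ h ih =>
      have h1 := ENNReal.toReal_mono (hfin h) (survival_succ_add_le μ hmean h)
      rw [ENNReal.toReal_add (hfin _)
        (ENNReal.mul_ne_top htfin (ENNReal.pow_ne_top (hfin h))), ENNReal.toReal_mul,
        ENNReal.toReal_pow, ← hc] at h1
      set q := (survival μ h).toReal
      set q' := (survival μ (h + 1)).toReal
      have hq0 : 0 ≤ q := ENNReal.toReal_nonneg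
      have hq1 : q ≤ 1 := by
        have : survival μ h ≤ 1 := prob_le_one
        simpa [q] using ENNReal.toReal_mono (by simp) this
      push_cast
      have hh : (0 : ℝ) ≤ h := by positivity
      -- With y = q(1 + ch) ≤ 1 the new value is at most y + cq(1 - y), a convex combination of y
      -- and 1.
      calc q' * (1 + c * (h + 1)) ≤ (q - c * q ^ 2) * (1 + c * (h + 1)) := by
            gcongr; linarith
        _ = q * (1 + c * h) + (c * q) * (1 - q * (1 + c * h)) - (c * q) ^ 2 := by ring
        _ ≤ q * (1 + c * h) + 1 * (1 - q * (1 + c * h)) := by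
            have : c * q ≤ 1 := by nlinarith
            have h3 := mul_le_mul_of_nonneg_right this (sub_nonneg.2 ih)
            nlinarith [sq_nonneg (c * q)]
        _ = 1 := by ring
  rw [← ENNReal.ofReal_toReal (hfin h)]
  refine ENNReal.ofReal_le_ofReal ?_
  rw [le_div_iff₀ (by positivity)]
  exact key h

theorem childLaw_exists_reach_le (hmean : ∫⁻ n, (n : ℝ≥0∞) ∂μ = 1) (K h : ℕ) :
    childLaw μ {N | ∃ k < K, Reach N k [] h} ≤
      ENNReal.ofReal (K / (1 + (tail μ 1).toReal * h)) := by
  have hsub : {N : Vertex → ℕ | ∃ k < K, Reach N k [] h} ⊆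
      ⋃ k ∈ Finset.range K, {N | Reach N k [] h} := by
    rintro N ⟨k, hk, hr⟩
    simp only [Set.mem_iUnion, Finset.mem_range]
    exact ⟨k, hk, hr⟩
  refine (measure_mono hsub).trans ((measure_biUnion_finset_le _ _).trans ?_)
  simp_rw [childLaw_reach]
  rw [Finset.sum_const, Finset.card_range, nsmul_eq_mul, div_eq_mul_one_div,
    ENNReal.ofReal_mul (by positivity), ENNReal.ofReal_natCast]
  gcongr
  exact survival_le μ hmean h

/-- A variable with values in {0, 1} and mean 1 is constant, so a nondegenerate critical law charges
{2, 3, ...}. -/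
theorem tail_one_pos (hmean : ∫⁻ n, (n : ℝ≥0∞) ∂μ = 1) (hne : μ ≠ Measure.dirac 1) :
    0 < (tail μ 1).toReal := by
  refine ENNReal.toReal_pos (fun h0 => hne ?_) (measure_ne_top _ _)
  have hle : ∀ᵐ n ∂μ, n ≤ 1 := by
    rw [ae_iff]
    simpa [tail] using h0
  have h1 : μ {1} = 1 := by
    rw [← hmean, ← lintegral_indicator_one (measurableSet_singleton 1)]
    refine lintegral_congr_ae ?_
    filter_upwards [hle] with n hn
    interval_cases n <;> simp
  have h2 : μ {1}ᶜ = 0 := by rwa [prob_compl_eq_zero_iff (measurableSet_singleton 1)]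
  refine Measure.ext_of_singleton fun n => ?_
  by_cases hn : n = 1
  · subst hn; simp [h1]
  · have h3 : μ {n} = 0 := measure_mono_null (by simpa [eq_comm] using hn) h2
    rw [h3]
    simp [Ne.symm hn]

end Survival

/-! ### The exploration stays in the truncated forest. -/

section Exploration

theorem Precedes.trans {u v w : Vertex} (h1 : Precedes u v) (h2 : Precedes v w) :
    Precedes u w := by
  rcases h1 with h1 | ⟨h1, h1'⟩ <;> rcases h2 with h2 | ⟨h2, h2'⟩
  · exact Or.inl (h1.trans h2)
  · exact Or.inl (h2 ▸ h1)
  · exact Or.inl (h1 ▸ h2)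
  · exact Or.inr ⟨h1.trans h2, h1'.trans h2'⟩

theorem not_precedes_self (u : Vertex) : ¬ Precedes u u := by
  rintro (h | ⟨-, h⟩)
  · exact lt_irrefl _ h
  · exact lt_irrefl _ h

theorem dfs_precedes (N : Vertex → ℕ) {i j : ℕ} (hij : i < j) : Precedes (dfs N i) (dfs N j) := by
  induction j with
  | zero => omega
  | succ j ih =>
    rcases Nat.lt_succ_iff_lt_or_eq.1 hij with h | rfl
    · exact (ih h).trans (dfs_spec N j).2.1
    · exact (dfs_spec N i).2.1

theorem dfs_injective (N : Vertex → ℕ) : Function.Injective (dfs N) := by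
  intro i j hij
  rcases lt_trichotomy i j with h | h | h
  · exact absurd (hij ▸ dfs_precedes N h) (not_precedes_self _)
  · exact h
  · exact absurd (hij ▸ dfs_precedes N h) (not_precedes_self _)

/-- The exploration skips nothing, each vertex being followed by the least later one. -/
theorem exists_dfs_eq_or_precedes (N : Vertex → ℕ) {v : Vertex} (hv : InForest N v) (n : ℕ) :
    (∃ i ≤ n, dfs N i = v) ∨ Precedes (dfs N n) v := by
  induction n with
  | zero =>
    obtain ⟨k, x⟩ := v
    by_cases h : (k, x) = ((0, []) : Vertex)
    · exact Or.inl ⟨0, le_rfl, h.symm⟩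
    · right
      simp only [dfs, Precedes]
      rcases Nat.eq_zero_or_pos k with rfl | hk
      · right
        refine ⟨rfl, ?_⟩
        have hx : x.reverse ≠ [] := by
          rw [Ne, List.reverse_eq_nil_iff]; rintro rfl; exact h rfl
        rcases hr : x.reverse with _ | ⟨a, t⟩
        · exact absurd hr hx
        · simp
      · exact Or.inl hk
  | succ n ih =>
    rcases ih with ⟨i, hi, h⟩ | h
    · exact Or.inl ⟨i, by omega, h⟩
    · rcases (dfs_spec N n).2.2 v hv h with h | h
      · exact Or.inl ⟨n + 1, le_rfl, h.symm⟩
      · exact Or.inr h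

/-- If the first `K` trees have many vertices, then the exploration stays in them for long. -/
theorem dfs_fst_lt (N : Vertex → ℕ) {K H n : ℕ} (hcount : (n : ℝ≥0∞) < truncCount K H N) {i : ℕ}
    (hi : i ≤ n) : (dfs N i).1 < K := by
  classical
  have hn : (dfs N n).1 < K := by
    by_contra hcon
    rw [not_lt] at hcon
    -- If the n-th vertex were beyond the first `K` trees, all vertices of these trees would come
    -- before it, so there would be at most n of them.
    have hsub : ∀ u, InTrunc N K H u → u ∈ (Finset.range n).image (dfs N) := by
      intro u hu
      have hpre : Precedes u (dfs N n) := Or.inl (hu.1.trans_le hcon)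
      rcases exists_dfs_eq_or_precedes N hu.2.2 n with ⟨i, hi, rfl⟩ | h
      · refine Finset.mem_image.2 ⟨i, Finset.mem_range.2 (lt_of_le_of_ne hi ?_), rfl⟩
        rintro rfl
        exact not_precedes_self _ hpre
      · exact absurd (hpre.trans h) (not_precedes_self _)
    have hle : truncCount K H N ≤ n := by
      rw [truncCount, tsum_eq_sum (s := (Finset.range n).image (dfs N))]
      · calc ∑ u ∈ (Finset.range n).image (dfs N), incl K H u N
            ≤ ∑ u ∈ (Finset.range n).image (dfs N), 1 := by
              refine Finset.sum_le_sum fun u _ => ?_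
              unfold incl
              split_ifs <;> simp
          _ ≤ n := by
              rw [Finset.sum_const, nsmul_one]
              have := Finset.card_image_le (s := Finset.range n) (f := dfs N)
              rw [Finset.card_range] at this
              exact_mod_cast this
      · intro u hu
        exact if_neg fun h => hu (hsub u h)
    exact absurd hcount (not_lt.2 hle)
  rcases hi.lt_or_eq with hi | rfl
  · rcases dfs_precedes N hi with h | ⟨h, -⟩
    · exact h.trans hn
    · exact h ▸ hn
  · exact hn

/-- Two heights occur: the vertices are counted up to `H'`, which is taken smaller than `H` to keep
the variance of the count small, whereas `H` is a height that no tree exceeds. -/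
theorem dfs_inTrunc (N : Vertex → ℕ) {K H H' n : ℕ} (hcount : (n : ℝ≥0∞) < truncCount K H' N)
    (hreach : ¬ ∃ k < K, Reach N k [] (H + 1)) {i : ℕ} (hi : i ≤ n) : InTrunc N K H (dfs N i) := by
  have h1 := dfs_fst_lt N hcount hi
  have h2 := (dfs_spec N i).1
  refine ⟨h1, ?_, h2⟩
  by_contra hcon
  rw [not_le] at hcon
  exact hreach ⟨_, h1, reach_of_inForest (x := (dfs N i).2) h2 hcon⟩

variable {d : ℕ}

theorem sum_green_le_energy (η : Measure (Lattice d)) {K H n : ℕ}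
    (ω : (Vertex → ℕ) × (Vertex → Lattice d)) (h : ∀ i ≤ n, InTrunc ω.1 K H (dfs ω.1 i)) :
    ∑ j ∈ Finset.range (n + 1), ∑ i ∈ Finset.range (n + 1),
      green η (position ω.2 (dfs ω.1 j) - position ω.2 (dfs ω.1 i)) ≤ energy η K H ω := by
  classical
  set I := (Finset.range (n + 1)).image (dfs ω.1) with hI
  have hinj : Set.InjOn (dfs ω.1) (Finset.range (n + 1)) := (dfs_injective ω.1).injOn
  have hincl : ∀ u ∈ I, incl K H u ω.1 = 1 := by
    intro u hu
    obtain ⟨i, hi, rfl⟩ := Finset.mem_image.1 hu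
    exact if_pos (h i (by simpa [Nat.lt_succ_iff] using hi))
  calc ∑ j ∈ Finset.range (n + 1), ∑ i ∈ Finset.range (n + 1),
        green η (position ω.2 (dfs ω.1 j) - position ω.2 (dfs ω.1 i))
      = ∑ u ∈ I, ∑ v ∈ I, green η (position ω.2 u - position ω.2 v) := by
        rw [hI, Finset.sum_image hinj]
        refine Finset.sum_congr rfl fun j _ => ?_
        rw [Finset.sum_image hinj]
    _ = ∑ u ∈ I, ∑ v ∈ I, incl K H u ω.1 * incl K H v ω.1 *
          green η (position ω.2 u - position ω.2 v) := by
        refine Finset.sum_congr rfl fun u hu => Finset.sum_congr rfl fun v hv => ?_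
        rw [hincl u hu, hincl v hv, one_mul, one_mul]
    _ ≤ ∑ u ∈ I, ∑' v, incl K H u ω.1 * incl K H v ω.1 *
          green η (position ω.2 u - position ω.2 v) :=
        Finset.sum_le_sum fun u _ => ENNReal.sum_le_tsum _
    _ ≤ energy η K H ω := ENNReal.sum_le_tsum _

end Exploration

/-! ### Exponents, and passage from powers of two to all integers. -/

section Asymptotics

theorem exists_exponent_of_forall (f : ℕ → ℝ) (s : ℝ)
    (h : ∀ m : ℕ, ∀ᶠ n : ℕ in atTop, (n : ℝ) ^ (s - 1 / ((m : ℝ) + 1)) ≤ f n ∧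
      f n ≤ (n : ℝ) ^ (s + 1 / ((m : ℝ) + 1))) :
    ∃ ε : ℕ → ℝ, Tendsto ε atTop (𝓝 0) ∧ ∀ᶠ n : ℕ in atTop, f n = (n : ℝ) ^ (s + ε n) := by
  have hpos : ∀ᶠ n : ℕ in atTop, 0 < f n := by
    filter_upwards [h 0, eventually_ge_atTop 2] with n hn h2
    have : (0 : ℝ) < n := by exact_mod_cast (by omega : 0 < n)
    exact lt_of_lt_of_le (Real.rpow_pos_of_pos this _) hn.1
  refine ⟨fun n => Real.logb n (f n) - s, ?_, ?_⟩
  · rw [Metric.tendsto_atTop']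
    intro κ hκ
    obtain ⟨m, hm⟩ := exists_nat_one_div_lt hκ
    obtain ⟨n₀, hn₀⟩ := eventually_atTop.1 ((h m).and (hpos.and (eventually_ge_atTop 2)))
    refine ⟨n₀, fun n hn => ?_⟩
    obtain ⟨⟨hl, hu⟩, hp, h2⟩ := hn₀ n hn.le
    have h1 : (1 : ℝ) < n := by exact_mod_cast (by omega : 1 < n)
    have hl' := (Real.le_logb_iff_rpow_le h1 hp).2 hl
    have hu' := (Real.logb_le_iff_le_rpow h1 hp).2 hu
    rw [Real.dist_eq, sub_zero]
    refine lt_of_le_of_lt (abs_le.2 ⟨?_, ?_⟩) hm <;> linarith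
  · filter_upwards [hpos, eventually_ge_atTop 2] with n hp h2
    have h1 : (1 : ℝ) < n := by exact_mod_cast (by omega : 1 < n)
    rw [add_sub_cancel, Real.rpow_logb (by linarith) h1.ne' hp]

/-- Apply y^m / m! ≤ exp y to y = t x^δ, with mδ ≥ a. -/
theorem exists_forall_rpow_mul_exp_le {a δ t : ℝ} (hδ : 0 < δ) (ht : 0 < t) :
    ∃ C, 0 < C ∧ ∀ x : ℝ, 1 ≤ x → x ^ a * Real.exp (-(t * x ^ δ)) ≤ C := by
  obtain ⟨m, hm⟩ := exists_nat_ge (a / δ)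
  refine ⟨m.factorial / t ^ m, by positivity, fun x hx => ?_⟩
  have hx0 : (0 : ℝ) < x := by linarith
  have h1 : x ^ a ≤ (x ^ δ) ^ m := by
    rw [← Real.rpow_mul_natCast hx0.le]
    refine Real.rpow_le_rpow_of_exponent_le hx ?_
    rw [div_le_iff₀ hδ] at hm
    linarith
  have h2 := Real.pow_div_factorial_le_exp (t * x ^ δ) (by positivity) m
  rw [Real.exp_neg, ← div_eq_mul_inv, div_le_div_iff₀ (Real.exp_pos _) (by positivity)]
  rw [div_le_iff₀ (by positivity), mul_pow] at h2
  have h3 : x ^ a * t ^ m ≤ (x ^ δ) ^ m * t ^ m := by gcongr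
  linarith

/-- Bounds along powers of two for a monotone sequence give bounds along all integers. -/
theorem eventually_rpow_le_of_dyadic {f : ℕ → ℝ} (hf : Monotone f) {s κ C : ℝ} (hC : 0 < C)
    (hκ : 0 < κ) (hs0 : 0 ≤ s - κ) (hs1 : s + κ ≤ 1)
    (h : ∀ᶠ k : ℕ in atTop, C⁻¹ * ((2 ^ k : ℕ) : ℝ) ^ (s - κ) ≤ f (2 ^ k) ∧
      f (2 ^ k) ≤ C * ((2 ^ k : ℕ) : ℝ) ^ (s + κ)) :
    ∀ᶠ n : ℕ in atTop, (n : ℝ) ^ (s - 2 * κ) ≤ f n ∧ f n ≤ (n : ℝ) ^ (s + 2 * κ) := by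
  have hlog : Tendsto (fun n : ℕ => Nat.log 2 n) atTop atTop :=
    tendsto_atTop.2 fun b => by
      filter_upwards [eventually_ge_atTop (2 ^ b)] with n hn
      exact Nat.le_log_of_pow_le (by norm_num) hn
  have hbig : Tendsto (fun n : ℕ => (n : ℝ) ^ κ) atTop atTop :=
    (tendsto_rpow_atTop hκ).comp tendsto_natCast_atTop_atTop
  have hsucc : Tendsto (fun n : ℕ => Nat.log 2 n + 1) atTop atTop :=
    (tendsto_add_atTop_nat 1).comp hlog
  -- n is compared with the powers of two on both sides of it. Once n^κ ≥ 2C, a second κ in the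
  -- exponent absorbs the constant and the factor 2.
  filter_upwards [hlog.eventually h, hsucc.eventually h, hbig.eventually_ge_atTop (2 * C),
    eventually_ge_atTop 1] with n h1 h2 h3 hn
  have hn0 : (0 : ℝ) < n := by exact_mod_cast hn
  have hle : 2 ^ Nat.log 2 n ≤ n := Nat.pow_log_le_self 2 (by omega)
  have hlt : n < 2 ^ (Nat.log 2 n + 1) := Nat.lt_pow_succ_log_self (by norm_num) n
  set k := Nat.log 2 n
  have hleR : ((2 ^ (k + 1) : ℕ) : ℝ) ≤ 2 * n := by
    have : 2 ^ (k + 1) ≤ 2 * n := by rw [pow_succ]; omega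
    exact_mod_cast this
  have hgeR : (n : ℝ) / 2 ≤ ((2 ^ k : ℕ) : ℝ) := by
    have : n ≤ 2 * 2 ^ k := by rw [pow_succ] at hlt; omega
    rw [div_le_iff₀ (by norm_num)]
    have : (n : ℝ) ≤ ((2 * 2 ^ k : ℕ) : ℝ) := by exact_mod_cast this
    push_cast at this ⊢
    linarith
  have htwo : ∀ p : ℝ, p ≤ 1 → (2 : ℝ) ^ p ≤ 2 := fun p hp => by
    simpa using Real.rpow_le_rpow_of_exponent_le (by norm_num : (1 : ℝ) ≤ 2) hp
  constructor
  · calc (n : ℝ) ^ (s - 2 * κ) = (n : ℝ) ^ (s - κ) / (n : ℝ) ^ κ := by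
          rw [← Real.rpow_sub hn0]; congr 1; ring
      _ ≤ (n : ℝ) ^ (s - κ) / (2 * C) := by gcongr
      _ = C⁻¹ * ((n : ℝ) ^ (s - κ) / 2) := by field_simp
      _ ≤ C⁻¹ * ((n : ℝ) ^ (s - κ) / 2 ^ (s - κ)) := by
          gcongr; exact htwo _ (by linarith)
      _ = C⁻¹ * ((n : ℝ) / 2) ^ (s - κ) := by rw [Real.div_rpow hn0.le (by norm_num)]
      _ ≤ C⁻¹ * ((2 ^ k : ℕ) : ℝ) ^ (s - κ) := by gcongr
      _ ≤ f (2 ^ k) := h1.1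
      _ ≤ f n := hf hle
  · calc f n ≤ f (2 ^ (k + 1)) := hf hlt.le
      _ ≤ C * ((2 ^ (k + 1) : ℕ) : ℝ) ^ (s + κ) := h2.2
      _ ≤ C * (2 * n) ^ (s + κ) := by gcongr; linarith
      _ = C * (2 ^ (s + κ) * (n : ℝ) ^ (s + κ)) := by
          rw [Real.mul_rpow (by norm_num) hn0.le]
      _ ≤ C * (2 * (n : ℝ) ^ (s + κ)) := by gcongr; exact htwo _ hs1
      _ = 2 * C * (n : ℝ) ^ (s + κ) := by ring
      _ ≤ (n : ℝ) ^ κ * (n : ℝ) ^ (s + κ) := by gcongr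
      _ = (n : ℝ) ^ (s + 2 * κ) := by rw [← Real.rpow_add hn0]; congr 1; ring

end Asymptotics

/-! ### Moment hypotheses in the form used above. -/

section Moments

theorem lintegral_natCast_eq_one {μ : Measure ℕ} [IsProbabilityMeasure μ]
    (hmean : ∫ k, (k : ℝ) ∂μ = 1) (hvar : MemLp (fun k : ℕ => (k : ℝ)) 2 μ) :
    ∫⁻ n, (n : ℝ≥0∞) ∂μ = 1 := by
  have h := ofReal_integral_eq_lintegral_ofReal (hvar.integrable (by norm_num))
    (ae_of_all _ fun n => Nat.cast_nonneg n)
  rw [hmean] at h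
  simpa using h.symm

theorem lintegral_natCast_sq_ne_top {μ : Measure ℕ} [IsProbabilityMeasure μ]
    (hvar : MemLp (fun k : ℕ => (k : ℝ)) 2 μ) : ∫⁻ n, (n : ℝ≥0∞) ^ 2 ∂μ ≠ ∞ := by
  have h := hvar.integrable_sq.lintegral_lt_top.ne
  convert h using 3 with n
  rw [ENNReal.ofReal_pow (by positivity), ENNReal.ofReal_natCast]

theorem memLp_two_coord {d : ℕ} (hd : 1 ≤ d) {η : Measure (Lattice d)} [IsProbabilityMeasure η]
    (hmom : Integrable (fun x => euclNorm x ^ (d + 1)) η) (i : Fin d) :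
    MemLp (fun x : Lattice d => (x i : ℝ)) 2 η := by
  rw [memLp_two_iff_integrable_sq Measurable.of_discrete.aestronglyMeasurable]
  refine Integrable.mono' (hmom.add (integrable_const 1))
    Measurable.of_discrete.aestronglyMeasurable (ae_of_all _ fun x => ?_)
  have h0 : 0 ≤ euclNorm x := Real.sqrt_nonneg _
  have hi := abs_le_euclNorm x i
  rw [Real.norm_of_nonneg (sq_nonneg _), ← sq_abs]
  simp only [Pi.add_apply]
  have h1 : |(x i : ℝ)| ^ 2 ≤ euclNorm x ^ 2 := by gcongr
  rcases le_total (euclNorm x) 1 with h | h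
  · have h2 : euclNorm x ^ 2 ≤ 1 := pow_le_one₀ h0 h
    have h3 : 0 ≤ euclNorm x ^ (d + 1) := by positivity
    linarith
  · have : euclNorm x ^ 2 ≤ euclNorm x ^ (d + 1) := pow_le_pow_right₀ h (by omega)
    linarith

end Moments

/-! ### Choice of scales, bad events, Borel–Cantelli. -/

section GoodEvents

/-- The number of trees that contain the first `n` vertices with high probability. -/
def numTrees (δ : ℝ) (n : ℕ) : ℕ := 2 * ⌈(n : ℝ) ^ (1 / 2 + δ)⌉₊

/-- The height that these trees do not exceed with high probability. -/
def maxHeight (δ : ℝ) (n : ℕ) : ℕ := ⌈(n : ℝ) ^ (1 / 2 + 2 * δ)⌉₊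

theorem ceil_rpow_bounds {n : ℕ} (hn : 1 ≤ n) {a : ℝ} (ha : 0 ≤ a) :
    1 ≤ ⌈(n : ℝ) ^ a⌉₊ ∧ (n : ℝ) ^ a ≤ ⌈(n : ℝ) ^ a⌉₊ ∧ (⌈(n : ℝ) ^ a⌉₊ : ℝ) ≤ 2 * (n : ℝ) ^ a := by
  have hn1 : (1 : ℝ) ≤ n := by exact_mod_cast hn
  have h1 : 1 ≤ (n : ℝ) ^ a := Real.one_le_rpow hn1 ha
  refine ⟨Nat.one_le_ceil_iff.2 (by linarith), Nat.le_ceil _, ?_⟩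
  have := (Nat.ceil_lt_add_one (by linarith : 0 ≤ (n : ℝ) ^ a)).le
  linarith

theorem numTrees_le {δ : ℝ} (hδ : 0 < δ) {n : ℕ} (hn : 1 ≤ n) :
    numTrees δ n ≤ 2 * maxHeight δ n := by
  have hn1 : (1 : ℝ) ≤ n := by exact_mod_cast hn
  refine Nat.mul_le_mul_left 2 (Nat.ceil_mono ?_)
  exact Real.rpow_le_rpow_of_exponent_le hn1 (by linarith)

theorem maxHeight_add_one_le {δ : ℝ} (hδ : 0 < δ) {n : ℕ} (hn : 1 ≤ n) :
    maxHeight δ n + 1 ≤ 2 * maxHeight δ n := by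
  have := (ceil_rpow_bounds hn (a := 1 / 2 + 2 * δ) (by linarith)).1
  unfold maxHeight
  omega

theorem brwLaw_fst {d : ℕ} (μ : Measure ℕ) [IsProbabilityMeasure μ] (θ : Measure (Lattice d))
    [IsProbabilityMeasure θ] (A : Set (Vertex → ℕ)) :
    brwLaw μ θ {ω | ω.1 ∈ A} = childLaw μ A := by
  have h : {ω : (Vertex → ℕ) × (Vertex → Lattice d) | ω.1 ∈ A} = A ×ˢ Set.univ := by
    ext ω; simp
  rw [h, brwLaw, Measure.prod_prod, measure_univ, mul_one]

/-- The ratio of height n^(1/2) to number of trees n^(1/2+δ) is the decay n^(-δ). The factor 2 in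
`numTrees` makes the mean size at least 2n. -/
theorem exists_childLaw_truncCount_le (μ : Measure ℕ) [IsProbabilityMeasure μ]
    (hmean : ∫⁻ n, (n : ℝ≥0∞) ∂μ = 1) (hvar : ∫⁻ n, (n : ℝ≥0∞) ^ 2 ∂μ ≠ ∞) {δ : ℝ} (hδ : 0 < δ) :
    ∃ C : ℝ, 0 < C ∧ ∀ n : ℕ, 1 ≤ n →
      childLaw μ {N | truncCount (numTrees δ n) ⌈(n : ℝ) ^ (1 / 2 : ℝ)⌉₊ N ≤ n} ≤
        ENNReal.ofReal (C * (n : ℝ) ^ (-δ)) := by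
  set m := (∫⁻ n, (n : ℝ≥0∞) ^ 2 ∂μ).toReal
  have hm : 0 ≤ m := ENNReal.toReal_nonneg
  refine ⟨4 * (2 + m) * 3, by positivity, fun n hn => ?_⟩
  have hn1 : (1 : ℝ) ≤ n := by exact_mod_cast hn
  have hn0 : (0 : ℝ) < n := by linarith
  obtain ⟨hK1, hK2, -⟩ := ceil_rpow_bounds hn (a := 1 / 2 + δ) (by linarith)
  obtain ⟨hH1, hH2, hH3⟩ := ceil_rpow_bounds hn (a := 1 / 2) (by norm_num)
  have hx : 1 ≤ (n : ℝ) ^ (1 / 2 : ℝ) := Real.one_le_rpow hn1 (by norm_num)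
  have hmul : (n : ℝ) ≤ (n : ℝ) ^ (1 / 2 + δ) * (n : ℝ) ^ (1 / 2 : ℝ) := by
    rw [← Real.rpow_add hn0]
    calc (n : ℝ) = (n : ℝ) ^ (1 : ℝ) := (Real.rpow_one _).symm
      _ ≤ _ := Real.rpow_le_rpow_of_exponent_le hn1 (by linarith)
  refine (childLaw_truncCount_le μ hmean hvar ?_ ?_).trans (ENNReal.ofReal_le_ofReal ?_)
  · unfold numTrees; omega
  · unfold numTrees
    have : (n : ℝ) ≤ (⌈(n : ℝ) ^ (1 / 2 + δ)⌉₊ : ℝ) * (⌈(n : ℝ) ^ (1 / 2 : ℝ)⌉₊ + 1) :=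
      hmul.trans (by gcongr; linarith)
    have : n ≤ ⌈(n : ℝ) ^ (1 / 2 + δ)⌉₊ * (⌈(n : ℝ) ^ (1 / 2 : ℝ)⌉₊ + 1) := by exact_mod_cast this
    linarith
  · have hKr : (n : ℝ) ^ (1 / 2 + δ) ≤ (numTrees δ n : ℝ) := by
      unfold numTrees
      push_cast
      linarith [Real.rpow_pos_of_pos hn0 (1 / 2 + δ)]
    calc 4 * (2 + m) * ((⌈(n : ℝ) ^ (1 / 2 : ℝ)⌉₊ : ℝ) + 1) / (numTrees δ n)
        ≤ 4 * (2 + m) * (3 * (n : ℝ) ^ (1 / 2 : ℝ)) / (n : ℝ) ^ (1 / 2 + δ) := by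
          gcongr; linarith
      _ = 4 * (2 + m) * 3 * ((n : ℝ) ^ (1 / 2 : ℝ) / (n : ℝ) ^ (1 / 2 + δ)) := by ring
      _ = 4 * (2 + m) * 3 * (n : ℝ) ^ (-δ) := by
          rw [← Real.rpow_sub hn0]; congr 2; ring

theorem exists_childLaw_reach_le (μ : Measure ℕ) [IsProbabilityMeasure μ]
    (hmean : ∫⁻ n, (n : ℝ≥0∞) ∂μ = 1) (hne : μ ≠ Measure.dirac 1) {δ : ℝ} (hδ : 0 < δ) :
    ∃ C : ℝ, 0 < C ∧ ∀ n : ℕ, 1 ≤ n →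
      childLaw μ {N | ∃ k < numTrees δ n, Reach N k [] (maxHeight δ n + 1)} ≤
        ENNReal.ofReal (C * (n : ℝ) ^ (-δ)) := by
  have hc := tail_one_pos μ hmean hne
  set c := (tail μ 1).toReal
  refine ⟨4 / c, by positivity, fun n hn => ?_⟩
  have hn0 : (0 : ℝ) < n := by exact_mod_cast hn
  obtain ⟨-, -, hK⟩ := ceil_rpow_bounds hn (a := 1 / 2 + δ) (by linarith)
  obtain ⟨-, hH, -⟩ := ceil_rpow_bounds hn (a := 1 / 2 + 2 * δ) (by linarith)
  refine (childLaw_exists_reach_le μ hmean _ _).trans (ENNReal.ofReal_le_ofReal ?_)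
  have hp := Real.rpow_pos_of_pos hn0 (1 / 2 + 2 * δ)
  calc (numTrees δ n : ℝ) / (1 + c * ((maxHeight δ n + 1 : ℕ) : ℝ))
      ≤ 4 * (n : ℝ) ^ (1 / 2 + δ) / (c * (n : ℝ) ^ (1 / 2 + 2 * δ)) := by
        unfold numTrees maxHeight
        push_cast
        refine div_le_div₀ (by positivity) (by linarith) (by positivity) ?_
        have := mul_le_mul_of_nonneg_left hH hc.le
        linarith
    _ = 4 / c * ((n : ℝ) ^ (1 / 2 + δ) / (n : ℝ) ^ (1 / 2 + 2 * δ)) := by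
        field_simp
    _ = 4 / c * (n : ℝ) ^ (-δ) := by rw [← Real.rpow_sub hn0]; congr 2; ring

variable {d : ℕ}

theorem exists_brwLaw_energy_le (hd3 : 3 ≤ d) (hd5 : d ≤ 5) (μ : Measure ℕ)
    [IsProbabilityMeasure μ] (θ η : Measure (Lattice d)) [IsProbabilityMeasure θ]
    [IsProbabilityMeasure η] (hmean : ∫⁻ n, (n : ℝ≥0∞) ∂μ = 1)
    (hvar : ∫⁻ n, (n : ℝ≥0∞) ^ 2 ∂μ ≠ ∞) (hsymm : θ.map (fun x => -x) = θ)
    (hθ : IsIrreducible θ) (hη : IsIrreducible η) {δ : ℝ} (hδ : 0 < δ) :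
    ∃ C : ℝ, 0 < C ∧ ∀ n : ℕ, 1 ≤ n →
      brwLaw μ θ {ω | ENNReal.ofReal (C * (n : ℝ) ^ (2 - ((d : ℝ) - 2) / 4 + 9 * δ)) ≤
        energy η (numTrees δ n) (maxHeight δ n) ω} ≤ ENNReal.ofReal ((n : ℝ) ^ (-δ)) := by
  obtain ⟨C, hC, hE⟩ := exists_lintegral_energy_le hd3 hd5 μ θ η hmean hvar hsymm hθ hη
  have hd3' : (3 : ℝ) ≤ d := by exact_mod_cast hd3
  have hd5' : (d : ℝ) ≤ 5 := by exact_mod_cast hd5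
  set p : ℝ := 4 - ((d : ℝ) - 2) / 2 with hp
  have hp0 : 0 ≤ p := by rw [hp]; linarith
  have hp4 : p ≤ 4 := by rw [hp]; linarith
  refine ⟨C * 4 ^ p, by positivity, fun n hn => ?_⟩
  have hn1 : (1 : ℝ) ≤ n := by exact_mod_cast hn
  have hn0 : (0 : ℝ) < n := by linarith
  obtain ⟨-, -, hH⟩ := ceil_rpow_bounds hn (a := 1 / 2 + 2 * δ) (by linarith)
  have hlam : 0 < C * 4 ^ p * (n : ℝ) ^ (2 - ((d : ℝ) - 2) / 4 + 9 * δ) := by positivity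
  refine (meas_ge_le_lintegral_div (measurable_energy η _ _).aemeasurable
    (by simpa using hlam) ENNReal.ofReal_ne_top).trans ?_
  rw [ENNReal.div_le_iff (by simpa using hlam) ENNReal.ofReal_ne_top,
    ← ENNReal.ofReal_mul (by positivity)]
  refine (hE _ _ _ (numTrees_le hδ hn) (maxHeight_add_one_le hδ hn)).trans
    (ENNReal.ofReal_le_ofReal ?_)
  calc C * ((2 * maxHeight δ n : ℕ) : ℝ) ^ p ≤ C * (4 * (n : ℝ) ^ (1 / 2 + 2 * δ)) ^ p := by
        gcongr
        unfold maxHeight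
        push_cast
        linarith
    _ = C * 4 ^ p * (n : ℝ) ^ ((1 / 2 + 2 * δ) * p) := by
        rw [Real.mul_rpow (by norm_num) (by positivity), ← Real.rpow_mul hn0.le]; ring
    -- Of the 9δ, at most 2pδ ≤ 8δ come from the height n^(1/2+2δ), and one δ is spent on Markov's
    -- inequality.
    _ ≤ C * 4 ^ p * (n : ℝ) ^ (-δ + (2 - ((d : ℝ) - 2) / 4 + 9 * δ)) := by
        gcongr
        have : δ * p ≤ δ * 4 := by gcongr
        rw [hp] at this ⊢
        linarith
    _ = _ := by rw [Real.rpow_add hn0]; ring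

theorem exists_brwLaw_displacement_at_scale_le (μ : Measure ℕ) [IsProbabilityMeasure μ]
    (θ : Measure (Lattice d)) [IsProbabilityMeasure θ]
    (hmean : ∫⁻ n, (n : ℝ≥0∞) ∂μ = 1) (hsymm : θ.map (fun x => -x) = θ)
    (hexp : ∃ c : ℝ, 0 < c ∧ Integrable (fun x => Real.exp (c * euclNorm x)) θ)
    {δ : ℝ} (hδ : 0 < δ) :
    ∃ C : ℝ, 0 < C ∧ ∀ n : ℕ, 1 ≤ n →
      brwLaw μ θ {ω | ∃ u, InTrunc ω.1 (numTrees δ n) (maxHeight δ n) u ∧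
        ∃ i, (n : ℝ) ^ (1 / 4 + 2 * δ) ≤ |(position ω.2 u i : ℝ)|} ≤
          ENNReal.ofReal (C * (n : ℝ) ^ (-δ)) := by
  obtain ⟨C, t₀, hC, ht₀, hdisp⟩ := exists_brwLaw_displacement_le θ μ hmean hsymm hexp
  -- The prefactor M^2 is of order n^(1+4δ); one more δ leaves the decay n^(-δ).
  obtain ⟨C', hC', hexp'⟩ := exists_forall_rpow_mul_exp_le (a := 1 + 5 * δ) hδ ht₀
  refine ⟨(2 * d + 1) * 16 * Real.exp (8 * C * t₀ ^ 2) * C', by positivity, fun n hn => ?_⟩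
  have hn1 : (1 : ℝ) ≤ n := by exact_mod_cast hn
  have hn0 : (0 : ℝ) < n := by linarith
  obtain ⟨-, -, hH⟩ := ceil_rpow_bounds hn (a := 1 / 2 + 2 * δ) (by linarith)
  have hM : ((2 * maxHeight δ n : ℕ) : ℝ) ≤ 4 * (n : ℝ) ^ (1 / 2 + 2 * δ) := by
    unfold maxHeight
    push_cast
    linarith
  have hneg : (n : ℝ) ^ (-(1 / 4 + δ)) ≤ 1 := Real.rpow_le_one_of_one_le_of_nonpos hn1 (by linarith)
  -- This t makes t^2 M bounded, while tR is of order n^δ.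
  refine (hdisp _ _ (2 * maxHeight δ n) (t₀ * (n : ℝ) ^ (-(1 / 4 + δ))) _ (by positivity)
    (by nlinarith) (numTrees_le hδ hn) (maxHeight_add_one_le hδ hn)).trans
    (ENNReal.ofReal_le_ofReal ?_)
  have e1 : C * (t₀ * (n : ℝ) ^ (-(1 / 4 + δ))) ^ 2 * (2 * ((2 * maxHeight δ n : ℕ) : ℝ)) ≤
      8 * C * t₀ ^ 2 := by
    calc _ ≤ C * (t₀ * (n : ℝ) ^ (-(1 / 4 + δ))) ^ 2 * (2 * (4 * (n : ℝ) ^ (1 / 2 + 2 * δ))) := by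
          gcongr
      _ = 8 * C * t₀ ^ 2 * ((n : ℝ) ^ (-(1 / 4 + δ)) * (n : ℝ) ^ (-(1 / 4 + δ)) *
            (n : ℝ) ^ (1 / 2 + 2 * δ)) := by ring
      _ = 8 * C * t₀ ^ 2 := by
          rw [← Real.rpow_add hn0, ← Real.rpow_add hn0]
          ring_nf
          simp
  have e2 : t₀ * (n : ℝ) ^ (-(1 / 4 + δ)) * (n : ℝ) ^ (1 / 4 + 2 * δ) = t₀ * (n : ℝ) ^ δ := by
    rw [mul_assoc, ← Real.rpow_add hn0]; congr 2; ring
  rw [e2]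
  calc 2 * (d : ℝ) * ((2 * maxHeight δ n : ℕ) : ℝ) ^ 2 *
        Real.exp (C * (t₀ * (n : ℝ) ^ (-(1 / 4 + δ))) ^ 2 *
          (2 * ((2 * maxHeight δ n : ℕ) : ℝ)) - t₀ * (n : ℝ) ^ δ)
      ≤ (2 * (d : ℝ) + 1) * (4 * (n : ℝ) ^ (1 / 2 + 2 * δ)) ^ 2 *
        Real.exp (8 * C * t₀ ^ 2 + -(t₀ * (n : ℝ) ^ δ)) := by
        gcongr
        · linarith
        · linarith
    _ = (2 * (d : ℝ) + 1) * 16 * Real.exp (8 * C * t₀ ^ 2) *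
        ((n : ℝ) ^ (1 / 2 + 2 * δ) * (n : ℝ) ^ (1 / 2 + 2 * δ) *
          Real.exp (-(t₀ * (n : ℝ) ^ δ))) := by
        rw [Real.exp_add]; ring
    _ = (2 * (d : ℝ) + 1) * 16 * Real.exp (8 * C * t₀ ^ 2) *
        ((n : ℝ) ^ (1 + 5 * δ) * Real.exp (-(t₀ * (n : ℝ) ^ δ))) * (n : ℝ) ^ (-δ) := by
        rw [← Real.rpow_add hn0]
        have : (n : ℝ) ^ (1 / 2 + 2 * δ + (1 / 2 + 2 * δ)) =
            (n : ℝ) ^ (1 + 5 * δ) * (n : ℝ) ^ (-δ) := by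
          rw [← Real.rpow_add hn0]; congr 1; ring
        rw [this]; ring
    _ ≤ _ := by
        gcongr
        exact hexp' n hn1

theorem le_capacity_range (η : Measure (Lattice d)) [IsProbabilityMeasure η]
    (hG : ∀ z, green η z ≠ ∞) (ω : (Vertex → ℕ) × (Vertex → Lattice d)) {K H n : ℕ} {E : ℝ}
    (htrunc : ∀ i ≤ n, InTrunc ω.1 K H (dfs ω.1 i)) (hE : energy η K H ω ≤ ENNReal.ofReal E)
    (hE0 : 0 ≤ E) : (n : ℝ) ^ 2 ≤ 4 * E * capacity η (range ω.1 ω.2 n) := by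
  have h := card_sq_le_mul_ecapacity η hG (Finset.range (n + 1))
    (fun i => position ω.2 (dfs ω.1 i)) (ENNReal.ofReal E)
    ((sum_green_le_energy η ω htrunc).trans hE)
  have h' := ENNReal.toReal_mono
    (ENNReal.mul_ne_top (ENNReal.mul_ne_top (by simp) ENNReal.ofReal_ne_top)
      (ecapacity_ne_top η _)) h
  rw [ENNReal.toReal_mul, ENNReal.toReal_mul, ENNReal.toReal_ofReal hE0, ← capacity_eq_toReal,
    ENNReal.toReal_pow, Finset.card_range, ENNReal.toReal_natCast] at h'
  refine le_trans ?_ h'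
  gcongr
  omega

/-- Outside four bad events (too few vertices, a tree too high, too much energy, a vertex too far)
both bounds hold deterministically. -/
theorem exists_brwLaw_capacity_le (hd3 : 3 ≤ d) (hd5 : d ≤ 5) (μ : Measure ℕ)
    [IsProbabilityMeasure μ] (θ η : Measure (Lattice d)) [IsProbabilityMeasure θ]
    [IsProbabilityMeasure η] (hmean : ∫⁻ n, (n : ℝ≥0∞) ∂μ = 1)
    (hvar : ∫⁻ n, (n : ℝ≥0∞) ^ 2 ∂μ ≠ ∞) (hne : μ ≠ Measure.dirac 1)
    (hη : IsIrreducible η) (hη_mean : ∀ i, ∫ x, (x i : ℝ) ∂η = 0)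
    (hη_L2 : ∀ i, MemLp (fun x : Lattice d => (x i : ℝ)) 2 η)
    (hsymm : θ.map (fun x => -x) = θ) (hθ : IsIrreducible θ)
    (hexp : ∃ c : ℝ, 0 < c ∧ Integrable (fun x => Real.exp (c * euclNorm x)) θ)
    {δ : ℝ} (hδ : 0 < δ) :
    ∃ C : ℝ, 0 < C ∧ ∀ n : ℕ, 1 ≤ n →
      brwLaw μ θ {ω | ¬ (C⁻¹ * (n : ℝ) ^ (((d : ℝ) - 2) / 4 - 9 * δ) ≤
          capacity η (range ω.1 ω.2 n) ∧
        capacity η (range ω.1 ω.2 n) ≤ C * (n : ℝ) ^ (((d : ℝ) - 2) / 4 + 9 * δ))} ≤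
          ENNReal.ofReal (C * (n : ℝ) ^ (-δ)) := by
  have hG : ∀ z, green η z ≠ ∞ := hη.green_ne_top hd3
  obtain ⟨C₁, hC₁, h₁⟩ := exists_childLaw_truncCount_le μ hmean hvar hδ
  obtain ⟨C₂, hC₂, h₂⟩ := exists_childLaw_reach_le μ hmean hne hδ
  obtain ⟨C₃, hC₃, h₃⟩ := exists_brwLaw_energy_le hd3 hd5 μ θ η hmean hvar hsymm hθ hη hδ
  obtain ⟨C₄, hC₄, h₄⟩ := exists_brwLaw_displacement_at_scale_le μ θ hmean hsymm hexp hδ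
  obtain ⟨C₅, hC₅, h₅⟩ := exists_ecapacity_le η (by omega) hG hη_mean hη_L2
  have hd3' : (3 : ℝ) ≤ d := by exact_mod_cast hd3
  have hd5' : (d : ℝ) ≤ 5 := by exact_mod_cast hd5
  set s : ℝ := ((d : ℝ) - 2) / 4 with hs
  -- One constant for three purposes: the probability (the first four summands), the lower bound
  -- (4C₃) and the upper bound (the last).
  set C : ℝ := C₁ + C₂ + 1 + C₄ + 4 * C₃ + C₅ * 2 ^ (d - 2) with hCdef
  have hpow : (0 : ℝ) < C₅ * 2 ^ (d - 2) := by positivity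
  have hC : 0 < C := by positivity
  refine ⟨C, hC, fun n hn => ?_⟩
  have hn1 : (1 : ℝ) ≤ n := by exact_mod_cast hn
  have hn0 : (0 : ℝ) < n := by linarith
  set K := numTrees δ n
  set H := maxHeight δ n
  set H' := ⌈(n : ℝ) ^ (1 / 2 : ℝ)⌉₊
  set E := C₃ * (n : ℝ) ^ (2 - s + 9 * δ) with hE
  set B₁ : Set ((Vertex → ℕ) × (Vertex → Lattice d)) :=
    {ω | ω.1 ∈ {N | truncCount K H' N ≤ n}} with hB₁
  set B₂ : Set ((Vertex → ℕ) × (Vertex → Lattice d)) :=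
    {ω | ω.1 ∈ {N | ∃ k < K, Reach N k [] (H + 1)}} with hB₂
  set B₃ : Set ((Vertex → ℕ) × (Vertex → Lattice d)) :=
    {ω | ENNReal.ofReal E ≤ energy η K H ω} with hB₃
  set B₄ : Set ((Vertex → ℕ) × (Vertex → Lattice d)) :=
    {ω | ∃ u, InTrunc ω.1 K H u ∧
      ∃ i, (n : ℝ) ^ (1 / 4 + 2 * δ) ≤ |(position ω.2 u i : ℝ)|} with hB₄
  have hprob : brwLaw μ θ (B₁ ∪ B₂ ∪ B₃ ∪ B₄) ≤ ENNReal.ofReal (C * (n : ℝ) ^ (-δ)) := by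
    have hp : 0 < (n : ℝ) ^ (-δ) := Real.rpow_pos_of_pos hn0 _
    calc brwLaw μ θ (B₁ ∪ B₂ ∪ B₃ ∪ B₄)
        ≤ brwLaw μ θ B₁ + brwLaw μ θ B₂ + brwLaw μ θ B₃ + brwLaw μ θ B₄ := by
          refine (measure_union_le _ _).trans (add_le_add_left ?_ _)
          refine (measure_union_le _ _).trans (add_le_add_left ?_ _)
          exact measure_union_le _ _
      _ ≤ ENNReal.ofReal (C₁ * (n : ℝ) ^ (-δ)) + ENNReal.ofReal (C₂ * (n : ℝ) ^ (-δ)) +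
          ENNReal.ofReal ((n : ℝ) ^ (-δ)) + ENNReal.ofReal (C₄ * (n : ℝ) ^ (-δ)) := by
          refine add_le_add (add_le_add (add_le_add ?_ ?_) (h₃ n hn)) (h₄ n hn)
          · exact (brwLaw_fst μ θ _).trans_le (h₁ n hn)
          · exact (brwLaw_fst μ θ _).trans_le (h₂ n hn)
      _ = ENNReal.ofReal ((C₁ + C₂ + 1 + C₄) * (n : ℝ) ^ (-δ)) := by
          rw [← ENNReal.ofReal_add (by positivity) (by positivity),
            ← ENNReal.ofReal_add (by positivity) (by positivity),
            ← ENNReal.ofReal_add (by positivity) (by positivity)]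
          congr 1; ring
      _ ≤ ENNReal.ofReal (C * (n : ℝ) ^ (-δ)) := by
          refine ENNReal.ofReal_le_ofReal ?_
          gcongr
          rw [hCdef]
          linarith
  refine (measure_mono fun ω hω => ?_).trans hprob
  by_contra hgood
  simp only [Set.mem_union, not_or] at hgood
  obtain ⟨⟨⟨hg₁, hg₂⟩, hg₃⟩, hg₄⟩ := hgood
  have htrunc : ∀ i ≤ n, InTrunc ω.1 K H (dfs ω.1 i) := fun i hi =>
    dfs_inTrunc ω.1 (not_le.1 hg₁) hg₂ hi
  refine hω ⟨?_, ?_⟩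
  · have h := le_capacity_range η hG ω htrunc (not_le.1 hg₃).le (by positivity)
    have hsq : (n : ℝ) ^ 2 = (n : ℝ) ^ (s - 9 * δ) * (n : ℝ) ^ (2 - s + 9 * δ) := by
      rw [← Real.rpow_add hn0, ← Real.rpow_natCast]; congr 1; push_cast; ring
    have hp : 0 < (n : ℝ) ^ (2 - s + 9 * δ) := Real.rpow_pos_of_pos hn0 _
    have hle : (n : ℝ) ^ (s - 9 * δ) ≤ 4 * C₃ * capacity η (range ω.1 ω.2 n) := by
      refine le_of_mul_le_mul_right ?_ hp
      rw [← hsq]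
      refine h.trans (le_of_eq ?_)
      rw [hE]; ring
    rw [inv_mul_le_iff₀ hC]
    refine hle.trans (mul_le_mul_of_nonneg_right ?_ ?_)
    · rw [hCdef]; linarith
    · rw [capacity_eq_toReal]; exact ENNReal.toReal_nonneg
  · obtain ⟨hR1, hR2, hR3⟩ := ceil_rpow_bounds hn (a := 1 / 4 + 2 * δ) (by linarith)
    set R := ⌈(n : ℝ) ^ (1 / 4 + 2 * δ)⌉₊
    have hbox : range ω.1 ω.2 n ⊆ box d R := by
      intro x hx
      obtain ⟨i, hi, rfl⟩ := Finset.mem_image.1 hx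
      rw [mem_box]
      intro l
      by_contra hcon
      refine hg₄ ⟨_, htrunc i (Nat.lt_succ_iff.1 (Finset.mem_range.1 hi)), l, hR2.trans ?_⟩
      exact_mod_cast (not_le.1 hcon).le
    have h := ENNReal.toReal_mono ENNReal.ofReal_ne_top (h₅ R _ hR1 hbox)
    rw [← capacity_eq_toReal, ENNReal.toReal_ofReal (by positivity)] at h
    refine h.trans ?_
    calc C₅ * (R : ℝ) ^ (d - 2) ≤ C₅ * (2 * (n : ℝ) ^ (1 / 4 + 2 * δ)) ^ (d - 2) := by gcongr
      _ = C₅ * 2 ^ (d - 2) * (n : ℝ) ^ ((1 / 4 + 2 * δ) * ((d - 2 : ℕ) : ℝ)) := by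
          rw [mul_pow, Real.rpow_mul_natCast hn0.le]; ring
      _ ≤ C * (n : ℝ) ^ (s + 9 * δ) := by
          have hcast : ((d - 2 : ℕ) : ℝ) = (d : ℝ) - 2 := by
            rw [Nat.cast_sub (by omega)]; norm_num
          gcongr
          · rw [hCdef]; linarith
          -- The loss is 2δ(d - 2) ≤ 6δ.
          · rw [hcast, hs]
            nlinarith

theorem capacity_range_mono (η : Measure (Lattice d)) [IsProbabilityMeasure η]
    (hG : ∀ z, green η z ≠ ∞) (N : Vertex → ℕ) (X : Vertex → Lattice d) :
    Monotone fun n => capacity η (range N X n) := by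
  intro m n hmn
  simp only [capacity_eq_toReal]
  refine ENNReal.toReal_mono (ecapacity_ne_top η _) (ecapacity_mono η hG ?_)
  exact Finset.image_subset_image (Finset.range_mono (by omega))

theorem ae_eventually_capacity_range (hd3 : 3 ≤ d) (hd5 : d ≤ 5) (μ : Measure ℕ)
    [IsProbabilityMeasure μ] (θ η : Measure (Lattice d)) [IsProbabilityMeasure θ]
    [IsProbabilityMeasure η] (hmean : ∫⁻ n, (n : ℝ≥0∞) ∂μ = 1)
    (hvar : ∫⁻ n, (n : ℝ≥0∞) ^ 2 ∂μ ≠ ∞) (hne : μ ≠ Measure.dirac 1)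
    (hη : IsIrreducible η) (hη_mean : ∀ i, ∫ x, (x i : ℝ) ∂η = 0)
    (hη_L2 : ∀ i, MemLp (fun x : Lattice d => (x i : ℝ)) 2 η)
    (hsymm : θ.map (fun x => -x) = θ) (hθ : IsIrreducible θ)
    (hexp : ∃ c : ℝ, 0 < c ∧ Integrable (fun x => Real.exp (c * euclNorm x)) θ)
    {κ : ℝ} (hκ : 0 < κ) (hκ1 : κ ≤ 1 / 4) :
    ∀ᵐ ω ∂(brwLaw μ θ), ∀ᶠ n : ℕ in atTop,
      (n : ℝ) ^ (((d : ℝ) - 2) / 4 - 2 * κ) ≤ capacity η (range ω.1 ω.2 n) ∧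
        capacity η (range ω.1 ω.2 n) ≤ (n : ℝ) ^ (((d : ℝ) - 2) / 4 + 2 * κ) := by
  -- With δ = κ/9 the exponents are off by κ, and the bad probabilities along n = 2^k form a
  -- geometric series. Since (d-2)/4 lies in [1/4, 3/4], κ ≤ 1/4 keeps both exponents in [0, 1], as
  -- the interpolation requires.
  have hδ : 0 < κ / 9 := by positivity
  obtain ⟨C, hC, hbad⟩ := exists_brwLaw_capacity_le hd3 hd5 μ θ η hmean hvar hne hη hη_mean hη_L2
    hsymm hθ hexp hδ
  have h9 : 9 * (κ / 9) = κ := by ring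
  rw [h9] at hbad
  have hd3' : (3 : ℝ) ≤ d := by exact_mod_cast hd3
  have hd5' : (d : ℝ) ≤ 5 := by exact_mod_cast hd5
  have hr0 : (0 : ℝ) < 2 ^ (-(κ / 9)) := by positivity
  have hr1 : (2 : ℝ) ^ (-(κ / 9)) < 1 :=
    Real.rpow_lt_one_of_one_lt_of_neg (by norm_num) (by linarith)
  have hsum : ∑' k : ℕ, brwLaw μ θ {ω | ¬ (C⁻¹ * ((2 ^ k : ℕ) : ℝ) ^ (((d : ℝ) - 2) / 4 - κ) ≤
          capacity η (range ω.1 ω.2 (2 ^ k)) ∧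
        capacity η (range ω.1 ω.2 (2 ^ k)) ≤
          C * ((2 ^ k : ℕ) : ℝ) ^ (((d : ℝ) - 2) / 4 + κ))} ≠ ∞ := by
    refine ne_top_of_le_ne_top ?_ (ENNReal.tsum_le_tsum fun k => hbad (2 ^ k) Nat.one_le_two_pow)
    have hterm : ∀ k : ℕ, C * ((2 ^ k : ℕ) : ℝ) ^ (-(κ / 9)) = C * (2 ^ (-(κ / 9))) ^ k := by
      intro k
      push_cast
      rw [← Real.rpow_natCast 2 k, ← Real.rpow_natCast (2 ^ (-(κ / 9))) k,
        ← Real.rpow_mul (by norm_num), ← Real.rpow_mul (by norm_num), mul_comm (k : ℝ)]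
    simp_rw [hterm]
    exact ((summable_geometric_of_lt_one hr0.le hr1).mul_left C).tsum_ofReal_ne_top
  filter_upwards [ae_eventually_notMem hsum] with ω hω
  refine eventually_rpow_le_of_dyadic (capacity_range_mono η (hη.green_ne_top hd3) ω.1 ω.2) hC hκ
    (by linarith) (by linarith) ?_
  filter_upwards [hω] with k hk
  exact not_not.1 hk

end GoodEvents

end BRWCapacity

end

/-! ### The almost sure exponent. -/

theorem proposition2p1 (d : ℕ) (hd : d = 3 ∨ d = 4 ∨ d = 5)
    (μ : Measure ℕ) [IsProbabilityMeasure μ]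
    (θ η : Measure (BRWCapacity.Lattice d)) [IsProbabilityMeasure θ] [IsProbabilityMeasure η]
    -- `μ` has mean 1 and finite variance, and is not the Dirac mass at 1
    (hμ_mean : ∫ k, (k : ℝ) ∂μ = 1)
    (hμ_var : MemLp (fun k : ℕ => (k : ℝ)) 2 μ)
    (hμ_ne : μ ≠ Measure.dirac 1)
    -- `η` is aperiodic, irreducible, centred, with finite moment of order `d + 1`
    (hη_aper : BRWCapacity.IsAperiodic η)
    (hη_irr : BRWCapacity.IsIrreducible η)
    (hη_mean : ∀ i : Fin d, ∫ x, (x i : ℝ) ∂η = 0)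
    (hη_mom : Integrable (fun x => BRWCapacity.euclNorm x ^ (d + 1)) η)
    -- `θ` is symmetric, irreducible, with some finite exponential moment
    (hθ_symm : θ.map (fun x => -x) = θ)
    (hθ_irr : BRWCapacity.IsIrreducible θ)
    (hθ_exp : ∃ c : ℝ, 0 < c ∧ Integrable (fun x => Real.exp (c * BRWCapacity.euclNorm x)) θ) :
    ∀ᵐ ω ∂(BRWCapacity.brwLaw μ θ),
      ∃ ε : ℕ → ℝ, Tendsto ε atTop (𝓝 0) ∧
        ∀ᶠ n : ℕ in atTop,
          BRWCapacity.capacity η (BRWCapacity.range ω.1 ω.2 n) =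
            (n : ℝ) ^ (((d : ℝ) - 2) / 4 + ε n) := by
  have hd3 : 3 ≤ d := by omega
  have hd5 : d ≤ 5 := by omega
  have hall : ∀ m : ℕ, ∀ᵐ ω ∂(BRWCapacity.brwLaw μ θ), ∀ᶠ n : ℕ in atTop,
      (n : ℝ) ^ (((d : ℝ) - 2) / 4 - 1 / ((m : ℝ) + 1)) ≤
          BRWCapacity.capacity η (BRWCapacity.range ω.1 ω.2 n) ∧
        BRWCapacity.capacity η (BRWCapacity.range ω.1 ω.2 n) ≤
          (n : ℝ) ^ (((d : ℝ) - 2) / 4 + 1 / ((m : ℝ) + 1)) := by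
    intro m
    have hm1 : 1 / ((m : ℝ) + 1) ≤ 1 := by
      rw [div_le_one (by positivity)]
      linarith [Nat.cast_nonneg (α := ℝ) m]
    -- The division by 4 gives κ ≤ 1/4, and 2κ is then below the tolerance 1/(m + 1). Countably many
    -- tolerances suffice for an almost sure statement.
    have hκ : (0 : ℝ) < 1 / ((m : ℝ) + 1) / 4 := by positivity
    filter_upwards [BRWCapacity.ae_eventually_capacity_range hd3 hd5 μ θ η
      (BRWCapacity.lintegral_natCast_eq_one hμ_mean hμ_var)
      (BRWCapacity.lintegral_natCast_sq_ne_top hμ_var) hμ_ne hη_irr hη_mean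
      (BRWCapacity.memLp_two_coord (by omega) hη_mom) hθ_symm hθ_irr hθ_exp hκ (by linarith)]
      with ω hω
    filter_upwards [hω, eventually_ge_atTop 1] with n hn hn1
    have hn1' : (1 : ℝ) ≤ n := by exact_mod_cast hn1
    exact ⟨(Real.rpow_le_rpow_of_exponent_le hn1' (by linarith)).trans hn.1,
      hn.2.trans (Real.rpow_le_rpow_of_exponent_le hn1' (by linarith))⟩
  filter_upwards [ae_all_iff.2 hall] with ω hω
  exact BRWCapacity.exists_exponent_of_forall _ _ hω
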